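/- Let $\mathbb T=\mathbb R/2\pi\mathbb Z$, $\alpha\in\mathbb R$ and $\varphi\in C^\infty(\mathbb T;\mathbb R)$. On $L^2(\mathbb T;\mathbb C)$ consider $L=-\partial_x^3+i\alpha\partial_x^2$ with domain $H^3(\mathbb T)$ and, for $f\in C^\infty(\mathbb T;\mathbb R)$, $T_f=f\partial_x+\tfrac12 f'$ with domain $\{\psi\in L^2(\mathbb T): f\partial_x\psi\in L^2(\mathbb T)\}$. For $\tau>0$ set $g_\tau=(\varphi')^3+\alpha\sqrt\tau\,(\varphi')^2$ and, for integers $n\ge 1$, $$W_{\tau,n}=\Big(e^{\frac{i g_\tau}{n\sqrt\tau}}\,e^{\frac{i\varphi}{\sqrt\tau}}\,e^{\frac{\tau}{n} L}\,e^{-\frac{i\varphi}{\sqrt\tau}}\Big)^n .$$ Put $f=3(\varphi')^2$. Then $L$ and $T_f$ generate strongly continuous unitary groups $(e^{tL})_{t\in\mathbb R}$ and $(e^{tT_f})_{t\in\mathbb R}$ on $L^2(\mathbb T)$, and for every $\psi\in L^2(\mathbb T)$ the following limits exist in $L^2(\mathbb T)$ and satisfy $$\lim_{\tau\to0^+}\Big(\lim_{n\to\infty}W_{\tau,n}\psi\Big)=e^{T_f}\psi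 .$$ Moreover, let $q\in\mathbb N$ and let $Q=(Q_0,\dots,Q_{q-1})$ be smooth real functions on $\mathbb T$ with $\{1,\sin x,\cos x,\sin 2x,\cos 2x\}\subset\mathrm{span}\{Q_0,\dots,Q_{q-1}\}$. Then $e^{T_f}$ is $L^2$-STAR for the equation $$\partial_t\psi+\partial_x^3\psi-i\alpha\partial_x^2\psi=i(u\cdot Q)\psi,\qquad \psi(0)=\psi_0,$$ that is: for every $\psi_0\in L^2(\mathbb T)$ with $\|\psi_0\|_{L^2}=1$ and every $\varepsilon>0$ there exist $T\in[0,\varepsilon]$, $\beta\in[0,2\pi)$ and a piecewise constant control $u:[0,T]\to\mathbb R^q$ such that the solution $\psi\in C([0,T];L^2(\mathbb T))$ of the equation (in the sense of Duhamel's formula) satisfies $\|\psi(T)-e^{i\beta}e^{T_f}\psi_0\|_{L^2}<\varepsilon$. -/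

import Mathlib

open MeasureTheory Filter Topology Set
open scoped Real ContDiff

noncomputable section

namespace KdVTransport

/-! ### Strongly continuous unitary groups and their generators -/

section UnitaryGroup

variable {H : Type*} [NormedAddCommGroup H] [InnerProductSpace ℂ H]

/-- `U` is a strongly continuous one-parameter unitary group on `H`, and its infinitesimal
generator is exactly the densely defined operator with graph `A`: a pair `(ψ, η)` lies in `A`
(that is, `ψ` is in the domain and is mapped to `η`) if and only if `t ↦ U t ψ` is differentiable
at `0` with derivative `η`. -/
structure IsUnitaryGroupGeneratedBy (U : ℝ → H ≃ₗᵢ[ℂ] H) (A : Set (H × H)) : Prop where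
  dense_domain : Dense {ψ : H | ∃ η, (ψ, η) ∈ A}
  map_zero : ∀ ψ, U 0 ψ = ψ
  map_add : ∀ s t ψ, U (s + t) ψ = U s (U t ψ)
  continuous : ∀ ψ, Continuous fun t => U t ψ
  generator : ∀ ψ η, (ψ, η) ∈ A ↔ HasDerivAt (fun t => U t ψ) η 0

open Classical in
/-- The group `(e^{tA})_{t ∈ ℝ}`: the strongly continuous unitary group generated by the operator
with graph `A` (by convention the identity if `A` generates no such group). -/
def expGroup (A : Set (H × H)) : ℝ → H ≃ₗᵢ[ℂ] H :=
  if h : ∃ U : ℝ → H ≃ₗᵢ[ℂ] H, IsUnitaryGroupGeneratedBy U A then h.choose else fun _ => 1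

theorem IsUnitaryGroupGeneratedBy.hasDerivAt {U : ℝ → H ≃ₗᵢ[ℂ] H} {A : Set (H × H)}
    (h : IsUnitaryGroupGeneratedBy U A) {ψ η : H} (hA : (ψ, η) ∈ A) (t : ℝ) :
    HasDerivAt (fun s => U s ψ) (U t η) t := by
  have h0 : HasDerivAt (fun s => U s ψ) η (t - t) := by
    simpa using (h.generator ψ η).1 hA
  have h1 : HasDerivAt (fun s : ℝ => U (s - t) ψ) η t := by
    simpa using h0.comp_sub_const t t
  have h2 := ((U t).toContinuousLinearEquiv.toContinuousLinearMap.restrictScalars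
    ℝ).hasFDerivAt.comp_hasDerivAt t h1
  refine h2.congr_of_eventuallyEq (Eventually.of_forall fun s => ?_)
  have := h.map_add t (s - t) ψ
  simpa using this

/-- A unitary group is determined by its generator. -/
theorem IsUnitaryGroupGeneratedBy.unique {U V : ℝ → H ≃ₗᵢ[ℂ] H} {A : Set (H × H)}
    (hU : IsUnitaryGroupGeneratedBy U A) (hV : IsUnitaryGroupGeneratedBy V A) : U = V := by
  have skew : ∀ ψ η ψ' η', (ψ, η) ∈ A → (ψ', η') ∈ A →
      inner ℂ ψ η' + inner ℂ η ψ' = 0 := by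
    intro ψ η ψ' η' h1 h2
    have d1 := (hU.generator _ _).1 h1
    have d2 := (hU.generator _ _).1 h2
    have d := d1.inner ℂ d2
    have hc : (fun t => inner ℂ (U t ψ) (U t ψ')) = fun _ => inner ℂ ψ ψ' := by
      funext t
      exact (U t).inner_map_map ψ ψ'
    rw [hc] at d
    have := d.unique (hasDerivAt_const (0 : ℝ) (inner ℂ ψ ψ'))
    simpa [hU.map_zero] using this
  have inv : ∀ {W : ℝ → H ≃ₗᵢ[ℂ] H}, IsUnitaryGroupGeneratedBy W A →
      ∀ {ψ η}, (ψ, η) ∈ A → ∀ t, (W t ψ, W t η) ∈ A := by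
    intro W hW ψ η hA t
    rw [hW.generator]
    have h2 := ((W t).toContinuousLinearEquiv.toContinuousLinearMap.restrictScalars
      ℝ).hasFDerivAt.comp_hasDerivAt 0 ((hW.generator _ _).1 hA)
    refine h2.congr_of_eventuallyEq (Eventually.of_forall fun s => ?_)
    have e1 := hW.map_add t s ψ
    have e2 := hW.map_add s t ψ
    rw [add_comm] at e2
    simpa using e2.symm.trans e1
  funext t
  ext ψ
  have key : ∀ ψ ∈ {ψ : H | ∃ η, (ψ, η) ∈ A}, U t ψ = V t ψ := by
    rintro ψ ⟨η, hA⟩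
    have hd : ∀ s, HasDerivAt (fun s => inner ℂ (U s ψ) (V s ψ)) 0 s := by
      intro s
      have d := (hU.hasDerivAt hA s).inner ℂ (hV.hasDerivAt hA s)
      rwa [skew _ _ _ _ (inv hU hA s) (inv hV hA s)] at d
    have hc : inner ℂ (U t ψ) (V t ψ) = inner ℂ ψ ψ := by
      have := is_const_of_deriv_eq_zero (fun s => (hd s).differentiableAt)
        (fun s => (hd s).deriv) t 0
      simpa [hU.map_zero, hV.map_zero] using this
    have hn : ‖U t ψ - V t ψ‖ ^ 2 = 0 := by
      have h1 := @norm_sub_sq ℂ H _ _ _ (U t ψ) (V t ψ)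
      rw [h1, hc, LinearIsometryEquiv.norm_map, LinearIsometryEquiv.norm_map,
        inner_self_eq_norm_sq]
      ring
    exact sub_eq_zero.1 (norm_eq_zero.1 (pow_eq_zero_iff (two_ne_zero)|>.1 hn))
  have := Continuous.ext_on hU.dense_domain (U t).continuous (V t).continuous key
  exact congrFun this ψ

theorem IsUnitaryGroupGeneratedBy.expGroup_eq {U : ℝ → H ≃ₗᵢ[ℂ] H} {A : Set (H × H)}
    (hU : IsUnitaryGroupGeneratedBy U A) : expGroup A = U := by
  have h : ∃ U : ℝ → H ≃ₗᵢ[ℂ] H, IsUnitaryGroupGeneratedBy U A := ⟨U, hU⟩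
  unfold expGroup
  rw [dif_pos h]
  exact h.choose_spec.unique hU

end UnitaryGroup

/-! ### The circle -/

instance factTwoPiPos : Fact (0 < 2 * π) := ⟨Real.two_pi_pos⟩

/-- The torus `𝕋 = ℝ / 2πℤ`. -/
abbrev Torus : Type := AddCircle (2 * π)

/-- `L²(𝕋; ℂ)`, for the Haar measure on the torus normalised to mass one. -/
abbrev L2 : Type := Lp ℂ 2 (AddCircle.haarAddCircle : Measure Torus)

/-- `F ∈ C^∞(𝕋; E)`. -/
def IsSmooth {E : Type*} [NormedAddCommGroup E] [NormedSpace ℝ E] (F : Torus → E) : Prop :=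
  ContDiff ℝ ∞ fun x : ℝ => F (x : Torus)

/-- The derivative `F'` of a function on the torus. -/
def dx {E : Type*} [NormedAddCommGroup E] [NormedSpace ℝ E] (F : Torus → E) (x : Torus) : E :=
  deriv (fun h : ℝ => F (x + (h : Torus))) 0

open Classical in
/-- Multiplication `ψ ↦ m ψ` by a continuous function `m` (the value is `0` by convention if `m ψ`
is not in `L²`, which does not happen when `m` is continuous). -/
def mulOp (m : Torus → ℂ) (ψ : L2) : L2 :=
  if h : MemLp (fun x => m x * ψ x) 2 (AddCircle.haarAddCircle : Measure Torus) then
    h.toLp _ else 0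

theorem coeFn_mulOp {m : Torus → ℂ} (hm : Continuous m) (ψ : L2) :
    mulOp m ψ =ᵐ[AddCircle.haarAddCircle] fun x => m x * ψ x := by
  have h : MemLp (fun x => m x * ψ x) 2 (AddCircle.haarAddCircle : Measure Torus) := by
    obtain ⟨C, hC⟩ := isCompact_univ.exists_bound_of_continuousOn hm.continuousOn
    have h1 : MemLp m ⊤ (AddCircle.haarAddCircle : Measure Torus) :=
      memLp_top_of_bound hm.aestronglyMeasurable C
        (Eventually.of_forall fun x => hC x (mem_univ x))
    exact (Lp.memLp ψ).mul h1
  unfold mulOp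
  rw [dif_pos h]
  exact h.coeFn_toLp

/-- The phase operator `ψ ↦ e^{iθ} ψ`. -/
def phase (θ : Torus → ℝ) : L2 → L2 :=
  mulOp fun x => Complex.exp (Complex.I * (θ x : ℂ))

/-! ### The operators `L` and `T_f` -/

/-- The `k`-th Fourier coefficient. -/
abbrev fc (ψ : L2) (k : ℤ) : ℂ := fourierCoeff (ψ : Torus → ℂ) k

/-- `ψ ∈ H^s(𝕋)`, for `s ≥ 0`. -/
def MemSobolev (s : ℝ) (ψ : L2) : Prop :=
  Summable fun k : ℤ => (1 + (k : ℝ) ^ 2) ^ s * ‖fc ψ k‖ ^ 2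

/-- The graph of `L = -∂ₓ³ + iα∂ₓ²` with domain `H³(𝕋)`; the distributional derivative acts on the
`k`-th Fourier coefficient as multiplication by `ik`. -/
def opL (α : ℝ) : Set (L2 × L2) :=
  {p | MemSobolev 3 p.1 ∧ ∀ k : ℤ, fc p.2 k =
    (-(Complex.I * (k : ℂ)) ^ 3 + Complex.I * (α : ℂ) * (Complex.I * (k : ℂ)) ^ 2) * fc p.1 k}

/-- `f ∂ₓψ = ζ` in the sense of distributions, for `f` smooth and real valued:
`∫ ζ θ = - ∫ ψ (f θ)'` for every smooth `θ`. -/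
def IsWeakTransport (f : Torus → ℝ) (ψ ζ : L2) : Prop :=
  ∀ θ : Torus → ℂ, IsSmooth θ →
    ∫ x, ζ x * θ x ∂AddCircle.haarAddCircle =
      -∫ x, ψ x * dx (fun y => (f y : ℂ) * θ y) x ∂AddCircle.haarAddCircle

/-- The graph of `T_f = f ∂ₓ + ½ f'` with domain `{ψ ∈ L² : f ∂ₓψ ∈ L²}`. -/
def opT (f : Torus → ℝ) : Set (L2 × L2) :=
  {p | ∃ ζ : L2, IsWeakTransport f p.1 ζ ∧
    p.2 = ζ + mulOp (fun x => ((1 / 2 * dx f x : ℝ) : ℂ)) p.1}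

/-! ### The approximating products -/

/-- `g_τ = (φ')³ + α √τ (φ')²`. -/
def gFun (α : ℝ) (φ : Torus → ℝ) (τ : ℝ) (x : Torus) : ℝ :=
  dx φ x ^ 3 + α * √τ * dx φ x ^ 2

/-- `W_{τ,n} = (e^{i g_τ / (n√τ)} e^{i φ / √τ} e^{τ L / n} e^{-i φ / √τ})^n`. -/
def W (α : ℝ) (φ : Torus → ℝ) (τ : ℝ) (n : ℕ) : L2 → L2 :=
  (fun ψ => phase (fun x => gFun α φ τ x / (n * √τ))
    (phase (fun x => φ x / √τ)
      (expGroup (opL α) (τ / n)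
        (phase (fun x => -(φ x / √τ)) ψ))))^[n]

/-! ### The controlled equation and reachable operators -/

/-- `u ∈ PWC(0,T;ℝ^q)`: `u` is constant on each open interval of a finite subdivision of `[0,T]`. -/
def IsPWC {q : ℕ} (T : ℝ) (u : ℝ → Fin q → ℝ) : Prop :=
  ∃ (m : ℕ) (t : ℕ → ℝ), Monotone t ∧ t 0 = 0 ∧ t m = T ∧
    ∀ i < m, ∃ c : Fin q → ℝ, ∀ s ∈ Ioo (t i) (t (i + 1)), u s = c

/-- `ψ ∈ C([0,T];L²)` is the (mild) solution on `[0,T]` of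
`∂ₜψ + ∂ₓ³ψ - iα∂ₓ²ψ = i (u·Q) ψ`, `ψ(0) = ψ₀`, i.e. Duhamel's formula holds. -/
def IsSolution {q : ℕ} (α : ℝ) (Q : Fin q → Torus → ℝ) (T : ℝ) (u : ℝ → Fin q → ℝ)
    (ψ₀ : L2) (ψ : ℝ → L2) : Prop :=
  ContinuousOn ψ (Icc 0 T) ∧ ∀ t ∈ Icc 0 T,
    ψ t = expGroup (opL α) t ψ₀ + ∫ s in (0 : ℝ)..t, expGroup (opL α) (t - s)
      (mulOp (fun x => Complex.I * ((∑ j, u s j * Q j x : ℝ) : ℂ)) (ψ s))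

/-- The unitary operator `S` is `L²`-STAR (small-time approximately reachable) for the equation
with parameter `α` and control profiles `Q`. -/
def IsSTAR {q : ℕ} (α : ℝ) (Q : Fin q → Torus → ℝ) (S : L2 ≃ₗᵢ[ℂ] L2) : Prop :=
  ∀ ψ₀ : L2, ‖ψ₀‖ = 1 → ∀ ε > 0, ∃ T ∈ Icc 0 ε, ∃ β ∈ Ico 0 (2 * π),
    ∃ u : ℝ → Fin q → ℝ, IsPWC T u ∧ ∃ ψ : ℝ → L2, IsSolution α Q T u ψ₀ ψ ∧
      ‖ψ T - Complex.exp (Complex.I * (β : ℂ)) • S ψ₀‖ < ε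

/-- The function `sin` on the torus. -/
def sinT : Torus → ℝ := Real.sin_periodic.lift
/-- The function `cos` on the torus. -/
def cosT : Torus → ℝ := Real.cos_periodic.lift

/-- The control profiles are smooth and
`{1, sin x, cos x, sin 2x, cos 2x} ⊆ span {Q_0, …, Q_{q-1}}`. -/
def IsAdmissible {q : ℕ} (Q : Fin q → Torus → ℝ) : Prop :=
  (∀ j, IsSmooth (Q j)) ∧
    {(fun _ => 1), sinT, cosT, (fun x => sinT (2 • x)), (fun x => cosT (2 • x))} ⊆
      (Submodule.span ℝ (Set.range Q) : Set (Torus → ℝ))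

end KdVTransport

end

open KdVTransport

open MeasureTheory Filter Topology Set
open scoped Real ContDiff

noncomputable section

/-! The limits come from an exact identity. Conjugation by a phase turns `L` into a differential
operator with large lower-order terms: if θ' = c b, then on smooth functions e^{iθ} L e^{-iθ} equals
L, plus c times a second-order operator, plus c² (T_{3b²} - iα b²), minus i c³ b³
(`Smooth.expI_mul_L`). Take θ = φ/√τ, so c = 1/√τ and b = φ', multiply by τ, and add i g_τ/√τ. The
terms -i b³/√τ and -iα b² cancel exactly. What remains is T_f + √τ (second order) + τ L, which tends
to T_f on each smooth function.

For fixed τ the perturbed operator is a unitary generator plus a bounded skew operator, so the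
Lie–Trotter formula (`IsPerturbation.tendsto_trotter`) identifies the limit in n with the perturbed
group at time one. The limit in τ is `IsUnitaryGroup.tendsto_of_core`, a Trotter–Kato argument
without resolvents: generators need only converge on a dense set preserved by the limit group and
its generator. That set is C^∞(𝕋). It is preserved because e^{tT_f} is explicit there, namely
composition with the flow of f times the square root of the Jacobian.

Both groups are first built on a dense subspace (trigonometric polynomials for `L`, smooth functions
for `T_f`) and extended by isometry. By `IsUnitaryGroup.hasDerivAt_iff_weak` the generator is minus
the adjoint of its restriction to such a subspace, and this matches the Fourier domain of `opL` and
the distributional domain of `opT`.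

For reachability, approximately reachable operators are closed under composition and strong limits,
so it suffices to reach all phases in arbitrarily small time. Large controls on short intervals give
the phases of the span of `Q`. Conjugating by θ/ε during time ε³t isolates the cubic term and gives
the phase -t(θ')³. Polarisation then gives products of three derivatives, which generate every
Fourier mode from the frequencies up to 2, and uniform density gives every continuous phase. Hence
W_{τ,n} is reachable in time τ, and both limits lead to time 0. -/

namespace KdVTransport

/-! ### Unitary groups and convergence from convergence of generators on a core. -/

section AbstractGroups

variable {H : Type*} [NormedAddCommGroup H] [InnerProductSpace ℂ H]

/-- A strongly continuous one-parameter group of unitary operators. -/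
structure IsUnitaryGroup (U : ℝ → H ≃ₗᵢ[ℂ] H) : Prop where
  map_zero : ∀ ψ, U 0 ψ = ψ
  map_add : ∀ s t ψ, U (s + t) ψ = U s (U t ψ)
  continuous : ∀ ψ, Continuous fun t => U t ψ

theorem IsUnitaryGroupGeneratedBy.isUnitaryGroup {U : ℝ → H ≃ₗᵢ[ℂ] H} {A : Set (H × H)}
    (h : IsUnitaryGroupGeneratedBy U A) : IsUnitaryGroup U :=
  ⟨h.map_zero, h.map_add, h.continuous⟩

theorem _root_.LinearIsometryEquiv.hasDerivAt_comp (T : H ≃ₗᵢ[ℂ] H) {w : ℝ → H} {w' : H} {t : ℝ}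
    (h : HasDerivAt w w' t) : HasDerivAt (fun s => T (w s)) (T w') t :=
  (T.toContinuousLinearEquiv.toContinuousLinearMap.restrictScalars
    ℝ).hasFDerivAt.comp_hasDerivAt t h

theorem _root_.LinearIsometryEquiv.map_real_smul (T : H ≃ₗᵢ[ℂ] H) (r : ℝ) (x : H) :
    T (r • x) = r • T x :=
  LinearMapClass.map_smul_of_tower T r x

namespace IsUnitaryGroup

variable {U : ℝ → H ≃ₗᵢ[ℂ] H}

theorem neg_apply (hU : IsUnitaryGroup U) (t : ℝ) (ψ : H) : U (-t) (U t ψ) = ψ := by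
  rw [← hU.map_add, neg_add_cancel, hU.map_zero]

theorem apply_neg (hU : IsUnitaryGroup U) (t : ℝ) (ψ : H) : U t (U (-t) ψ) = ψ := by
  rw [← hU.map_add, add_neg_cancel, hU.map_zero]

theorem inner_left (hU : IsUnitaryGroup U) (t : ℝ) (a b : H) :
    inner ℂ (U t a) b = inner ℂ a (U (-t) b) := by
  conv_lhs => rw [← hU.apply_neg t b]
  exact (U t).inner_map_map _ _

theorem continuous_uncurry (hU : IsUnitaryGroup U) : Continuous fun p : ℝ × H => U p.1 p.2 := by
  rw [continuous_iff_continuousAt]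
  rintro ⟨t, x⟩
  rw [ContinuousAt, tendsto_iff_norm_sub_tendsto_zero]
  have h1 : Tendsto (fun p : ℝ × H => ‖p.2 - x‖ + ‖U p.1 x - U t x‖) (𝓝 (t, x)) (𝓝 0) := by
    have : Continuous fun p : ℝ × H => ‖p.2 - x‖ + ‖U p.1 x - U t x‖ :=
      (continuous_snd.sub continuous_const).norm.add
        (((hU.continuous x).comp continuous_fst).sub continuous_const).norm
    simpa using this.tendsto (t, x)
  refine squeeze_zero (fun _ => norm_nonneg _) (fun p => ?_) h1
  calc ‖U p.1 p.2 - U t x‖ = ‖U p.1 (p.2 - x) + (U p.1 x - U t x)‖ := by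
        rw [map_sub]; congr 1; abel
    _ ≤ _ := (norm_add_le _ _).trans (by rw [LinearIsometryEquiv.norm_map])

theorem continuous_apply {X : Type*} [TopologicalSpace X] (hU : IsUnitaryGroup U) {a : X → ℝ}
    {b : X → H} (ha : Continuous a) (hb : Continuous b) : Continuous fun x => U (a x) (b x) :=
  hU.continuous_uncurry.comp (ha.prodMk hb)

theorem hasDerivAt (hU : IsUnitaryGroup U) {ψ η : H} (h : HasDerivAt (fun t => U t ψ) η 0)
    (t : ℝ) : HasDerivAt (fun s => U s ψ) (U t η) t := by
  have h0 : HasDerivAt (fun s => U s ψ) η (t - t) := by simpa using h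
  have h1 : HasDerivAt (fun s : ℝ => U (s - t) ψ) η t := by
    simpa using h0.comp_sub_const t t
  refine ((U t).hasDerivAt_comp h1).congr_of_eventuallyEq (Eventually.of_forall fun s => ?_)
  have := hU.map_add t (s - t) ψ
  simpa using this

theorem hasDerivAt_neg (hU : IsUnitaryGroup U) {ψ η : H} (h : HasDerivAt (fun t => U t ψ) η 0)
    (t : ℝ) : HasDerivAt (fun s => U (-s) ψ) (-U (-t) η) t := by
  have := (hU.hasDerivAt h (-t)).scomp t (_root_.hasDerivAt_neg t)
  rw [neg_one_smul] at this
  exact this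

/-- The generator is unchanged along an orbit. -/
theorem hasDerivAt_orbit (hU : IsUnitaryGroup U) {ψ η : H}
    (h : HasDerivAt (fun t => U t ψ) η 0) (t : ℝ) :
    HasDerivAt (fun s => U s (U t ψ)) (U t η) 0 := by
  refine ((U t).hasDerivAt_comp h).congr_of_eventuallyEq (Eventually.of_forall fun s => ?_)
  simp only
  rw [← hU.map_add, ← hU.map_add, add_comm]

/-- A product rule that needs only strong continuity: the increment splits into U t applied to the
remainder of w, t(U t b - b), and the increment of the fixed orbit. Isometry controls the first,
strong continuity the second. -/
theorem hasDerivAt_apply (hU : IsUnitaryGroup U) {w : ℝ → H} {a b : H}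
    (hw : HasDerivAt w b 0) (ha : HasDerivAt (fun t => U t (w 0)) a 0) :
    HasDerivAt (fun t => U t (w t)) (a + b) 0 := by
  rw [hasDerivAt_iff_isLittleO] at hw ha ⊢
  simp only [sub_zero] at hw ha ⊢
  have h1 : (fun t => U t (w t - w 0 - t • b)) =o[𝓝 0] fun t : ℝ => t := by
    rw [← Asymptotics.isLittleO_norm_left]
    simpa only [LinearIsometryEquiv.norm_map] using hw.norm_left
  have h2 : (fun t : ℝ => t • (U t b - b)) =o[𝓝 0] fun t : ℝ => t := by
    have h3 : (fun t : ℝ => U t b - b) =o[𝓝 0] fun _ : ℝ => (1 : ℝ) := by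
      rw [Asymptotics.isLittleO_one_iff]
      have := ((hU.continuous b).sub continuous_const).tendsto (f := fun t => U t b - b) 0
      simpa [hU.map_zero] using this
    simpa using (Asymptotics.isBigO_refl (fun t : ℝ => t) (𝓝 0)).smul_isLittleO h3
  refine ((h1.add h2).add ha).congr_left fun t => ?_
  simp only [map_sub, LinearIsometryEquiv.map_real_smul, hU.map_zero, smul_sub, smul_add]
  abel

/-- The group differs little from its first order expansion. -/
theorem norm_apply_sub_le (hU : IsUnitaryGroup U) {x v a b : H}
    (hx : HasDerivAt (fun t => U t x) a 0) (hv : HasDerivAt (fun t => U t v) b 0) {h : ℝ}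
    (hh : 0 ≤ h) : ‖U h x - (x + h • v)‖ ≤ h * (‖v - a‖ + h * ‖b‖) := by
  -- Pulling the expansion back by the group gives the curve U(-r)(x + r v), whose derivative is
  -- small when v is close to a. The mean value inequality on [0, h], followed by U h, gives the
  -- bound.
  have hd : ∀ r : ℝ, HasDerivAt (fun r : ℝ => U (-r) x + r • U (-r) v)
      (U (-r) (v - a) - r • U (-r) b) r := by
    intro r
    have h1 := (hU.hasDerivAt_neg hx r).add
      ((hasDerivAt_id r).smul (hU.hasDerivAt_neg hv r))
    refine h1.congr_deriv ?_
    simp only [map_sub, id, smul_neg, one_smul]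
    abel
  have hb : ∀ r ∈ Icc 0 h, ‖U (-r) (v - a) - r • U (-r) b‖ ≤ ‖v - a‖ + h * ‖b‖ := by
    intro r hr
    refine (norm_sub_le _ _).trans ?_
    rw [norm_smul, LinearIsometryEquiv.norm_map, LinearIsometryEquiv.norm_map, Real.norm_eq_abs,
      abs_of_nonneg hr.1]
    gcongr
    exact hr.2
  have := (convex_Icc 0 h).norm_image_sub_le_of_norm_hasDerivWithin_le
    (fun r _ => (hd r).hasDerivWithinAt) hb (left_mem_Icc.2 hh) (right_mem_Icc.2 hh)
  have e : U h x - (x + h • v) =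
      -U h ((U (-h) x + h • U (-h) v) - (U (-0) x + (0 : ℝ) • U (-0) v)) := by
    rw [neg_zero, hU.map_zero, zero_smul, add_zero, map_sub, _root_.map_add,
      LinearIsometryEquiv.map_real_smul, hU.apply_neg, hU.apply_neg]
    abel
  rw [e, norm_neg, LinearIsometryEquiv.norm_map]
  refine this.trans_eq ?_
  rw [sub_zero, Real.norm_eq_abs, abs_of_nonneg hh, mul_comm]

end IsUnitaryGroup

/-- Telescoping: if F is a contraction, the one-step errors committed along the orbit of G are not
amplified. -/
theorem norm_iterate_sub_iterate_le {E : Type*} [SeminormedAddCommGroup E] {F G : E → E}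
    (hF : ∀ x y, ‖F x - F y‖ ≤ ‖x - y‖) (x : E) (n : ℕ) :
    ‖F^[n] x - G^[n] x‖ ≤ ∑ j ∈ Finset.range n, ‖F (G^[j] x) - G (G^[j] x)‖ := by
  induction n with
  | zero => simp
  | succ n ih =>
    rw [Finset.sum_range_succ, Function.iterate_succ_apply', Function.iterate_succ_apply']
    calc ‖F (F^[n] x) - G (G^[n] x)‖
        = ‖(F (F^[n] x) - F (G^[n] x)) + (F (G^[n] x) - G (G^[n] x))‖ := by congr 1; abel
      _ ≤ _ := (norm_add_le _ _).trans (add_le_add_left ((hF _ _).trans ih) _)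

theorem IsUnitaryGroup.iterate_apply {U : ℝ → H ≃ₗᵢ[ℂ] H} (hU : IsUnitaryGroup U) (h : ℝ)
    (n : ℕ) (x : H) : (U h)^[n] x = U (n * h) x := by
  induction n with
  | zero => simp [hU.map_zero]
  | succ n ih =>
    rw [Function.iterate_succ_apply', ih, ← hU.map_add]
    congr 2
    push_cast; ring

/-- Unitary groups converge strongly if their generators converge on a dense set which is
invariant under the limit group and its generator. -/
theorem IsUnitaryGroup.tendsto_of_core {ι S : Type*} {l : Filter ι} {V : ι → ℝ → H ≃ₗᵢ[ℂ] H}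
    (hV : ∀ i, IsUnitaryGroup (V i)) {U : ℝ → H ≃ₗᵢ[ℂ] H} (hU : IsUnitaryGroup U)
    {e : S → H} (he : DenseRange e) {G : S → S}
    (hG : ∀ F, HasDerivAt (fun t => U t (e F)) (e (G F)) 0)
    (hinv : ∀ t F, ∃ F', U t (e F) = e F') {A : ι → S → H}
    (hA : ∀ i F, HasDerivAt (fun t => V i t (e F)) (A i F) 0)
    (hlim : ∀ F, Tendsto (fun i => A i F) l (𝓝 (e (G F)))) {t : ℝ} (ht : 0 ≤ t) (ψ : H) :
    Tendsto (fun i => V i t ψ) l (𝓝 (U t ψ)) := by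
  have key : ∀ F, Tendsto (fun i => V i t (e F)) l (𝓝 (U t (e F))) := by
    intro F
    rw [tendsto_iff_norm_sub_tendsto_zero, Metric.tendsto_nhds]
    intro ε hε
    -- Each of the N steps of length t/N costs, in the limit, h²‖G²F‖ for `V i` and the same for U.
    -- The total is 2t²‖G²F‖/N, and N is chosen to make it less than ε before the limit in i is
    -- taken.
    obtain ⟨N, hN⟩ := exists_nat_gt (2 * t ^ 2 * ‖e (G (G F))‖ / ε)
    have hN0 : 0 < (N : ℝ) := lt_of_le_of_lt (by positivity) hN
    set h := t / N with hh
    have hh0 : 0 ≤ h := by positivity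
    have hNh : N * h = t := by rw [hh]; field_simp
    choose c hc using fun j : ℕ => hinv (j * h) F
    -- The generator commutes with its group, so G and G² have constant norm along the orbit and one
    -- bound serves all steps.
    have hGc : ∀ j, e (G (c j)) = U (j * h) (e (G F)) := fun j => by
      have h1 := hU.hasDerivAt_orbit (hG F) (j * h)
      rw [hc j] at h1
      exact (hG (c j)).unique h1
    have hGGc : ∀ j, ‖e (G (G (c j)))‖ = ‖e (G (G F))‖ := fun j => by
      have h1 := hU.hasDerivAt_orbit (hG (G F)) (j * h)
      rw [← hGc j] at h1
      rw [(hG (G (c j))).unique h1, LinearIsometryEquiv.norm_map]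
    have hbound : ∀ i, ‖V i t (e F) - U t (e F)‖ ≤ ∑ j ∈ Finset.range N,
        (h * (‖e (G (c j)) - A i (c j)‖ + h * ‖A i (G (c j))‖) + h * (h * ‖e (G (G F))‖)) := by
      intro i
      have h1 := norm_iterate_sub_iterate_le (F := V i h) (G := U h)
        (fun x y => by rw [← map_sub, LinearIsometryEquiv.norm_map]) (e F) N
      rw [(hV i).iterate_apply, hU.iterate_apply, hNh] at h1
      refine h1.trans (Finset.sum_le_sum fun j _ => ?_)
      rw [hU.iterate_apply, hc j]
      have h2 := (hV i).norm_apply_sub_le (hA i (c j)) (hA i (G (c j))) hh0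
      have h3 := hU.norm_apply_sub_le (hG (c j)) (hG (G (c j))) hh0
      rw [sub_self, norm_zero, zero_add, hGGc] at h3
      calc _ = ‖(V i h (e (c j)) - (e (c j) + h • e (G (c j)))) -
            (U h (e (c j)) - (e (c j) + h • e (G (c j))))‖ := by congr 1; abel
        _ ≤ _ := (norm_sub_le _ _).trans (add_le_add h2 h3)
    have hlim' : Tendsto (fun i => ∑ j ∈ Finset.range N,
        (h * (‖e (G (c j)) - A i (c j)‖ + h * ‖A i (G (c j))‖) + h * (h * ‖e (G (G F))‖))) l
        (𝓝 (∑ j ∈ Finset.range N,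
          (h * (‖e (G (c j)) - e (G (c j))‖ + h * ‖e (G (G (c j)))‖) +
            h * (h * ‖e (G (G F))‖)))) := by
      refine tendsto_finsetSum _ fun j _ => ?_
      exact (((tendsto_const_nhds.sub (hlim (c j))).norm.add
        ((hlim (G (c j))).norm.const_mul h)).const_mul h).add_const _
    have hlt : ∑ j ∈ Finset.range N,
          (h * (‖e (G (c j)) - e (G (c j))‖ + h * ‖e (G (G (c j)))‖) +
            h * (h * ‖e (G (G F))‖)) < ε := by
      simp only [sub_self, norm_zero, zero_add, hGGc, Finset.sum_const, Finset.card_range,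
        nsmul_eq_mul]
      rw [div_lt_iff₀ hε] at hN
      have : (N : ℝ) * (h * (h * ‖e (G (G F))‖) + h * (h * ‖e (G (G F))‖)) =
          2 * t ^ 2 * ‖e (G (G F))‖ / N := by
        rw [hh]; field_simp; ring
      rw [this, div_lt_iff₀ hN0, mul_comm ε]
      exact hN
    filter_upwards [hlim'.eventually_lt_const hlt] with i hi
    rw [Real.dist_0_eq_abs, abs_of_nonneg (norm_nonneg _)]
    exact (hbound i).trans_lt hi
  rw [tendsto_iff_norm_sub_tendsto_zero, Metric.tendsto_nhds]
  intro ε hε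
  obtain ⟨F, hF⟩ := he.exists_dist_lt ψ (show 0 < ε / 3 by positivity)
  have h1 := key F
  rw [tendsto_iff_norm_sub_tendsto_zero] at h1
  filter_upwards [h1.eventually_lt_const (show 0 < ε / 3 by positivity)] with i hi
  rw [Real.dist_0_eq_abs, abs_of_nonneg (norm_nonneg _)]
  have e1 : V i t ψ - U t ψ = V i t (ψ - e F) + (V i t (e F) - U t (e F)) - U t (ψ - e F) := by
    rw [map_sub, map_sub]; abel
  rw [dist_eq_norm] at hF
  rw [e1]
  have h2 := norm_sub_le (V i t (ψ - e F) + (V i t (e F) - U t (e F))) (U t (ψ - e F))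
  have h3 := norm_add_le (V i t (ψ - e F)) (V i t (e F) - U t (e F))
  rw [LinearIsometryEquiv.norm_map] at h2 h3
  linarith

end AbstractGroups

/-! ### Building unitary groups from dense subspaces; weak description of generators; the Dyson
series. -/

section Generation

variable {H : Type*} [NormedAddCommGroup H] [InnerProductSpace ℂ H] [CompleteSpace H]

/-- A group of linear maps on a dense subspace with skew-symmetric derivative extends to a
unitary group. -/
theorem exists_isUnitaryGroup_of_dense {S : Type*} [AddCommGroup S] [Module ℂ S] {e : S →ₗ[ℂ] H}
    (he : DenseRange e) {U₀ : ℝ → S →ₗ[ℂ] S} (h0 : ∀ F, U₀ 0 F = F)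
    (hadd : ∀ s t F, U₀ (s + t) F = U₀ s (U₀ t F)) {G : S → S}
    (hG : ∀ F, HasDerivAt (fun t => e (U₀ t F)) (e (G F)) 0)
    (hskew : ∀ F F', inner ℂ (e (G F)) (e F') + inner ℂ (e F) (e (G F')) = 0) :
    ∃ U : ℝ → H ≃ₗᵢ[ℂ] H, IsUnitaryGroup U ∧ ∀ t F, U t (e F) = e (U₀ t F) := by
  have hd : ∀ t F, HasDerivAt (fun t => e (U₀ t F)) (e (G (U₀ t F))) t := by
    intro t F
    have h1 : HasDerivAt (fun s => e (U₀ s (U₀ t F))) (e (G (U₀ t F))) (t - t) := by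
      simpa using hG (U₀ t F)
    have h2 := h1.comp_sub_const t t
    refine h2.congr_of_eventuallyEq (Eventually.of_forall fun s => ?_)
    simp only
    rw [← hadd, sub_add_cancel]
  have hnorm : ∀ t F, ‖e (U₀ t F)‖ = ‖e F‖ := by
    intro t F
    -- Skew symmetry makes the squared norm constant along orbits, so each U₀ t is isometric and
    -- extends to H; U₀ (-t) provides the inverse.
    have hc : ∀ s, HasDerivAt (fun s => inner ℂ (e (U₀ s F)) (e (U₀ s F))) 0 s := by
      intro s
      have := (hd s F).inner ℂ (hd s F)
      rwa [add_comm, hskew] at this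
    have := is_const_of_deriv_eq_zero (fun s => (hc s).differentiableAt) (fun s => (hc s).deriv) t 0
    simp only [h0, inner_self_eq_norm_sq_to_K] at this
    have h2 : ‖e (U₀ t F)‖ ^ 2 = ‖e F‖ ^ 2 := by exact_mod_cast this
    exact (pow_left_inj₀ (norm_nonneg _) (norm_nonneg _) two_ne_zero).1 h2
  have hb : ∀ t F, ‖(e ∘ₗ U₀ t) F‖ ≤ 1 * ‖e F‖ := fun t F => by simp [hnorm]
  set E : ℝ → H →L[ℂ] H := fun t => (e ∘ₗ U₀ t).extendOfNorm e with hE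
  have hEe : ∀ t F, E t (e F) = e (U₀ t F) := fun t F =>
    LinearMap.extendOfNorm_eq he ⟨1, hb t⟩ F
  have hEn : ∀ t ψ, ‖E t ψ‖ = ‖ψ‖ := fun t ψ =>
    congrFun (he.equalizer (E t).continuous.norm continuous_norm
      (funext fun F => by simp [hEe, hnorm])) ψ
  have hE0 : ∀ ψ, E 0 ψ = ψ := fun ψ =>
    congrFun (he.equalizer (E 0).continuous continuous_id
      (funext fun F => by simp [hEe, h0])) ψ
  have hEadd : ∀ s t ψ, E (s + t) ψ = E s (E t ψ) := fun s t ψ =>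
    congrFun (he.equalizer (E (s + t)).continuous ((E s).continuous.comp (E t).continuous)
      (funext fun F => by simp [hEe, hadd])) ψ
  let U : ℝ → H ≃ₗᵢ[ℂ] H := fun t =>
    { toFun := E t
      invFun := E (-t)
      map_add' := (E t).map_add
      map_smul' := (E t).map_smul
      left_inv := fun ψ => by rw [← hEadd, neg_add_cancel, hE0]
      right_inv := fun ψ => by rw [← hEadd, add_neg_cancel, hE0]
      norm_map' := hEn t }
  refine ⟨U, ⟨hE0, hEadd, fun ψ => ?_⟩, hEe⟩
  change Continuous fun t => E t ψ
  rw [Metric.continuous_iff]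
  intro t ε hε
  obtain ⟨F, hF⟩ := he.exists_dist_lt ψ (show 0 < ε / 3 by positivity)
  obtain ⟨δ, hδ, h⟩ := Metric.continuousAt_iff.1 (hd t F).continuousAt (ε / 3) (by positivity)
  refine ⟨δ, hδ, fun s hs => ?_⟩
  have h1 := h hs
  rw [← hEe, ← hEe] at h1
  have h2 : ∀ r, dist (E r ψ) (E r (e F)) < ε / 3 := fun r => by
    rwa [dist_eq_norm, ← map_sub, hEn, ← dist_eq_norm]
  calc dist (E s ψ) (E t ψ) ≤ dist (E s ψ) (E s (e F)) + dist (E s (e F)) (E t (e F))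
        + dist (E t (e F)) (E t ψ) := dist_triangle4 _ _ _ _
    _ < ε := by rw [dist_comm (E t (e F))]; linarith [h2 s, h2 t]

/-- The generator of a unitary group with invariant dense domain is determined weakly. -/
theorem IsUnitaryGroup.hasDerivAt_iff_weak {U : ℝ → H ≃ₗᵢ[ℂ] H} (hU : IsUnitaryGroup U)
    {S : Type*} {e : S → H} (he : DenseRange e) {G : S → S}
    (hG : ∀ F, HasDerivAt (fun t => U t (e F)) (e (G F)) 0)
    (hinv : ∀ t F, ∃ F', U t (e F) = e F') (ψ η : H) :
    HasDerivAt (fun t => U t ψ) η 0 ↔ ∀ F, inner ℂ (e (G F)) ψ = -inner ℂ (e F) η := by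
  constructor
  · intro h F
    have d := (hG F).inner ℂ h
    have hc : (fun t => inner ℂ (U t (e F)) (U t ψ)) = fun _ => inner ℂ (e F) ψ := by
      funext t
      exact (U t).inner_map_map _ _
    rw [hc] at d
    have := d.unique (hasDerivAt_const (0 : ℝ) _)
    simp only [hU.map_zero] at this
    exact eq_neg_of_add_eq_zero_right this
  · intro h
    have hη : Continuous fun s => U s η := hU.continuous η
    -- The weak identity is upgraded to an integral equation, tested against the dense set; the
    -- fundamental theorem of calculus then gives strong differentiability.
    have key : ∀ t, U t ψ = ψ + ∫ s in (0 : ℝ)..t, U s η := by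
      intro t
      refine he.induction_on (p := fun x => inner ℂ x (U t ψ) =
        inner ℂ x (ψ + ∫ s in (0 : ℝ)..t, U s η)) |> fun hx => ext_inner_left ℂ fun x => hx x ?_ ?_
      · exact isClosed_eq (by fun_prop) (by fun_prop)
      · intro F
        have hd : ∀ s, HasDerivAt (fun s => inner ℂ (e F) (U s ψ)) (inner ℂ (e F) (U s η)) s := by
          intro s
          -- The group is moved onto the test vector, which stays in the core by invariance, so the
          -- weak hypothesis applies to it again.
          obtain ⟨F', hF'⟩ := hinv (-s) F
          have e1 : ∀ r x, inner ℂ (e F) (U r x) = inner ℂ (U (-r) (e F)) x := fun r x => by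
            rw [hU.inner_left, neg_neg]
          have d := (hU.hasDerivAt_neg (hG F) s).inner ℂ (hasDerivAt_const s ψ)
          simp only [inner_zero_right, zero_add, inner_neg_left] at d
          have h1 := hU.hasDerivAt_orbit (hG F) (-s)
          rw [hF'] at h1
          rw [← (hG F').unique h1, h F', neg_neg, ← hF', ← e1] at d
          simp only [e1]
          simpa only [e1] using d
        have hint := intervalIntegral.integral_eq_sub_of_hasDerivAt (fun s _ => hd s)
          (Continuous.intervalIntegrable (by fun_prop) 0 t)
        have hsw : ∫ s in (0 : ℝ)..t, inner ℂ (e F) (U s η) =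
            inner ℂ (e F) (∫ s in (0 : ℝ)..t, U s η) :=
          (innerSL ℂ (e F)).intervalIntegral_comp_comm (hη.intervalIntegrable 0 t)
        rw [inner_add_right, ← hsw, hint, hU.map_zero]
        ring
    have hd : HasDerivAt (fun t => ψ + ∫ s in (0 : ℝ)..t, U s η) (U 0 η) 0 :=
      (intervalIntegral.integral_hasDerivAt_right (hη.intervalIntegrable 0 0)
        (hη.stronglyMeasurableAtFilter _ _) hη.continuousAt).const_add ψ
    rw [hU.map_zero] at hd
    exact hd.congr_of_eventuallyEq (Eventually.of_forall key)

/-- `V` is the unitary group generated by the generator of `U` plus the bounded operator `B`. -/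
structure IsPerturbation (U : ℝ → H ≃ₗᵢ[ℂ] H) (B : H →L[ℂ] H) (V : ℝ → H ≃ₗᵢ[ℂ] H) : Prop where
  isUnitaryGroup : IsUnitaryGroup V
  hasDerivAt_interaction : ∀ ψ t,
    HasDerivAt (fun t => U (-t) (V t ψ)) (U (-t) (B (V t ψ))) t

/-- Picard iteration for the linear equation w' = C(t) w with C(t) = U(-t) B U(t). The terms D n of
the Dyson series are bounded by ‖ψ‖(‖B‖|t|)^n/n!. C is only strongly continuous, so continuity of t
↦ C t (v t) is all that the iteration uses. -/
theorem exists_hasDerivAt_interaction {U : ℝ → H ≃ₗᵢ[ℂ] H} (hU : IsUnitaryGroup U)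
    (B : H →L[ℂ] H) (ψ : H) :
    ∃ w : ℝ → H, w 0 = ψ ∧ ∀ t, HasDerivAt w (U (-t) (B (U t (w t)))) t := by
  let C : ℝ → H → H := fun t x => U (-t) (B (U t x))
  have hCcont : ∀ {v : ℝ → H}, Continuous v → Continuous fun t => C t (v t) := fun {v} hv =>
    hU.continuous_apply continuous_neg
      (B.continuous.comp (hU.continuous_apply continuous_id hv))
  have hCn : ∀ t x, ‖C t x‖ ≤ ‖B‖ * ‖x‖ := fun t x => by
    simpa only [C, LinearIsometryEquiv.norm_map] using B.le_opNorm (U t x)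
  let D : ℕ → ℝ → H := fun n => Nat.rec (fun _ => ψ) (fun _ v t => ∫ s in (0 : ℝ)..t, C s (v s)) n
  have hD0 : D 0 = fun _ => ψ := rfl
  have hDs : ∀ n, D (n + 1) = fun t => ∫ s in (0 : ℝ)..t, C s (D n s) := fun n => rfl
  have hDd' : ∀ n, Continuous (D n) → ∀ t, HasDerivAt (D (n + 1)) (C t (D n t)) t := by
    intro n hn t
    rw [hDs]
    exact intervalIntegral.integral_hasDerivAt_right ((hCcont hn).intervalIntegrable 0 t)
      ((hCcont hn).stronglyMeasurableAtFilter _ _) (hCcont hn).continuousAt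
  have hDc : ∀ n, Continuous (D n) := by
    intro n
    induction n with
    | zero => exact continuous_const
    | succ n ih => exact continuous_iff_continuousAt.2 fun t => (hDd' n ih t).continuousAt
  have hDd := fun n => hDd' n (hDc n)
  have hDn : ∀ n t, ‖D n t‖ ≤ ‖ψ‖ * ((‖B‖ * |t|) ^ n / n.factorial) := by
    intro n
    induction n with
    | zero => intro t; simp [hD0]
    | succ n ih =>
      intro t
      have h1 : ‖∫ s in (0 : ℝ)..t, C s (D n s)‖ ≤
          |∫ s in (0 : ℝ)..t, ‖B‖ * (‖ψ‖ * ((‖B‖ * |s|) ^ n / n.factorial))| := by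
        refine intervalIntegral.norm_integral_le_abs_of_norm_le ?_ ?_
        · exact ae_of_all _ fun s => (hCn s _).trans (by gcongr; exact ih s)
        · exact Continuous.intervalIntegrable (by fun_prop) _ _
      rw [hDs]
      refine h1.trans_eq ?_
      have h2 : ∀ s : ℝ, ‖B‖ * (‖ψ‖ * ((‖B‖ * |s|) ^ n / n.factorial)) =
          (‖B‖ ^ (n + 1) * ‖ψ‖ / n.factorial) * |s| ^ n := fun s => by
        rw [mul_pow, pow_succ]; ring
      have h3 : |∫ s in (0 : ℝ)..t, |s| ^ n| = |t| ^ (n + 1) / (n + 1) := by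
        have h4 : |∫ s in (0 : ℝ)..t, |s| ^ n| = ∫ s in (0 : ℝ)..|t|, s ^ n := by
          rcases le_total 0 t with h | h
          · rw [abs_of_nonneg h, abs_of_nonneg (intervalIntegral.integral_nonneg h
              fun s _ => by positivity)]
            refine intervalIntegral.integral_congr fun s hs => ?_
            rw [uIcc_of_le h] at hs
            simp only [abs_of_nonneg hs.1]
          · have h5 : ∫ s in (0 : ℝ)..|t|, s ^ n = ∫ s in (0 : ℝ)..(-t), |s| ^ n := by
              rw [abs_of_nonpos h]
              refine intervalIntegral.integral_congr fun s hs => ?_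
              rw [uIcc_of_le (by linarith)] at hs
              simp only [abs_of_nonneg hs.1]
            have h6 : ∫ s in (0 : ℝ)..(-t), |s| ^ n = -∫ s in (0 : ℝ)..t, |s| ^ n := by
              have := intervalIntegral.integral_comp_neg (a := (0 : ℝ)) (b := -t)
                (fun s : ℝ => |s| ^ n)
              simp only [abs_neg, neg_neg, neg_zero] at this
              rw [this, intervalIntegral.integral_symm]
            rw [h5, h6, abs_of_nonpos]
            rw [← neg_nonneg, ← h6]
            exact intervalIntegral.integral_nonneg (by linarith) fun s _ => by positivity
        rw [h4, integral_pow]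
        simp
      simp only [h2]
      rw [intervalIntegral.integral_const_mul, abs_mul, h3, abs_of_nonneg (by positivity),
        Nat.factorial_succ, mul_pow]
      push_cast
      field_simp
  have hsum : ∀ R : ℝ, Summable fun n : ℕ => ‖ψ‖ * ((‖B‖ * R) ^ n / n.factorial) := fun R =>
    (Real.summable_pow_div_factorial _).mul_left _
  have hDsum : ∀ t, Summable fun n => D n t := fun t =>
    Summable.of_norm_bounded (hsum |t|) fun n => hDn n t
  refine ⟨fun t => ∑' n, D n t, ?_, fun t => ?_⟩
  · change ∑' n, D n 0 = ψ
    refine tsum_eq_single 0 fun n hn => ?_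
    obtain ⟨m, rfl⟩ := Nat.exists_eq_succ_of_ne_zero hn
    rw [Nat.succ_eq_add_one, hDs]
    simp
  · have hsplit : (fun t => ∑' n, D n t) = fun t => ψ + ∑' n, D (n + 1) t := by
      funext t
      rw [(hDsum t).tsum_eq_zero_add, hD0]
    -- Termwise differentiation needs an open set on which the derivatives are summably bounded; a
    -- ball containing both t and the base point 0 is enough.
    set R := |t| + 1
    have hd := hasDerivAt_tsum_of_isPreconnected (u := fun n : ℕ =>
      ‖B‖ * (‖ψ‖ * ((‖B‖ * R) ^ n / n.factorial))) (t := Metric.ball (0 : ℝ) R)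
      (g := fun n t => D (n + 1) t) (g' := fun n t => C t (D n t)) (y₀ := 0) (y := t)
      ((hsum R).mul_left _) Metric.isOpen_ball (convex_ball _ _).isPreconnected
      (fun n s _ => hDd n s)
      (fun n s hs => (hCn s _).trans (by
        gcongr
        refine (hDn n s).trans ?_
        have : |s| ≤ R := by simpa using (Metric.mem_ball.1 hs).le
        gcongr))
      (by simp; positivity)
      ((summable_nat_add_iff 1).2 (hDsum 0)) (by simp [R])
    rw [hsplit]
    refine (hd.const_add ψ).congr_deriv ?_
    have hl : ∑' n, C t (D n t) = C t (∑' n, D n t) := by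
      have h1 : HasSum (fun n => D n t) (∑' n, D n t) := (hDsum t).hasSum
      exact ((((U (-t)).toContinuousLinearEquiv.toContinuousLinearMap.comp
        (B.comp (U t).toContinuousLinearEquiv.toContinuousLinearMap)).hasSum h1).tsum_eq)
    rw [hl]
    simp only [C]
    rw [congrFun hsplit t]

end Generation

/-! ### Bounded skew perturbations, Duhamel's formula and the Lie–Trotter formula. -/

section Perturbation

variable {H : Type*} [NormedAddCommGroup H] [InnerProductSpace ℂ H]

/-- In the interaction picture the equation has the skew bounded coefficients C t, so solutions have
constant norm and are unique. Uniqueness yields linearity in the initial datum and the group law of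
U t (w t). -/
theorem IsUnitaryGroup.exists_isPerturbation [CompleteSpace H] {U : ℝ → H ≃ₗᵢ[ℂ] H} (hU : IsUnitaryGroup U)
    {B : H →L[ℂ] H} (hB : ∀ x y, inner ℂ (B x) y + inner ℂ x (B y) = 0) :
    ∃ V, IsPerturbation U B V := by
  let C : ℝ → H →L[ℂ] H := fun t => (U (-t)).toContinuousLinearEquiv.toContinuousLinearMap.comp
    (B.comp (U t).toContinuousLinearEquiv.toContinuousLinearMap)
  have hC : ∀ t x, C t x = U (-t) (B (U t x)) := fun t x => rfl
  have hCskew : ∀ t x y, inner ℂ (C t x) y + inner ℂ x (C t y) = 0 := fun t x y => by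
    rw [hC, hC, hU.inner_left, neg_neg]
    have h1 : inner ℂ x (U (-t) (B (U t y))) = inner ℂ (U t x) (B (U t y)) := by
      rw [hU.inner_left]
    rw [h1, hB]
  have hconst : ∀ {w : ℝ → H}, (∀ t, HasDerivAt w (C t (w t)) t) → ∀ t, ‖w t‖ = ‖w 0‖ := by
    intro w hw t
    have hc : ∀ s, HasDerivAt (fun s => inner ℂ (w s) (w s)) 0 s := by
      intro s
      have := (hw s).inner ℂ (hw s)
      rwa [add_comm, hCskew] at this
    have := is_const_of_deriv_eq_zero (fun s => (hc s).differentiableAt) (fun s => (hc s).deriv) t 0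
    simp only [inner_self_eq_norm_sq_to_K] at this
    have h2 : ‖w t‖ ^ 2 = ‖w 0‖ ^ 2 := by exact_mod_cast this
    exact (pow_left_inj₀ (norm_nonneg _) (norm_nonneg _) two_ne_zero).1 h2
  have huniq : ∀ {v w : ℝ → H}, (∀ t, HasDerivAt v (C t (v t)) t) →
      (∀ t, HasDerivAt w (C t (w t)) t) → v 0 = w 0 → ∀ t, v t = w t := by
    intro v w hv hw h0 t
    have h1 := hconst (w := fun t => v t - w t)
      (fun t => ((hv t).sub (hw t)).congr_deriv (map_sub _ _ _).symm) t
    simp only [h0, sub_self, norm_zero, norm_eq_zero] at h1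
    exact sub_eq_zero.1 h1
  choose w hw0 hw using exists_hasDerivAt_interaction hU B
  have hw' : ∀ ψ t, HasDerivAt (w ψ) (C t (w ψ t)) t := hw
  have hwadd : ∀ x y t, w (x + y) t = w x t + w y t := fun x y =>
    huniq (hw' _) (fun t => ((hw' x t).add (hw' y t)).congr_deriv (_root_.map_add _ _ _).symm)
      (by simp [hw0])
  have hwsmul : ∀ (c : ℂ) x t, w (c • x) t = c • w x t := fun c x =>
    huniq (hw' _) (fun t => ((hw' x t).const_smul c).congr_deriv (map_smul _ _ _).symm)
      (by simp [hw0])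
  have hgroup : ∀ s t ψ, U (s + t) (w ψ (s + t)) = U s (w (U t (w ψ t)) s) := by
    intro s t ψ
    have h1 : ∀ s, HasDerivAt (fun s => U t (w ψ (s + t))) (C s (U t (w ψ (s + t)))) s := by
      intro s
      have h2 := (U t).hasDerivAt_comp ((hw' ψ (s + t)).comp_add_const s t)
      refine h2.congr_deriv ?_
      rw [hC, hC, ← hU.map_add, ← hU.map_add]
      congr 2
      ring
    rw [huniq (hw' (U t (w ψ t))) h1 (by simp [hw0]) s, ← hU.map_add]
  let V : ℝ → H ≃ₗᵢ[ℂ] H := fun t =>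
    { toFun := fun ψ => U t (w ψ t)
      invFun := fun ψ => U (-t) (w ψ (-t))
      map_add' := fun x y => by rw [hwadd, _root_.map_add]
      map_smul' := fun c x => by rw [hwsmul, map_smul]; rfl
      left_inv := fun ψ => by
        change U (-t) (w (U t (w ψ t)) (-t)) = ψ
        rw [← hgroup, neg_add_cancel, hU.map_zero, hw0]
      right_inv := fun ψ => by
        change U t (w (U (-t) (w ψ (-t))) t) = ψ
        rw [← hgroup, add_neg_cancel, hU.map_zero, hw0]
      norm_map' := fun ψ => by
        change ‖U t (w ψ t)‖ = ‖ψ‖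
        rw [LinearIsometryEquiv.norm_map, hconst (hw' ψ), hw0] }
  have hV : ∀ t ψ, V t ψ = U t (w ψ t) := fun _ _ => rfl
  have hwc : ∀ ψ, Continuous (w ψ) := fun ψ =>
    continuous_iff_continuousAt.2 fun t => (hw' ψ t).continuousAt
  refine ⟨V, ⟨fun ψ => by rw [hV, hU.map_zero, hw0], fun s t ψ => ?_, fun ψ => ?_⟩, fun ψ t => ?_⟩
  · rw [hV, hV, hV, hgroup]
  · simp only [hV]
    exact hU.continuous_apply continuous_id (hwc ψ)
  · simp only [hV, hU.neg_apply]
    exact hw ψ t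

namespace IsPerturbation

variable {U V : ℝ → H ≃ₗᵢ[ℂ] H} {B : H →L[ℂ] H}

/-- Duhamel's formula. -/
theorem duhamel [CompleteSpace H] (hV : IsPerturbation U B V) (hU : IsUnitaryGroup U) (ψ : H) (t : ℝ) :
    V t ψ = U t ψ + ∫ s in (0 : ℝ)..t, U (t - s) (B (V s ψ)) := by
  have hc : Continuous fun s => U (-s) (B (V s ψ)) :=
    hU.continuous_apply continuous_neg (B.continuous.comp (hV.isUnitaryGroup.continuous ψ))
  have h1 := intervalIntegral.integral_eq_sub_of_hasDerivAt
    (fun s _ => hV.hasDerivAt_interaction ψ s) (hc.intervalIntegrable 0 t)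
  have h2 : ∫ s in (0 : ℝ)..t, U (t - s) (B (V s ψ)) =
      U t (∫ s in (0 : ℝ)..t, U (-s) (B (V s ψ))) := by
    rw [← LinearIsometryEquiv.coe_toContinuousLinearEquiv, ← ContinuousLinearEquiv.coe_coe,
      ← ContinuousLinearMap.intervalIntegral_comp_comm _ (hc.intervalIntegrable 0 t)]
    refine intervalIntegral.integral_congr fun s _ => ?_
    simp only [ContinuousLinearEquiv.coe_coe, LinearIsometryEquiv.coe_toContinuousLinearEquiv]
    rw [← hU.map_add, sub_eq_add_neg]
  rw [h2, h1, neg_zero, hU.map_zero, hV.isUnitaryGroup.map_zero, map_sub, hU.apply_neg]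
  abel

theorem hasDerivAt (hV : IsPerturbation U B V) (hU : IsUnitaryGroup U) {ψ a : H}
    (ha : HasDerivAt (fun t => U t ψ) a 0) : HasDerivAt (fun t => V t ψ) (a + B ψ) 0 := by
  have h1 := hV.hasDerivAt_interaction ψ 0
  rw [neg_zero, hU.map_zero, hV.isUnitaryGroup.map_zero] at h1
  have h2 := hU.hasDerivAt_apply h1
    (by simpa only [neg_zero, hU.map_zero, hV.isUnitaryGroup.map_zero] using ha)
  simpa only [hU.apply_neg] using h2

/-- The Lie–Trotter product formula for a bounded perturbation. -/
theorem tendsto_trotter (hV : IsPerturbation U B V) (hU : IsUnitaryGroup U)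
    {E : ℝ → H ≃ₗᵢ[ℂ] H} (hE : IsUnitaryGroup E)
    (hEB : ∀ ψ, HasDerivAt (fun t => E t ψ) (B ψ) 0) {t : ℝ} (ht : 0 ≤ t) (ψ : H) :
    Tendsto (fun n : ℕ => (fun x => E (t / n) (U (t / n) x))^[n] ψ) atTop (𝓝 (V t ψ)) := by
  have hVg := hV.isUnitaryGroup
  have hVψ := hVg.continuous ψ
  -- Both E h (U h x) and V h x are compared with U h x plus a first-order term in B. The two
  -- first-order terms, h B U h x and h U h B x, differ by at most hδ.
  have hstep : ∀ (x : H) (h δ : ℝ), 0 ≤ h → (∀ r ∈ Icc 0 h, ‖U (-r) (B (V r x)) - B x‖ ≤ δ) →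
      ‖B (U h x) - U h (B x)‖ ≤ δ →
      ‖E h (U h x) - V h x‖ ≤ h * (2 * δ + h * (‖B‖ * (‖B‖ * ‖x‖))) := by
    intro x h δ hh h1 h2
    have h3 := hE.norm_apply_sub_le (hEB (U h x)) (hEB (B (U h x))) hh
    rw [sub_self, norm_zero, zero_add] at h3
    have h3' : ‖B (B (U h x))‖ ≤ ‖B‖ * (‖B‖ * ‖x‖) := by
      refine (B.le_opNorm _).trans ?_
      gcongr
      simpa only [LinearIsometryEquiv.norm_map] using B.le_opNorm (U h x)
    have h4 := (convex_Icc 0 h).norm_image_sub_le_of_norm_hasDerivWithin_le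
      (f := fun r : ℝ => U (-r) (V r x) - r • B x) (f' := fun r => U (-r) (B (V r x)) - B x)
      (fun r _ => by
        have h5 := (hV.hasDerivAt_interaction x r).sub ((hasDerivAt_id r).smul_const (B x))
        rw [one_smul] at h5
        exact h5.hasDerivWithinAt) h1
      (left_mem_Icc.2 hh) (right_mem_Icc.2 hh)
    rw [neg_zero, hU.map_zero, hVg.map_zero, zero_smul, sub_zero, sub_zero, Real.norm_eq_abs,
      abs_of_nonneg hh] at h4
    have e1 : E h (U h x) - V h x = (E h (U h x) - (U h x + h • B (U h x))) +
        h • (B (U h x) - U h (B x)) - U h (U (-h) (V h x) - h • B x - x) := by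
      rw [map_sub, map_sub, hU.apply_neg, LinearIsometryEquiv.map_real_smul, smul_sub]
      abel
    rw [e1]
    refine (norm_sub_le _ _).trans ?_
    have h6 := norm_add_le (E h (U h x) - (U h x + h • B (U h x))) (h • (B (U h x) - U h (B x)))
    rw [norm_smul, Real.norm_eq_abs, abs_of_nonneg hh] at h6
    rw [LinearIsometryEquiv.norm_map]
    have h7 : h * ‖B (U h x) - U h (B x)‖ ≤ h * δ := by gcongr
    have h8 : h * (h * ‖B (B (U h x))‖) ≤ h * (h * (‖B‖ * (‖B‖ * ‖x‖))) := by gcongr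
    linarith
  rw [tendsto_iff_norm_sub_tendsto_zero, Metric.tendsto_nhds]
  intro ε hε
  set M := ‖B‖ * (‖B‖ * ‖ψ‖) with hM
  have hM0 : 0 ≤ M := by positivity
  -- One step will cost at most 3hδ, so n steps cost 3tδ = 3tε/(4(t+1)) < ε.
  set δ := ε / (4 * (t + 1)) with hδ
  have hδ0 : 0 < δ := by positivity
  -- The orbit of ψ under V over [0, t] is compact, so strong continuity is uniform along it. This
  -- is why one δ bounds the error at every step.
  have hunif : ∀ᶠ r in 𝓝 (0 : ℝ), ∀ s ∈ Icc 0 t,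
      ‖U (-r) (B (V r (V s ψ))) - B (V s ψ)‖ < δ ∧ ‖B (U r (V s ψ)) - U r (B (V s ψ))‖ < δ := by
    refine isCompact_Icc.eventually_forall_of_forall_eventually fun s _ => ?_
    have c1 : Continuous fun p : ℝ × ℝ =>
        ‖U (-p.1) (B (V p.1 (V p.2 ψ))) - B (V p.2 ψ)‖ := by
      have h1 : Continuous fun p : ℝ × ℝ => V p.2 ψ := hVψ.comp continuous_snd
      exact ((hU.continuous_apply continuous_fst.neg (B.continuous.comp
        (hVg.continuous_apply continuous_fst h1))).sub (B.continuous.comp h1)).norm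
    have c2 : Continuous fun p : ℝ × ℝ =>
        ‖B (U p.1 (V p.2 ψ)) - U p.1 (B (V p.2 ψ))‖ := by
      have h1 : Continuous fun p : ℝ × ℝ => V p.2 ψ := hVψ.comp continuous_snd
      exact ((B.continuous.comp (hU.continuous_apply continuous_fst h1)).sub
        (hU.continuous_apply continuous_fst (B.continuous.comp h1))).norm
    have t1 := (c1.tendsto (0, s)).eventually_lt_const (u := δ)
      (by simpa [hU.map_zero, hVg.map_zero] using hδ0)
    have t2 := (c2.tendsto (0, s)).eventually_lt_const (u := δ)
      (by simpa [hU.map_zero, hVg.map_zero] using hδ0)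
    exact t1.and t2
  obtain ⟨ρ, hρ0, hρ⟩ := Metric.eventually_nhds_iff.1 hunif
  have hsmall : Tendsto (fun n : ℕ => t / (n : ℝ)) atTop (𝓝 0) :=
    tendsto_const_div_atTop_nhds_zero_nat t
  have hsmall2 : Tendsto (fun n : ℕ => t / (n : ℝ) * M) atTop (𝓝 0) := by
    simpa using hsmall.mul_const M
  filter_upwards [hsmall.eventually_lt_const hρ0, hsmall2.eventually_lt_const hδ0,
    eventually_gt_atTop 0] with n hn1 hn2 hn0
  have hn0' : (0 : ℝ) < n := by exact_mod_cast hn0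
  rw [Real.dist_0_eq_abs, abs_of_nonneg (norm_nonneg _)]
  set h := t / n with hh
  have hh0 : 0 ≤ h := by positivity
  have hnh : n * h = t := by rw [hh]; field_simp
  have h1 := norm_iterate_sub_iterate_le (F := fun x => E h (U h x)) (G := V h)
    (fun x y => by rw [← map_sub, ← map_sub, LinearIsometryEquiv.norm_map,
      LinearIsometryEquiv.norm_map]) ψ n
  rw [hVg.iterate_apply, hnh] at h1
  have h2 : ∀ j ∈ Finset.range n, ‖E h (U h ((V h)^[j] ψ)) - V h ((V h)^[j] ψ)‖ ≤
      h * (3 * δ) := by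
    intro j hj
    rw [hVg.iterate_apply]
    have hjt : (j : ℝ) * h ∈ Icc 0 t := by
      refine ⟨by positivity, ?_⟩
      rw [← hnh]
      gcongr
      exact (Finset.mem_range.1 hj).le
    have hr : ∀ r ∈ Icc 0 h, dist r 0 < ρ := fun r hr => by
      rw [Real.dist_0_eq_abs, abs_of_nonneg hr.1]; exact hr.2.trans_lt hn1
    refine (hstep _ h δ hh0 (fun r hr' => (hρ (hr r hr') _ hjt).1.le)
      (hρ (hr h ⟨hh0, le_rfl⟩) _ hjt).2.le).trans ?_
    rw [LinearIsometryEquiv.norm_map]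
    gcongr
    linarith
  refine (h1.trans (Finset.sum_le_sum h2)).trans_lt ?_
  rw [Finset.sum_const, Finset.card_range, nsmul_eq_mul, ← mul_assoc, hnh, hδ]
  have : t * (3 * (ε / (4 * (t + 1)))) = (3 * t / (4 * (t + 1))) * ε := by
    field_simp
  rw [this]
  have h3 : 3 * t / (4 * (t + 1)) < 1 := by
    rw [div_lt_one (by positivity)]; linarith
  nlinarith

end IsPerturbation

end Perturbation

/-! ### Smooth periodic functions as a dense star algebra in L². -/

section SmoothFunctions

/-- The smooth `2π`-periodic functions on the real line. -/
def smoothPeriodic : StarSubalgebra ℂ (ℝ → ℂ) where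
  carrier := {F | ContDiff ℝ ∞ F ∧ Function.Periodic F (2 * π)}
  mul_mem' := fun ha hb => ⟨ha.1.mul hb.1, ha.2.mul hb.2⟩
  add_mem' := fun ha hb => ⟨ha.1.add hb.1, ha.2.add hb.2⟩
  algebraMap_mem' := fun r => ⟨contDiff_const, fun _ => rfl⟩
  star_mem' := fun {a} ha => ⟨Complex.conjCLE.contDiff.comp ha.1, fun x => by
    simp only [Pi.star_apply]; rw [ha.2 x]⟩

/-- `C^∞(𝕋; ℂ)`. -/
abbrev Smooth : Type := smoothPeriodic

namespace Smooth

instance : CoeFun Smooth fun _ => ℝ → ℂ := ⟨fun F => F.1⟩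

theorem contDiff (F : Smooth) : ContDiff ℝ ∞ F := F.2.1

theorem periodic (F : Smooth) : Function.Periodic F (2 * π) := F.2.2

@[ext] theorem ext {F G : Smooth} (h : ∀ x, F x = G x) : F = G := Subtype.ext (funext h)

@[simp] theorem add_apply (F G : Smooth) (x : ℝ) : (F + G) x = F x + G x := rfl
@[simp] theorem sub_apply (F G : Smooth) (x : ℝ) : (F - G) x = F x - G x := rfl
@[simp] theorem neg_apply (F : Smooth) (x : ℝ) : (-F) x = -F x := rfl
@[simp] theorem mul_apply (F G : Smooth) (x : ℝ) : (F * G) x = F x * G x := rfl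
@[simp] theorem smul_apply (c : ℂ) (F : Smooth) (x : ℝ) : (c • F) x = c * F x := rfl
@[simp] theorem star_apply (F : Smooth) (x : ℝ) : (star F) x = star (F x) := rfl
@[simp] theorem one_apply (x : ℝ) : (1 : Smooth) x = 1 := rfl

theorem continuous (F : Smooth) : Continuous F := F.contDiff.continuous

theorem differentiable (F : Smooth) : Differentiable ℝ F :=
  F.contDiff.differentiable (by simp)

/-- Differentiation of smooth periodic functions. -/
def D : Derivation ℂ Smooth Smooth :=
  Derivation.mk'
    { toFun := fun F => ⟨deriv F, (contDiff_infty_iff_deriv.1 F.contDiff).2, fun x => by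
        rw [← deriv_comp_add_const, show (fun x => F (x + 2 * π)) = F from funext F.periodic]⟩
      map_add' := fun F G => ext fun x => deriv_add (F.differentiable x) (G.differentiable x)
      map_smul' := fun c F => ext fun x => deriv_const_smul c (F.differentiable x) }
    fun F G => ext fun x => by
      have := deriv_mul (F.differentiable x) (G.differentiable x)
      simp only [LinearMap.coe_mk, AddHom.coe_mk, smul_eq_mul, add_apply, mul_apply]
      refine this.trans ?_
      ring

theorem D_apply (F : Smooth) (x : ℝ) : D F x = deriv F x := rfl

theorem hasDerivAt (F : Smooth) (x : ℝ) : HasDerivAt F (D F x) x :=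
  (F.differentiable x).hasDerivAt

theorem D_mul (F G : Smooth) : D (F * G) = F * D G + D F * G := by
  rw [Derivation.leibniz, smul_eq_mul, smul_eq_mul, mul_comm G]

theorem D_star (F : Smooth) : D (star F) = star (D F) := by
  ext x
  exact ((Complex.conjCLE.toContinuousLinearMap.hasFDerivAt.comp_hasDerivAt x
    (F.hasDerivAt x))).deriv

/-- The function on the torus defined by a periodic function. -/
def tor (F : Smooth) : Torus → ℂ := F.periodic.lift

@[simp] theorem tor_coe (F : Smooth) (x : ℝ) : F.tor x = F x := rfl

theorem continuous_tor (F : Smooth) : Continuous F.tor :=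
  Continuous.quotient_liftOn' F.continuous _

theorem memLp_tor (F : Smooth) : MemLp F.tor 2 (AddCircle.haarAddCircle : Measure Torus) := by
  obtain ⟨C, hC⟩ := isCompact_univ.exists_bound_of_continuousOn F.continuous_tor.continuousOn
  exact MemLp.of_bound F.continuous_tor.aestronglyMeasurable C
    (Eventually.of_forall fun x => hC x (mem_univ x))

/-- A smooth function, as an element of `L²`. -/
def emb : Smooth →ₗ[ℂ] L2 where
  toFun F := F.memLp_tor.toLp F.tor
  map_add' F G := by
    rw [← MemLp.toLp_add]
    congr 1
    funext x
    induction x using QuotientAddGroup.induction_on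
    rfl
  map_smul' c F := by
    rw [RingHom.id_apply, ← MemLp.toLp_const_smul]
    congr 1
    funext x
    induction x using QuotientAddGroup.induction_on
    rfl

theorem coeFn_emb (F : Smooth) : emb F =ᵐ[AddCircle.haarAddCircle] F.tor :=
  F.memLp_tor.coeFn_toLp

/-- The mean value. -/
def mean (F : Smooth) : ℂ := ∫ x, F.tor x ∂AddCircle.haarAddCircle

theorem mean_add (F G : Smooth) : mean (F + G) = mean F + mean G := by
  rw [mean, mean, mean, ← integral_add (F.memLp_tor.integrable (by norm_num))
    (G.memLp_tor.integrable (by norm_num))]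
  congr 1
  funext x
  induction x using QuotientAddGroup.induction_on
  rfl

theorem mean_D (F : Smooth) : mean (D F) = 0 := by
  rw [mean, AddCircle.integral_haarAddCircle, ← AddCircle.intervalIntegral_preimage _ 0]
  simp only [tor_coe, zero_add]
  rw [intervalIntegral.integral_eq_sub_of_hasDerivAt (fun x _ => F.hasDerivAt x)
    ((D F).continuous.intervalIntegrable _ _)]
  have := F.periodic 0
  rw [zero_add] at this
  rw [this, sub_self, smul_zero]

/-- Converts the bilinear pairing of the distributional definitions into the inner product,
conjugate-linear in its first slot; hence the star. -/
theorem integral_mul_tor (ψ : L2) (F : Smooth) :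
    ∫ x, ψ x * F.tor x ∂AddCircle.haarAddCircle = inner ℂ (emb (star F)) ψ := by
  rw [L2.inner_def]
  refine integral_congr_ae ?_
  filter_upwards [coeFn_emb (star F)] with x hx
  rw [hx, RCLike.inner_apply]
  congr 1
  induction x using QuotientAddGroup.induction_on
  simp [tor_coe]

theorem inner_emb (F G : Smooth) : inner ℂ (emb F) (emb G) = mean (star F * G) := by
  have := integral_mul_tor (emb G) (star F)
  rw [star_star] at this
  rw [← this, mean]
  refine integral_congr_ae ?_
  filter_upwards [coeFn_emb G] with x hx
  rw [hx]
  induction x using QuotientAddGroup.induction_on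
  simp [tor_coe, mul_comm]

/-- Integration by parts: the derivative of a periodic product has mean zero. -/
theorem inner_emb_D (F G : Smooth) : inner ℂ (emb (D F)) (emb G) = -inner ℂ (emb F) (emb (D G)) := by
  have h := mean_D (star F * G)
  rw [D_mul, D_star, mean_add, ← inner_emb, ← inner_emb] at h
  exact eq_neg_of_add_eq_zero_right h

/-- The function `e^{ikx}`. -/
def mode (k : ℤ) : Smooth :=
  ⟨fun x => Complex.exp (Complex.I * k * x), by
    refine ⟨(contDiff_const.mul Complex.ofRealCLM.contDiff).cexp, fun x => ?_⟩
    have : Complex.I * k * ((x + 2 * π : ℝ) : ℂ) =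
        Complex.I * k * x + k * (2 * π * Complex.I) := by push_cast; ring
    simp only
    rw [this, Complex.exp_add, Complex.exp_int_mul_two_pi_mul_I, mul_one]⟩

theorem mode_apply (k : ℤ) (x : ℝ) : mode k x = Complex.exp (Complex.I * k * x) := rfl

theorem D_mode (k : ℤ) : D (mode k) = (Complex.I * k) • mode k := by
  ext x
  have h1 : HasDerivAt (fun x : ℝ => Complex.I * k * (x : ℂ)) (Complex.I * k * 1) x :=
    (Complex.ofRealCLM.hasDerivAt (x := x)).const_mul (Complex.I * k)
  have h2 := h1.cexp.deriv
  rw [D_apply]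
  refine Eq.trans h2 ?_
  simp only [smul_apply, mode_apply]
  ring

theorem tor_mode (k : ℤ) : (mode k).tor = fourier (T := 2 * π) k := by
  funext x
  induction x using QuotientAddGroup.induction_on with
  | H x =>
    refine Eq.trans ?_ (fourier_coe_apply (T := 2 * π) (n := k) (x := x)).symm
    change Complex.exp _ = _
    congr 1
    have : (π : ℂ) ≠ 0 := by exact_mod_cast Real.pi_ne_zero
    push_cast
    field_simp

theorem emb_mode (k : ℤ) : emb (mode k) = fourierLp (T := 2 * π) 2 k := by
  refine Lp.ext ?_
  refine (coeFn_emb _).trans ?_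
  refine EventuallyEq.trans (Eventually.of_forall fun x => ?_) (coeFn_fourierLp 2 k).symm
  rw [tor_mode]

theorem fc_eq_inner (ψ : L2) (k : ℤ) : fc ψ k = inner ℂ (emb (mode k)) ψ := by
  rw [emb_mode, fc, ← fourierBasis_repr, ← coe_fourierBasis, HilbertBasis.repr_apply_apply]

theorem fc_emb_D (F : Smooth) (k : ℤ) : fc (emb (D F)) k = Complex.I * k * fc (emb F) k := by
  rw [fc_eq_inner, fc_eq_inner, ← neg_inj, ← inner_emb_D, D_mode, map_smul, inner_smul_left]
  simp

theorem denseRange_emb : DenseRange emb := by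
  have h := span_fourierLp_closure_eq_top (T := 2 * π) (p := 2) (by norm_num)
  have h1 : Submodule.span ℂ (Set.range (fourierLp (T := 2 * π) 2)) ≤ LinearMap.range emb := by
    rw [Submodule.span_le]
    rintro _ ⟨k, rfl⟩
    exact ⟨mode k, emb_mode k⟩
  rw [← Submodule.dense_iff_topologicalClosure_eq_top] at h
  exact h.mono h1

end Smooth

end SmoothFunctions

/-! ### Multiplication and phase operators on L². -/

section Multiplication

theorem mulOp_ae_eq {m : Torus → ℂ} (hm : Continuous m) {ψ η : L2}
    (h : ∀ᵐ x ∂(AddCircle.haarAddCircle : Measure Torus), m x * ψ x = η x) : mulOp m ψ = η :=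
  Lp.ext ((coeFn_mulOp hm ψ).trans h)

theorem mulOp_add {m : Torus → ℂ} (hm : Continuous m) (ψ η : L2) :
    mulOp m (ψ + η) = mulOp m ψ + mulOp m η := by
  refine mulOp_ae_eq hm ?_
  filter_upwards [Lp.coeFn_add ψ η, Lp.coeFn_add (mulOp m ψ) (mulOp m η), coeFn_mulOp hm ψ,
    coeFn_mulOp hm η] with x h1 h2 h3 h4
  rw [h1, h2, Pi.add_apply, Pi.add_apply, h3, h4, mul_add]

theorem mulOp_smul {m : Torus → ℂ} (hm : Continuous m) (c : ℂ) (ψ : L2) :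
    mulOp m (c • ψ) = c • mulOp m ψ := by
  refine mulOp_ae_eq hm ?_
  filter_upwards [Lp.coeFn_smul c ψ, Lp.coeFn_smul c (mulOp m ψ), coeFn_mulOp hm ψ]
    with x h1 h2 h3
  rw [h1, h2, Pi.smul_apply, Pi.smul_apply, h3, smul_eq_mul, smul_eq_mul, mul_left_comm]

theorem mulOp_mulOp {m m' : Torus → ℂ} (hm : Continuous m) (hm' : Continuous m') (ψ : L2) :
    mulOp m (mulOp m' ψ) = mulOp (fun x => m x * m' x) ψ := by
  refine mulOp_ae_eq hm ?_
  filter_upwards [coeFn_mulOp hm' ψ, coeFn_mulOp (m := fun x => m x * m' x) (by fun_prop) ψ] with x h1 h2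
  rw [h1, h2, mul_assoc]

theorem mulOp_one (ψ : L2) : mulOp (fun _ => 1) ψ = ψ :=
  mulOp_ae_eq continuous_const (Eventually.of_forall fun _ => one_mul _)

theorem mulOp_add_fun {m m' : Torus → ℂ} (hm : Continuous m) (hm' : Continuous m') (ψ : L2) :
    mulOp (fun x => m x + m' x) ψ = mulOp m ψ + mulOp m' ψ := by
  refine mulOp_ae_eq (hm.add hm') ?_
  filter_upwards [Lp.coeFn_add (mulOp m ψ) (mulOp m' ψ), coeFn_mulOp hm ψ,
    coeFn_mulOp hm' ψ] with x h2 h3 h4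
  rw [h2]
  simp only [Pi.add_apply, h3, h4, add_mul]

theorem norm_mulOp_le {m : Torus → ℂ} (hm : Continuous m) {C : ℝ} (hC : ∀ x, ‖m x‖ ≤ C)
    (ψ : L2) : ‖mulOp m ψ‖ ≤ C * ‖ψ‖ := by
  refine Lp.norm_le_mul_norm_of_ae_le_mul ?_
  filter_upwards [coeFn_mulOp hm ψ] with x hx
  rw [hx, norm_mul]
  gcongr
  exact hC x

theorem exists_norm_le_of_continuous {m : Torus → ℂ} (hm : Continuous m) : ∃ C, ∀ x, ‖m x‖ ≤ C := by
  obtain ⟨C, hC⟩ := isCompact_univ.exists_bound_of_continuousOn hm.continuousOn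
  exact ⟨C, fun x => hC x (mem_univ x)⟩

/-- Multiplication by a continuous function, as a bounded operator. -/
def mulCLM (m : Torus → ℂ) (hm : Continuous m) : L2 →L[ℂ] L2 :=
  LinearMap.mkContinuousOfExistsBound
    { toFun := mulOp m
      map_add' := mulOp_add hm
      map_smul' := mulOp_smul hm }
    ((exists_norm_le_of_continuous hm).imp fun _ h => norm_mulOp_le hm h)

@[simp] theorem mulCLM_apply (m : Torus → ℂ) (hm : Continuous m) (ψ : L2) :
    mulCLM m hm ψ = mulOp m ψ := rfl

theorem inner_mulOp {m : Torus → ℂ} (hm : Continuous m) (ψ η : L2) :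
    inner ℂ (mulOp m ψ) η = inner ℂ ψ (mulOp (fun x => star (m x)) η) := by
  rw [L2.inner_def, L2.inner_def]
  refine integral_congr_ae ?_
  filter_upwards [coeFn_mulOp hm ψ, coeFn_mulOp hm.star η] with x h1 h2
  rw [h1, h2]
  simp only [RCLike.inner_apply, map_mul]
  rw [starRingEnd_apply, starRingEnd_apply]
  ring

theorem inner_mulOp_I_skew {θ : Torus → ℝ} (hθ : Continuous θ) (ψ η : L2) :
    inner ℂ (mulOp (fun x => Complex.I * (θ x : ℂ)) ψ) η +
      inner ℂ ψ (mulOp (fun x => Complex.I * (θ x : ℂ)) η) = 0 := by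
  have hc : Continuous fun x => Complex.I * (θ x : ℂ) := by fun_prop
  have hc' : Continuous fun x => star (Complex.I * (θ x : ℂ)) := hc.star
  rw [inner_mulOp hc, ← inner_add_right, ← mulOp_add_fun hc' hc]
  have : mulOp (fun x => star (Complex.I * (θ x : ℂ)) + Complex.I * (θ x : ℂ)) η = 0 := by
    refine mulOp_ae_eq (hc'.add hc) ?_
    filter_upwards [Lp.coeFn_zero ℂ 2 (AddCircle.haarAddCircle : Measure Torus)] with x hx
    rw [hx]
    simp
  rw [this, inner_zero_right]

theorem continuous_expI {θ : Torus → ℝ} (hθ : Continuous θ) :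
    Continuous fun x => Complex.exp (Complex.I * (θ x : ℂ)) := by fun_prop

theorem phase_add {θ θ' : Torus → ℝ} (hθ : Continuous θ) (hθ' : Continuous θ') (ψ : L2) :
    phase θ (phase θ' ψ) = phase (fun x => θ x + θ' x) ψ := by
  rw [phase, phase, phase, mulOp_mulOp (continuous_expI hθ) (continuous_expI hθ')]
  congr 1
  funext x
  rw [← Complex.exp_add]
  push_cast
  rw [mul_add]

theorem phase_zero (ψ : L2) : phase (fun _ => 0) ψ = ψ := by
  simpa [phase] using mulOp_one ψ

theorem norm_phase {θ : Torus → ℝ} (hθ : Continuous θ) (ψ : L2) : ‖phase θ ψ‖ = ‖ψ‖ := by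
  have h1 : ∀ (θ : Torus → ℝ), Continuous θ → ∀ ψ, ‖phase θ ψ‖ ≤ ‖ψ‖ := fun θ h ψ => by
    have := norm_mulOp_le (continuous_expI h) (C := 1) (fun x => by
      rw [mul_comm, Complex.norm_exp_ofReal_mul_I]) ψ
    rwa [one_mul] at this
  -- The bound by 1 holds for every phase; applying it to the inverse phase gives the reverse
  -- inequality.
  refine le_antisymm (h1 θ hθ ψ) ?_
  have := h1 (fun x => -θ x) hθ.neg (phase θ ψ)
  rw [phase_add (θ := fun x => -θ x) hθ.neg hθ] at this
  simpa only [neg_add_cancel, phase_zero] using this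

/-- The phase operators are unitary. -/
def phaseEquiv (θ : C(Torus, ℝ)) : L2 ≃ₗᵢ[ℂ] L2 where
  toFun := phase θ
  invFun := phase fun x => -θ x
  map_add' := mulOp_add (continuous_expI θ.continuous)
  map_smul' := mulOp_smul (continuous_expI θ.continuous)
  left_inv := fun ψ => by
    rw [phase_add (by fun_prop) (by fun_prop)]
    simp only [neg_add_cancel, phase_zero]
  right_inv := fun ψ => by
    rw [phase_add (by fun_prop) (by fun_prop)]
    simp only [add_neg_cancel, phase_zero]
  norm_map' := norm_phase θ.continuous

@[simp] theorem phaseEquiv_apply (θ : C(Torus, ℝ)) (ψ : L2) : phaseEquiv θ ψ = phase θ ψ := rfl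

end Multiplication

/-! ### Real functions on the torus and the groups of phase operators. -/

section RealFunctions

theorem dx_coe {E : Type*} [NormedAddCommGroup E] [NormedSpace ℝ E] (F : Torus → E) (x : ℝ) :
    dx F x = deriv (fun y : ℝ => F y) x := by
  have := deriv_comp_const_add (f := fun y : ℝ => F y) x 0
  rw [add_zero] at this
  rw [← this]
  rfl

theorem IsSmooth.dx {E : Type*} [NormedAddCommGroup E] [NormedSpace ℝ E] {F : Torus → E}
    (h : IsSmooth F) : IsSmooth (dx F) := by
  have : (fun x : ℝ => KdVTransport.dx F x) = deriv fun x : ℝ => F x := funext (dx_coe F)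
  rw [IsSmooth, this]
  exact (contDiff_infty_iff_deriv.1 h).2

theorem IsSmooth.continuous {E : Type*} [NormedAddCommGroup E] [NormedSpace ℝ E] {F : Torus → E}
    (h : IsSmooth F) : Continuous F :=
  continuous_coinduced_dom.2 (ContDiff.continuous h)

/-- A smooth function on the torus as a periodic function. -/
def Smooth.ofTorus (F : Torus → ℂ) (h : IsSmooth F) : Smooth :=
  ⟨fun x => F x, h, fun x => by simp only; rw [AddCircle.coe_add_period]⟩

@[simp] theorem Smooth.tor_ofTorus (F : Torus → ℂ) (h : IsSmooth F) :
    (Smooth.ofTorus F h).tor = F := by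
  funext x
  induction x using QuotientAddGroup.induction_on
  rfl

theorem Smooth.isSmooth_tor (F : Smooth) : IsSmooth F.tor := F.contDiff

theorem Smooth.dx_tor (F : Smooth) : dx F.tor = (Smooth.D F).tor := by
  funext x
  induction x using QuotientAddGroup.induction_on
  exact dx_coe _ _

theorem Smooth.mulOp_emb (G F : Smooth) : mulOp G.tor (Smooth.emb F) = Smooth.emb (G * F) := by
  refine mulOp_ae_eq G.continuous_tor ?_
  filter_upwards [Smooth.coeFn_emb F, Smooth.coeFn_emb (G * F)] with x h1 h2
  rw [h1, h2]
  induction x using QuotientAddGroup.induction_on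
  rfl

theorem Smooth.norm_emb_le (F : Smooth) {C : ℝ} (hC : ∀ x, ‖F x‖ ≤ C) : ‖Smooth.emb F‖ ≤ C := by
  have hC0 : 0 ≤ C := (norm_nonneg _).trans (hC 0)
  have := Lp.norm_le_of_ae_bound (f := Smooth.emb F) hC0 (by
    filter_upwards [Smooth.coeFn_emb F] with x hx
    rw [hx]
    induction x using QuotientAddGroup.induction_on
    exact hC _)
  simpa [measureUnivNNReal] using this

/-- A smooth real function as an element of `C^∞(𝕋; ℂ)`. -/
def Smooth.ofReal (θ : Torus → ℝ) (h : IsSmooth θ) : Smooth :=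
  ⟨fun x => (θ x : ℂ), Complex.ofRealCLM.contDiff.comp h, fun x => by
    simp only; rw [AddCircle.coe_add_period]⟩

@[simp] theorem Smooth.ofReal_apply (θ : Torus → ℝ) (h : IsSmooth θ) (x : ℝ) :
    Smooth.ofReal θ h x = (θ x : ℂ) := rfl

theorem Smooth.star_ofReal (θ : Torus → ℝ) (h : IsSmooth θ) :
    star (Smooth.ofReal θ h) = Smooth.ofReal θ h := by
  ext x
  simp

theorem IsSmooth.hasDerivAt {E : Type*} [NormedAddCommGroup E] [NormedSpace ℝ E] {F : Torus → E}
    (h : IsSmooth F) (x : ℝ) : HasDerivAt (fun y : ℝ => F y) (KdVTransport.dx F x) x := by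
  rw [dx_coe]
  exact (ContDiff.differentiable h (by simp) x).hasDerivAt

theorem Smooth.D_ofReal (θ : Torus → ℝ) (h : IsSmooth θ) :
    Smooth.D (Smooth.ofReal θ h) = Smooth.ofReal (dx θ) h.dx := by
  ext x
  exact (h.hasDerivAt x).ofReal_comp.deriv

/-- The function `e^{iθ}`. -/
def Smooth.expI (θ : Torus → ℝ) (h : IsSmooth θ) : Smooth :=
  ⟨fun x => Complex.exp (Complex.I * (θ x : ℂ)),
    (contDiff_const.mul (Complex.ofRealCLM.contDiff.comp h)).cexp, fun x => by
    simp only; rw [AddCircle.coe_add_period]⟩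

theorem Smooth.expI_apply (θ : Torus → ℝ) (h : IsSmooth θ) (x : ℝ) :
    Smooth.expI θ h x = Complex.exp (Complex.I * (θ x : ℂ)) := rfl

theorem Smooth.tor_expI (θ : Torus → ℝ) (h : IsSmooth θ) :
    (Smooth.expI θ h).tor = fun x => Complex.exp (Complex.I * (θ x : ℂ)) := by
  funext x
  induction x using QuotientAddGroup.induction_on
  rfl

theorem Smooth.D_expI (θ : Torus → ℝ) (h : IsSmooth θ) :
    Smooth.D (Smooth.expI θ h) =
      Complex.I • (Smooth.ofReal (dx θ) h.dx * Smooth.expI θ h) := by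
  ext x
  have := (((h.hasDerivAt x).ofReal_comp).const_mul Complex.I).cexp.deriv
  refine Eq.trans this ?_
  simp only [smul_apply, mul_apply, expI_apply, ofReal_apply]
  ring

theorem Smooth.phase_emb (θ : Torus → ℝ) (h : IsSmooth θ) (F : Smooth) :
    phase θ (Smooth.emb F) = Smooth.emb (Smooth.expI θ h * F) := by
  rw [phase, ← Smooth.tor_expI θ h, Smooth.mulOp_emb]

theorem Smooth.mulOp_I_emb (θ : Torus → ℝ) (h : IsSmooth θ) (F : Smooth) :
    mulOp (fun x => Complex.I * (θ x : ℂ)) (Smooth.emb F) =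
      Smooth.emb (Complex.I • (Smooth.ofReal θ h * F)) := by
  have e : (fun x => Complex.I * (θ x : ℂ)) = (Complex.I • Smooth.ofReal θ h).tor := by
    funext x
    induction x using QuotientAddGroup.induction_on
    rfl
  rw [e, Smooth.mulOp_emb, smul_mul_assoc]

/-- The group of phase operators `e^{itθ}`. -/
def phaseGroup (θ : C(Torus, ℝ)) (t : ℝ) : L2 ≃ₗᵢ[ℂ] L2 := phaseEquiv (t • θ)

theorem phaseGroup_apply (θ : C(Torus, ℝ)) (t : ℝ) (ψ : L2) :
    phaseGroup θ t ψ = phase (fun x => t * θ x) ψ := rfl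

/-- Since θ is bounded, the estimate |e^z - 1 - z| ≤ |z|² for |z| ≤ 1 holds uniformly in x once t is
small, so the remainder is O(t²) in operator norm. -/
theorem hasDerivAt_phaseGroup (θ : C(Torus, ℝ)) (ψ : L2) :
    HasDerivAt (fun t => phaseGroup θ t ψ) (mulOp (fun x => Complex.I * (θ x : ℂ)) ψ) 0 := by
  obtain ⟨C, hC⟩ := exists_norm_le_of_continuous (m := fun x => (θ x : ℂ)) (by fun_prop)
  have hC0 : 0 ≤ C := (norm_nonneg _).trans (hC 0)
  rw [hasDerivAt_iff_isLittleO]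
  have hb : ∀ t : ℝ, |t| * C ≤ 1 →
      ‖phaseGroup θ t ψ - phaseGroup θ 0 ψ -
        (t - 0) • mulOp (fun x => Complex.I * (θ x : ℂ)) ψ‖ ≤ (C ^ 2 * ‖ψ‖) * ‖t ^ 2‖ := by
    intro t ht
    have hc1 : Continuous fun x => Complex.exp (Complex.I * ((t * θ x : ℝ) : ℂ)) := by fun_prop
    have hc2 : Continuous fun x => Complex.I * (θ x : ℂ) := by fun_prop
    have hm : phaseGroup θ t ψ - phaseGroup θ 0 ψ -
        (t - 0) • mulOp (fun x => Complex.I * (θ x : ℂ)) ψ =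
        mulOp (fun x => Complex.exp (Complex.I * ((t * θ x : ℝ) : ℂ)) - 1 -
          Complex.I * ((t * θ x : ℝ) : ℂ)) ψ := by
      refine (mulOp_ae_eq (by fun_prop) ?_).symm
      have e1 : phaseGroup θ 0 ψ = ψ := by
        rw [phaseGroup_apply]; simp only [zero_mul, phase_zero]
      rw [e1, sub_zero, phaseGroup_apply, phase]
      filter_upwards [Lp.coeFn_sub (mulOp (fun x => Complex.exp (Complex.I * ((t * θ x : ℝ) : ℂ))) ψ
        - ψ) (t • mulOp (fun x => Complex.I * (θ x : ℂ)) ψ),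
        Lp.coeFn_sub (mulOp (fun x => Complex.exp (Complex.I * ((t * θ x : ℝ) : ℂ))) ψ) ψ,
        Lp.coeFn_smul t (mulOp (fun x => Complex.I * (θ x : ℂ)) ψ), coeFn_mulOp hc1 ψ,
        coeFn_mulOp hc2 ψ] with x h1 h2 h3 h4 h5
      rw [h1, Pi.sub_apply, h2, Pi.sub_apply, h3, Pi.smul_apply, h4, h5, Complex.real_smul]
      push_cast
      ring
    rw [hm]
    refine (norm_mulOp_le (by fun_prop) (C := C ^ 2 * ‖t ^ 2‖) (fun x => ?_) ψ).trans_eq (by ring)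
    have h1 : ‖Complex.I * ((t * θ x : ℝ) : ℂ)‖ ≤ |t| * C := by
      have := hC x
      rw [norm_mul, Complex.norm_I, one_mul, Complex.ofReal_mul, norm_mul, Complex.norm_real,
        Real.norm_eq_abs]
      gcongr
    refine (Complex.norm_exp_sub_one_sub_id_le (h1.trans ht)).trans ?_
    have h2 : ‖Complex.I * ((t * θ x : ℝ) : ℂ)‖ ^ 2 ≤ (|t| * C) ^ 2 := by gcongr
    rw [mul_pow, sq_abs] at h2
    rw [Real.norm_eq_abs, abs_of_nonneg (sq_nonneg t), mul_comm (C ^ 2)]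
    exact h2
  have hO : (fun t : ℝ => phaseGroup θ t ψ - phaseGroup θ 0 ψ -
        (t - 0) • mulOp (fun x => Complex.I * (θ x : ℂ)) ψ) =O[𝓝 0] fun t : ℝ => t ^ 2 := by
    refine Asymptotics.IsBigO.of_bound (C ^ 2 * ‖ψ‖) ?_
    have : Tendsto (fun t : ℝ => |t| * C) (𝓝 0) (𝓝 0) := by
      have : Continuous fun t : ℝ => |t| * C := by fun_prop
      simpa using this.tendsto 0
    filter_upwards [this.eventually_le_const zero_lt_one] with t ht using hb t ht
  refine hO.trans_isLittleO ?_
  simpa using Asymptotics.isLittleO_pow_id (𝕜 := ℝ) one_lt_two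

theorem isUnitaryGroup_phaseGroup (θ : C(Torus, ℝ)) : IsUnitaryGroup (phaseGroup θ) := by
  have h0 : ∀ ψ, phaseGroup θ 0 ψ = ψ := fun ψ => by
    rw [phaseGroup_apply]; simp only [zero_mul, phase_zero]
  have hadd : ∀ s t ψ, phaseGroup θ (s + t) ψ = phaseGroup θ s (phaseGroup θ t ψ) := by
    intro s t ψ
    rw [phaseGroup_apply, phaseGroup_apply, phaseGroup_apply,
      phase_add (by fun_prop) (by fun_prop)]
    simp only [add_mul]
  refine ⟨h0, hadd, fun ψ => continuous_iff_continuousAt.2 fun t => ?_⟩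
  have h1 : Tendsto (fun s => phaseGroup θ (s - t) ψ) (𝓝 t) (𝓝 ψ) := by
    have h2 := (hasDerivAt_phaseGroup θ ψ).continuousAt.tendsto
    rw [h0] at h2
    refine h2.comp ?_
    have : Continuous fun s : ℝ => s - t := by fun_prop
    simpa using this.tendsto t
  have h3 := ((phaseGroup θ t).continuous.tendsto ψ).comp h1
  refine h3.congr fun s => ?_
  simp only [Function.comp]
  rw [← hadd, add_sub_cancel]

end RealFunctions

/-! ### The operator `L` in Fourier variables and its unitary group. -/

section OperatorL

/-- The symbol of `L` is `i` times this real number. -/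
def symL (α : ℝ) (k : ℤ) : ℝ := (k : ℝ) ^ 2 * (k - α)

theorem symL_eq (α : ℝ) (k : ℤ) :
    -(Complex.I * (k : ℂ)) ^ 3 + Complex.I * (α : ℂ) * (Complex.I * (k : ℂ)) ^ 2 =
      Complex.I * (symL α k : ℂ) := by
  have h3 : Complex.I ^ 3 = -Complex.I := by rw [pow_succ, Complex.I_sq]; ring
  rw [mul_pow, mul_pow, h3, Complex.I_sq, symL]
  push_cast
  ring

/-- Ellipticity of the symbol. For |k| > 2|α| + 1 one has |k| ≤ 2|k - α| and 1 + k² ≤ 2k², whence 32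
= 8·4. The finitely many other frequencies go into the constant. -/
theorem one_add_sq_pow_le_symL (α : ℝ) (k : ℤ) :
    (1 + (k : ℝ) ^ 2) ^ 3 ≤ 32 * symL α k ^ 2 + (1 + (2 * |α| + 1) ^ 2) ^ 3 := by
  rw [symL]
  rcases le_or_gt (|(k : ℝ)|) (2 * |α| + 1) with h | h
  · have h1 : (k : ℝ) ^ 2 ≤ (2 * |α| + 1) ^ 2 := by rw [← sq_abs]; gcongr
    have h2 : (1 + (k : ℝ) ^ 2) ^ 3 ≤ (1 + (2 * |α| + 1) ^ 2) ^ 3 := by gcongr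
    have h3 : 0 ≤ 32 * ((k : ℝ) ^ 2 * (k - α)) ^ 2 := by positivity
    linarith
  · have hα := abs_nonneg α
    have h1 : 1 ≤ (k : ℝ) ^ 2 := by
      rw [← sq_abs]
      nlinarith
    have h2 : (k : ℝ) ^ 2 ≤ 4 * ((k : ℝ) - α) ^ 2 := by
      have h3 : |(k : ℝ)| - |α| ≤ |(k : ℝ) - α| := abs_sub_abs_le_abs_sub _ _
      have h4 : |(k : ℝ)| ≤ 2 * |(k : ℝ) - α| := by linarith
      calc (k : ℝ) ^ 2 = |(k : ℝ)| ^ 2 := (sq_abs _).symm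
        _ ≤ (2 * |(k : ℝ) - α|) ^ 2 := by gcongr
        _ = 4 * ((k : ℝ) - α) ^ 2 := by rw [mul_pow, sq_abs]; ring
    calc (1 + (k : ℝ) ^ 2) ^ 3 ≤ (2 * (k : ℝ) ^ 2) ^ 3 := by gcongr; linarith
      _ = 8 * ((k : ℝ) ^ 4 * (k : ℝ) ^ 2) := by ring
      _ ≤ 8 * ((k : ℝ) ^ 4 * (4 * ((k : ℝ) - α) ^ 2)) := by gcongr
      _ = 32 * ((k : ℝ) ^ 2 * (k - α)) ^ 2 := by ring
      _ ≤ _ := le_add_of_nonneg_right (by positivity)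

/-- Membership in H³ is automatic: if both ψ and its image under the symbol are square summable,
`one_add_sq_pow_le_symL` bounds the Sobolev sum. -/
theorem mem_opL_iff (α : ℝ) (ψ η : L2) :
    (ψ, η) ∈ opL α ↔ ∀ k : ℤ, fc η k = Complex.I * (symL α k : ℂ) * fc ψ k := by
  simp only [opL, mem_ofPred_eq, symL_eq, and_iff_right_iff_imp]
  intro h
  have hψ := (hasSum_sq_fourierCoeff ψ).summable
  have hη := (hasSum_sq_fourierCoeff η).summable
  refine Summable.of_nonneg_of_le (fun k => by positivity) (fun k => ?_)
    ((hη.mul_left 32).add (hψ.mul_left ((1 + (2 * |α| + 1) ^ 2) ^ 3)))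
  have h1 : ‖fourierCoeff (η : Torus → ℂ) k‖ ^ 2 =
      symL α k ^ 2 * ‖fourierCoeff (ψ : Torus → ℂ) k‖ ^ 2 := by
    have := h k
    simp only [fc] at this
    rw [this, norm_mul, norm_mul, Complex.norm_I, one_mul, Complex.norm_real, mul_pow,
      Real.norm_eq_abs, sq_abs]
  rw [h1, show (3 : ℝ) = ((3 : ℕ) : ℝ) by norm_num, Real.rpow_natCast, ← mul_assoc, ← add_mul]
  gcongr
  exact one_add_sq_pow_le_symL α k

/-- On finite combinations of modes the group multiplies by exponentials of an imaginary symbol. The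
weak description of the generator, tested on single modes, is exactly the Fourier condition of
`mem_opL_iff`. -/
theorem isUnitaryGroupGeneratedBy_opL (α : ℝ) :
    IsUnitaryGroupGeneratedBy (expGroup (opL α)) (opL α) := by
  suffices h : ∃ U, IsUnitaryGroupGeneratedBy U (opL α) by
    obtain ⟨U, hU⟩ := h
    rwa [hU.expGroup_eq]
  let v : ℤ → L2 := fun k => Smooth.emb (Smooth.mode k)
  have hv : Orthonormal ℂ v := by
    have : v = fourierLp (T := 2 * π) 2 := funext Smooth.emb_mode
    rw [this]
    exact orthonormal_fourier
  let e : (ℤ →₀ ℂ) →ₗ[ℂ] L2 := Finsupp.linearCombination ℂ v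
  have he : DenseRange e := by
    have h := span_fourierLp_closure_eq_top (T := 2 * π) (p := 2) (by norm_num)
    rw [← Submodule.dense_iff_topologicalClosure_eq_top,
      show fourierLp (T := 2 * π) 2 = v from (funext Smooth.emb_mode).symm,
      ← Finsupp.range_linearCombination] at h
    exact h
  let U₀ : ℝ → (ℤ →₀ ℂ) →ₗ[ℂ] (ℤ →₀ ℂ) := fun t => Finsupp.linearCombination ℂ
    fun k => Finsupp.single k (Complex.exp (t * (Complex.I * symL α k)))
  let G : (ℤ →₀ ℂ) →ₗ[ℂ] (ℤ →₀ ℂ) := Finsupp.linearCombination ℂ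
    fun k => Finsupp.single k (Complex.I * symL α k)
  have hUs : ∀ t k (a : ℂ), U₀ t (Finsupp.single k a) =
      Finsupp.single k (a * Complex.exp (t * (Complex.I * symL α k))) := fun t k a => by
    simp [U₀, Finsupp.linearCombination_single]
  have hGs : ∀ k (a : ℂ), G (Finsupp.single k a) =
      Finsupp.single k (a * (Complex.I * symL α k)) := fun k a => by
    simp only [G, Finsupp.linearCombination_single, Finsupp.smul_single, smul_eq_mul]
  have hes : ∀ k (a : ℂ), e (Finsupp.single k a) = a • v k := fun k a => by
    simp [e, Finsupp.linearCombination_single]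
  have h0 : ∀ F, U₀ 0 F = F := by
    intro F
    induction F using Finsupp.induction_linear with
    | zero => simp
    | add F F' h h' => rw [map_add, h, h']
    | single k a => rw [hUs]; simp
  have hadd : ∀ s t F, U₀ (s + t) F = U₀ s (U₀ t F) := by
    intro s t F
    induction F using Finsupp.induction_linear with
    | zero => simp
    | add F F' h h' => rw [map_add, h, h', map_add, map_add]
    | single k a =>
      rw [hUs, hUs, hUs, mul_assoc, ← Complex.exp_add]
      congr 3
      push_cast
      ring
  have hG : ∀ F, HasDerivAt (fun t => e (U₀ t F)) (e (G F)) 0 := by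
    intro F
    induction F using Finsupp.induction_linear with
    | zero => simpa using hasDerivAt_const (0 : ℝ) (0 : L2)
    | add F F' h h' =>
      simp only [map_add]
      exact h.add h'
    | single k a =>
      simp only [hUs, hGs, hes]
      have h1 : HasDerivAt (fun t : ℝ => (t : ℂ) * (Complex.I * symL α k))
          (1 * (Complex.I * symL α k)) 0 :=
        (Complex.ofRealCLM.hasDerivAt (x := 0)).mul_const _
      have h2 := (h1.cexp.const_mul a).smul_const (v k)
      simpa using h2
  have hskew : ∀ F F', inner ℂ (e (G F)) (e F') + inner ℂ (e F) (e (G F')) = 0 := by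
    intro F F'
    induction F using Finsupp.induction_linear with
    | zero => simp
    | add F₁ F₂ h1 h2 =>
      simp only [map_add, inner_add_left]
      linear_combination h1 + h2
    | single k a =>
      induction F' using Finsupp.induction_linear with
      | zero => simp
      | add F₁ F₂ h1 h2 =>
        simp only [map_add, inner_add_right]
        linear_combination h1 + h2
      | single j b =>
        simp only [hGs, hes, inner_smul_left, inner_smul_right, map_mul, Complex.conj_I,
          Complex.conj_ofReal]
        rcases eq_or_ne k j with rfl | hkj
        · ring
        · rw [hv.inner_eq_zero hkj]; ring
  obtain ⟨U, hU, hUe⟩ := exists_isUnitaryGroup_of_dense he h0 hadd hG hskew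
  have hG' : ∀ F, HasDerivAt (fun t => U t (e F)) (e (G F)) 0 := fun F => by
    simpa only [hUe] using hG F
  have hgen : ∀ ψ η, (ψ, η) ∈ opL α ↔ HasDerivAt (fun t => U t ψ) η 0 := by
    intro ψ η
    rw [mem_opL_iff]
    refine Iff.trans ?_ (hU.hasDerivAt_iff_weak he hG' (fun t F => ⟨_, hUe t F⟩) ψ η).symm
    constructor
    · intro h F
      induction F using Finsupp.induction_linear with
      | zero => simp
      | add F₁ F₂ h1 h2 =>
        simp only [map_add, inner_add_left, h1, h2]
        ring
      | single k a =>
        have := h k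
        rw [Smooth.fc_eq_inner, Smooth.fc_eq_inner] at this
        simp only [hGs, hes, inner_smul_left, map_mul, Complex.conj_I, Complex.conj_ofReal]
        simp only [v]
        rw [this]
        ring
    · intro h k
      have := h (Finsupp.single k 1)
      simp only [hGs, hes, inner_smul_left, map_mul, Complex.conj_I, Complex.conj_ofReal,
        map_one, one_mul] at this
      rw [Smooth.fc_eq_inner, Smooth.fc_eq_inner]
      change inner ℂ (v k) η = _ * inner ℂ (v k) ψ
      linear_combination this
  refine ⟨U, ⟨?_, hU.map_zero, hU.map_add, hU.continuous, hgen⟩⟩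
  refine he.mono ?_
  rintro _ ⟨F, rfl⟩
  exact ⟨_, (hgen _ _).2 (hG' F)⟩

/-- The action of `L` on smooth functions. -/
def Smooth.L (α : ℝ) (F : Smooth) : Smooth :=
  -Smooth.D (Smooth.D (Smooth.D F)) + (Complex.I * α) • Smooth.D (Smooth.D F)

theorem isUnitaryGroup_expL (α : ℝ) : IsUnitaryGroup (expGroup (opL α)) :=
  (isUnitaryGroupGeneratedBy_opL α).isUnitaryGroup

theorem hasDerivAt_expL (α : ℝ) (F : Smooth) :
    HasDerivAt (fun t => expGroup (opL α) t (Smooth.emb F)) (Smooth.emb (Smooth.L α F)) 0 := by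
  refine ((isUnitaryGroupGeneratedBy_opL α).generator _ _).1 ((mem_opL_iff _ _ _).2 ?_)
  intro k
  rw [← symL_eq, Smooth.L, map_add, map_neg, map_smul]
  have h3 : ∀ ψ η : L2, fc (ψ + η) k = fc ψ k + fc η k := fun ψ η => by
    simp only [Smooth.fc_eq_inner, inner_add_right]
  have h4 : ∀ ψ : L2, fc (-ψ) k = -fc ψ k := fun ψ => by
    simp only [Smooth.fc_eq_inner, inner_neg_right]
  have h5 : ∀ (c : ℂ) (ψ : L2), fc (c • ψ) k = c * fc ψ k := fun c ψ => by
    simp only [Smooth.fc_eq_inner, inner_smul_right]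
  rw [h3, h4, h5, Smooth.fc_emb_D, Smooth.fc_emb_D, Smooth.fc_emb_D]
  ring

end OperatorL

/-! ### Global flows of smooth vector fields on the line and their regularity. -/

section Flow

/-- Boundedness of f prevents blow-up: on [-n, n] a curve moves at most M n, so Picard–Lindelöf
applies on each such interval. Uniqueness glues the pieces. -/
theorem exists_integralCurve {f : ℝ → ℝ} {K M : NNReal} (hf : LipschitzWith K f)
    (hM : ∀ x, ‖f x‖ ≤ M) (x : ℝ) :
    ∃ γ : ℝ → ℝ, γ 0 = x ∧ ∀ t, HasDerivAt γ (f (γ t)) t := by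
  have hn : ∀ n : ℕ, ∃ γ : ℝ → ℝ, γ 0 = x ∧
      ∀ t ∈ Ioo (-(n : ℝ)) n, HasDerivAt γ (f (γ t)) t := by
    intro n
    have h0 : (0 : ℝ) ∈ Icc (-(n : ℝ)) n := by simp
    have hp : IsPicardLindelof (fun _ => f) (⟨0, h0⟩ : Icc (-(n : ℝ)) n) x (M * n) 0 M K :=
      IsPicardLindelof.of_time_independent (fun y _ => hM y) hf.lipschitzOnWith (by simp)
    obtain ⟨γ, h1, h2⟩ := hp.exists_eq_forall_mem_Icc_hasDerivWithinAt₀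
    exact ⟨γ, h1, fun t ht => (h2 t (Ioo_subset_Icc_self ht)).hasDerivAt (Icc_mem_nhds ht.1 ht.2)⟩
  choose γ h0 hd using hn
  have hcomp : ∀ m n : ℕ, 0 < m → m ≤ n → EqOn (γ m) (γ n) (Ioo (-(m : ℝ)) m) := by
    intro m n hm hmn
    have hm' : (0 : ℝ) < m := by exact_mod_cast hm
    have hmn' : (m : ℝ) ≤ n := by exact_mod_cast hmn
    refine ODE_solution_unique_of_mem_Ioo (v := fun _ => f) (s := fun _ => univ) (K := K)
      (t₀ := 0) (fun t _ => hf.lipschitzOnWith) ⟨by linarith, hm'⟩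
      (fun t ht => ⟨hd m t ht, mem_univ _⟩)
      (fun t ht => ⟨hd n t ⟨by linarith [ht.1], by linarith [ht.2]⟩, mem_univ _⟩)
      ((h0 m).trans (h0 n).symm)
  -- The index ⌈|t|⌉ + 1 puts t strictly inside its interval; near t all curves used agree with the
  -- one of index ⌈|t|⌉ + 2.
  refine ⟨fun t => γ (⌈|t|⌉₊ + 1) t, by simpa using h0 1, fun t => ?_⟩
  have hmem : ∀ s : ℝ, s ∈ Ioo (-((⌈|s|⌉₊ + 1 : ℕ) : ℝ)) ((⌈|s|⌉₊ + 1 : ℕ) : ℝ) := fun s => by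
    rw [mem_Ioo, ← abs_lt]
    push_cast
    linarith [Nat.le_ceil |s|]
  have ht : t ∈ Ioo (-((⌈|t|⌉₊ + 2 : ℕ) : ℝ)) ((⌈|t|⌉₊ + 2 : ℕ) : ℝ) := by
    have := hmem t
    push_cast at this ⊢
    exact ⟨by linarith [this.1], by linarith [this.2]⟩
  have hev : (fun s => γ (⌈|s|⌉₊ + 1) s) =ᶠ[𝓝 t] γ (⌈|t|⌉₊ + 2) := by
    have : ∀ᶠ s in 𝓝 t, |s| < |t| + 1 :=
      continuous_abs.continuousAt.eventually_lt continuousAt_const (by simp)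
    filter_upwards [this] with s hs
    refine hcomp _ _ (Nat.succ_pos _) ?_ (hmem s)
    have h2 : ⌈|s|⌉₊ ≤ ⌈|t|⌉₊ + 1 := by
      rw [Nat.ceil_le]
      push_cast
      linarith [Nat.le_ceil |t|]
    omega
  have := hd (⌈|t|⌉₊ + 2) t ht
  rw [← hev.eq_of_nhds] at this
  exact this.congr_of_eventuallyEq hev

/-- Continuous partial derivatives give a Fréchet derivative, which here is a linear expression in
k₁ and k₂ and so inherits their regularity. -/
theorem contDiff_succ_of_partial {K : ℝ → ℝ → ℝ} {k₁ k₂ : ℝ × ℝ → ℝ} {n : ℕ}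
    (h₁ : ∀ t x, HasDerivAt (fun t => K t x) (k₁ (t, x)) t)
    (h₂ : ∀ t x, HasDerivAt (fun x => K t x) (k₂ (t, x)) x)
    (hk₁ : ContDiff ℝ n k₁) (hk₂ : ContDiff ℝ n k₂) :
    ContDiff ℝ (n + 1 : ℕ) fun p : ℝ × ℝ => K p.1 p.2 := by
  have hc : ∀ {k : ℝ × ℝ → ℝ}, ContDiff ℝ n k →
      ContDiff ℝ n fun p => ContinuousLinearMap.toSpanSingleton ℝ (k p) := fun h =>
    (ContinuousLinearMap.toSpanSingletonCLE (𝕜 := ℝ) (E := ℝ)).contDiff.comp h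
  push_cast
  rw [contDiff_succ_iff_hasFDerivAt]
  refine ⟨fun p => (ContinuousLinearMap.toSpanSingleton ℝ (k₁ p)).coprod
    (ContinuousLinearMap.toSpanSingleton ℝ (k₂ p)), ?_, fun p => ?_⟩
  · have e : (fun p => (ContinuousLinearMap.toSpanSingleton ℝ (k₁ p)).coprod
        (ContinuousLinearMap.toSpanSingleton ℝ (k₂ p))) = fun p =>
        k₁ p • ContinuousLinearMap.fst ℝ ℝ ℝ + k₂ p • ContinuousLinearMap.snd ℝ ℝ ℝ := by
      funext p
      ext <;> simp
    rw [e]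
    exact (hk₁.smul contDiff_const).add (hk₂.smul contDiff_const)
  · exact (hasStrictFDerivAt_uncurry_coprod (f := K)
      (f₁ := fun t x => ContinuousLinearMap.toSpanSingleton ℝ (k₁ (t, x)))
      (f₂ := fun t x => ContinuousLinearMap.toSpanSingleton ℝ (k₂ (t, x)))
      (Eventually.of_forall fun v => (h₁ v.1 v.2).hasFDerivAt)
      (Eventually.of_forall fun v => (h₂ v.1 v.2).hasFDerivAt)
      (hc hk₁).continuous.continuousAt (hc hk₂).continuous.continuousAt).hasFDerivAt

theorem hasDerivAt_integral_param {h h' : ℝ × ℝ → ℝ} (hc : Continuous h) (hc' : Continuous h')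
    (hd : ∀ s x, HasDerivAt (fun x => h (s, x)) (h' (s, x)) x) (t x : ℝ) :
    HasDerivAt (fun x => ∫ s in (0 : ℝ)..t, h (s, x)) (∫ s in (0 : ℝ)..t, h' (s, x)) x := by
  obtain ⟨C, hC⟩ := (isCompact_uIcc.prod (isCompact_closedBall x 1)).exists_bound_of_continuousOn
    (f := h') (s := uIcc 0 t ×ˢ Metric.closedBall x 1) hc'.continuousOn
  refine (intervalIntegral.hasDerivAt_integral_of_dominated_loc_of_deriv_le
    (F := fun x s => h (s, x)) (F' := fun x s => h' (s, x)) (bound := fun _ => C)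
    (Metric.ball_mem_nhds x one_pos) ?_ ?_ ?_ ?_ ?_ ?_).2
  · exact Eventually.of_forall fun y => Continuous.aestronglyMeasurable (by fun_prop)
  · exact Continuous.intervalIntegrable (by fun_prop) _ _
  · exact Continuous.aestronglyMeasurable (by fun_prop)
  · refine ae_of_all _ fun s hs y hy => hC (s, y) ⟨uIoc_subset_uIcc hs, Metric.ball_subset_closedBall hy⟩
  · exact intervalIntegrable_const
  · exact ae_of_all _ fun s _ y _ => hd s y

/-- Induction on n: the time derivative is h itself, and the space derivative is again such a
primitive, of ∂ₓh, with one derivative fewer. -/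
theorem contDiff_primitive (n : ℕ) : ∀ {h : ℝ × ℝ → ℝ}, ContDiff ℝ n h →
    ContDiff ℝ n fun p : ℝ × ℝ => ∫ s in (0 : ℝ)..p.1, h (s, p.2) := by
  have hcont : ∀ {h : ℝ × ℝ → ℝ}, Continuous h →
      Continuous fun p : ℝ × ℝ => ∫ s in (0 : ℝ)..p.1, h (s, p.2) := fun {h} hh =>
    intervalIntegral.continuous_parametric_intervalIntegral_of_continuous
      (f := fun (p : ℝ × ℝ) s => h (s, p.2)) (by fun_prop) continuous_fst
  induction n with
  | zero =>
    intro h hh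
    rw [Nat.cast_zero, contDiff_zero] at hh ⊢
    exact hcont hh
  | succ n ih =>
    intro h hh
    have hc : Continuous h := hh.continuous
    have hh' : ContDiff ℝ n fun p => fderiv ℝ h p (0, 1) :=
      (hh.fderiv_right (m := n) (by push_cast; exact le_rfl)).clm_apply contDiff_const
    refine contDiff_succ_of_partial (K := fun t x => ∫ s in (0 : ℝ)..t, h (s, x)) (k₁ := h)
      (k₂ := fun p => ∫ s in (0 : ℝ)..p.1, fderiv ℝ h (s, p.2) (0, 1)) ?_ ?_
      (hh.of_le (by exact_mod_cast Nat.le_succ n)) (ih hh')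
    · intro t x
      have : Continuous fun s => h (s, x) := by fun_prop
      exact intervalIntegral.integral_hasDerivAt_right (this.intervalIntegrable 0 t)
        (this.stronglyMeasurableAtFilter _ _) this.continuousAt
    · refine fun t x => hasDerivAt_integral_param hc hh'.continuous (fun s y => ?_) t x
      have h1 : HasFDerivAt h (fderiv ℝ h (s, y)) (s, y) :=
        (hh.differentiable (by simp) (s, y)).hasFDerivAt
      have h2 : HasDerivAt (fun y : ℝ => (s, y)) ((0 : ℝ), (1 : ℝ)) y :=
        (hasDerivAt_const y s).prodMk (hasDerivAt_id y)
      exact h1.comp_hasDerivAt y h2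

/-- `Φ` is the flow of the vector field `f` on the line. -/
structure IsFlow (f : ℝ → ℝ) (Φ : ℝ → ℝ → ℝ) : Prop where
  map_zero : ∀ x, Φ 0 x = x
  hasDerivAt : ∀ t x, HasDerivAt (fun t => Φ t x) (f (Φ t x)) t

theorem exists_isFlow {f : ℝ → ℝ} {K M : NNReal} (hf : LipschitzWith K f)
    (hM : ∀ x, ‖f x‖ ≤ M) : ∃ Φ, IsFlow f Φ := by
  choose γ h0 hd using exists_integralCurve hf hM
  exact ⟨fun t x => γ x t, h0, fun t x => hd x t⟩

namespace IsFlow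

variable {f : ℝ → ℝ} {Φ : ℝ → ℝ → ℝ}

theorem eq_of_hasDerivAt (hΦ : IsFlow f Φ) {K : NNReal} (hf : LipschitzWith K f) {γ : ℝ → ℝ}
    (hγ : ∀ t, HasDerivAt γ (f (γ t)) t) (t : ℝ) : γ t = Φ t (γ 0) :=
  congrFun (ODE_solution_unique_univ (v := fun _ => f) (s := fun _ => univ) (K := K) (t₀ := 0)
    (fun _ => hf.lipschitzOnWith) (fun t => ⟨hγ t, mem_univ _⟩)
    (fun t => ⟨hΦ.hasDerivAt t (γ 0), mem_univ _⟩) (hΦ.map_zero _).symm) t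

theorem map_add (hΦ : IsFlow f Φ) {K : NNReal} (hf : LipschitzWith K f) (s t x : ℝ) :
    Φ (s + t) x = Φ s (Φ t x) := by
  have h := hΦ.eq_of_hasDerivAt hf (γ := fun s => Φ (s + t) x)
    (fun s => (hΦ.hasDerivAt (s + t) x).comp_add_const s t) s
  simpa only [zero_add] using h

theorem add_period (hΦ : IsFlow f Φ) {K : NNReal} (hf : LipschitzWith K f) {c : ℝ}
    (hc : Function.Periodic f c) (t x : ℝ) : Φ t (x + c) = Φ t x + c := by
  have h := hΦ.eq_of_hasDerivAt hf (γ := fun s => Φ s x + c)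
    (fun s => by rw [hc]; exact (hΦ.hasDerivAt s x).add_const c) t
  simp only [hΦ.map_zero] at h
  exact h.symm

/-- The difference quotient of `f`. -/
def diffQuot (f : ℝ → ℝ) (a b : ℝ) : ℝ := ∫ r in (0 : ℝ)..1, deriv f (a + r * (b - a))

theorem continuous_diffQuot (hf : ContDiff ℝ ∞ f) :
    Continuous fun p : ℝ × ℝ => diffQuot f p.1 p.2 := by
  have : Continuous (deriv f) := hf.continuous_deriv (by simp)
  exact intervalIntegral.continuous_parametric_intervalIntegral_of_continuous'
    (f := fun (p : ℝ × ℝ) r => deriv f (p.1 + r * (p.2 - p.1))) (by fun_prop) 0 1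

theorem sub_eq_mul_diffQuot (hf : ContDiff ℝ ∞ f) (a b : ℝ) :
    f b - f a = diffQuot f a b * (b - a) := by
  have hc : Continuous (deriv f) := hf.continuous_deriv (by simp)
  have hd : ∀ r ∈ uIcc (0 : ℝ) 1, HasDerivAt (fun r => f (a + r * (b - a)))
      (deriv f (a + r * (b - a)) * (b - a)) r := by
    intro r _
    have h1 : HasDerivAt f (deriv f (a + r * (b - a))) (a + r * (b - a)) :=
      (hf.differentiable (by simp) _).hasDerivAt
    have h2 : HasDerivAt (fun r : ℝ => a + r * (b - a)) (b - a) r := by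
      simpa using ((hasDerivAt_id r).mul_const (b - a)).const_add a
    exact h1.comp r h2
  have h := intervalIntegral.integral_eq_sub_of_hasDerivAt hd
    (Continuous.intervalIntegrable (by fun_prop) _ _)
  rw [intervalIntegral.integral_mul_const] at h
  rw [diffQuot, h]
  simp

theorem continuous_time (hΦ : IsFlow f Φ) (x : ℝ) : Continuous fun t => Φ t x :=
  continuous_iff_continuousAt.2 fun t => (hΦ.hasDerivAt t x).continuousAt

/-- By the mean-value form of the difference quotient, the gap between two trajectories solves a
scalar linear equation. The explicit exponential yields both the Lipschitz bound and the derivative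
in the initial point. -/
theorem sub_eq_mul_exp (hΦ : IsFlow f Φ) (hf : ContDiff ℝ ∞ f) (t x y : ℝ) :
    Φ t y - Φ t x = (y - x) * Real.exp (∫ s in (0 : ℝ)..t, diffQuot f (Φ s x) (Φ s y)) := by
  have hq : Continuous fun s => diffQuot f (Φ s x) (Φ s y) :=
    (continuous_diffQuot hf).comp ((hΦ.continuous_time x).prodMk (hΦ.continuous_time y))
  set E : ℝ → ℝ := fun t => ∫ s in (0 : ℝ)..t, diffQuot f (Φ s x) (Φ s y) with hE
  have hEd : ∀ t, HasDerivAt E (diffQuot f (Φ t x) (Φ t y)) t := fun t =>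
    intervalIntegral.integral_hasDerivAt_right (hq.intervalIntegrable 0 t)
      (hq.stronglyMeasurableAtFilter _ _) hq.continuousAt
  have hd : ∀ t, HasDerivAt (fun t => (Φ t y - Φ t x) * Real.exp (-E t)) 0 t := by
    intro t
    have h := ((hΦ.hasDerivAt t y).sub (hΦ.hasDerivAt t x)).mul (hEd t).neg.exp
    refine h.congr_deriv ?_
    simp only [Pi.sub_apply, Pi.neg_apply]
    rw [sub_eq_mul_diffQuot hf]
    ring
  have h := is_const_of_deriv_eq_zero (fun t => (hd t).differentiableAt) (fun t => (hd t).deriv) t 0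
  have hE0 : E 0 = 0 := by simp [hE]
  simp only [hΦ.map_zero, hE0, neg_zero, Real.exp_zero, mul_one] at h
  rw [← h, mul_assoc, ← Real.exp_add]
  simp [hE]

theorem abs_sub_le (hΦ : IsFlow f Φ) (hf : ContDiff ℝ ∞ f) {K : ℝ} (hK : ∀ x, |deriv f x| ≤ K)
    (t x y : ℝ) : |Φ t y - Φ t x| ≤ |y - x| * Real.exp (K * |t|) := by
  have hq : ∀ a b, ‖diffQuot f a b‖ ≤ K := fun a b => by
    have := intervalIntegral.norm_integral_le_of_norm_le_const (a := (0 : ℝ)) (b := 1) (C := K)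
      (f := fun r => deriv f (a + r * (b - a))) (fun r _ => hK _)
    simpa [diffQuot] using this
  rw [hΦ.sub_eq_mul_exp hf, abs_mul, Real.abs_exp]
  gcongr
  refine (le_abs_self _).trans ?_
  have := intervalIntegral.norm_integral_le_of_norm_le_const (a := (0 : ℝ)) (b := t) (C := K)
      (f := fun s => diffQuot f (Φ s x) (Φ s y)) (fun s _ => hq _ _)
  simpa using this

theorem continuous_uncurry (hΦ : IsFlow f Φ) (hf : ContDiff ℝ ∞ f) {K : ℝ}
    (hK : ∀ x, |deriv f x| ≤ K) : Continuous fun p : ℝ × ℝ => Φ p.1 p.2 := by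
  rw [continuous_iff_continuousAt]
  rintro ⟨t, x⟩
  rw [ContinuousAt, tendsto_iff_norm_sub_tendsto_zero]
  have h1 : Continuous fun p : ℝ × ℝ =>
      |p.2 - x| * Real.exp (K * |p.1|) + |Φ p.1 x - Φ t x| := by
    have := (hΦ.continuous_time x).comp (continuous_fst (X := ℝ) (Y := ℝ))
    exact (by fun_prop : Continuous fun p : ℝ × ℝ => |p.2 - x| * Real.exp (K * |p.1|)).add
      (this.sub continuous_const).abs
  have h2 := h1.tendsto (t, x)
  simp only [sub_self, abs_zero, zero_mul, add_zero] at h2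
  refine squeeze_zero (fun _ => norm_nonneg _) (fun p => ?_) h2
  rw [Real.norm_eq_abs]
  calc |Φ p.1 p.2 - Φ t x| = |(Φ p.1 p.2 - Φ p.1 x) + (Φ p.1 x - Φ t x)| := by congr 1; ring
    _ ≤ _ := (abs_add_le _ _).trans (by gcongr; exact hΦ.abs_sub_le hf hK _ _ _)

/-- By `sub_eq_mul_exp` the slope in x is an exponential that is continuous up to y = x, where the
difference quotient becomes f'. -/
theorem hasDerivAt_space (hΦ : IsFlow f Φ) (hf : ContDiff ℝ ∞ f) {K : ℝ}
    (hK : ∀ x, |deriv f x| ≤ K) (t x : ℝ) :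
    HasDerivAt (fun x => Φ t x) (Real.exp (∫ s in (0 : ℝ)..t, deriv f (Φ s x))) x := by
  have hc := hΦ.continuous_uncurry hf hK
  rw [hasDerivAt_iff_tendsto_slope]
  have h1 : Continuous fun y => Real.exp (∫ s in (0 : ℝ)..t, diffQuot f (Φ s x) (Φ s y)) := by
    refine Real.continuous_exp.comp
      (intervalIntegral.continuous_parametric_intervalIntegral_of_continuous'
        (f := fun (y : ℝ) s => diffQuot f (Φ s x) (Φ s y)) ?_ 0 t)
    have h2 : Continuous fun p : ℝ × ℝ => (Φ p.2 x, Φ p.2 p.1) :=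
      ((hΦ.continuous_time x).comp continuous_snd).prodMk
        (hc.comp (continuous_snd.prodMk continuous_fst))
    exact (continuous_diffQuot hf).comp h2
  have h2 := h1.tendsto x
  have h3 : ∀ s, diffQuot f (Φ s x) (Φ s x) = deriv f (Φ s x) := fun s => by simp [diffQuot]
  simp only [h3] at h2
  refine (h2.mono_left nhdsWithin_le_nhds).congr' ?_
  filter_upwards [self_mem_nhdsWithin] with y hy
  have : y - x ≠ 0 := sub_ne_zero.2 hy
  rw [slope_def_field, hΦ.sub_eq_mul_exp hf]
  field_simp

/-- Bootstrap: both partial derivatives, f∘Φ and exp ∫ f'∘Φ, are as regular as Φ, so each pass gains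
one derivative. -/
theorem contDiff_nat (hΦ : IsFlow f Φ) (hf : ContDiff ℝ ∞ f) {K : ℝ}
    (hK : ∀ x, |deriv f x| ≤ K) (n : ℕ) : ContDiff ℝ n fun p : ℝ × ℝ => Φ p.1 p.2 := by
  induction n with
  | zero => exact contDiff_zero.2 (hΦ.continuous_uncurry hf hK)
  | succ n ih =>
    have hf' : ContDiff ℝ n (deriv f) :=
      ((contDiff_infty_iff_deriv.1 hf).2).of_le (by exact_mod_cast le_top)
    refine contDiff_succ_of_partial (K := Φ) (k₁ := fun p => f (Φ p.1 p.2))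
      (k₂ := fun p => Real.exp (∫ s in (0 : ℝ)..p.1, deriv f (Φ s p.2)))
      hΦ.hasDerivAt (hΦ.hasDerivAt_space hf hK) ((hf.of_le (by exact_mod_cast le_top)).comp ih) ?_
    exact (contDiff_primitive n (h := fun p => deriv f (Φ p.1 p.2)) (hf'.comp ih)).exp

theorem contDiff (hΦ : IsFlow f Φ) (hf : ContDiff ℝ ∞ f) {K : ℝ}
    (hK : ∀ x, |deriv f x| ≤ K) : ContDiff ℝ ∞ fun p : ℝ × ℝ => Φ p.1 p.2 :=
  contDiff_infty.2 (hΦ.contDiff_nat hf hK)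

end IsFlow

end Flow

/-! ### The transport operator `T_f` and its unitary group. -/

section TransportGroup

/-- Passes from pointwise to L² differentiability: the derivative is continuous jointly in time and
space, and periodicity reduces uniformity in x to a compact period. -/
theorem hasDerivAt_emb {u v : ℝ → Smooth} (hu : ∀ t x, HasDerivAt (fun t => u t x) (v t x) t)
    (hv : Continuous fun p : ℝ × ℝ => v p.1 p.2) :
    HasDerivAt (fun t => Smooth.emb (u t)) (Smooth.emb (v 0)) 0 := by
  rw [hasDerivAt_iff_isLittleO, Asymptotics.isLittleO_iff]
  intro ε hε
  have hunif : ∀ᶠ t in 𝓝 (0 : ℝ), ∀ x ∈ Icc 0 (2 * π), ‖v t x - v 0 x‖ < ε := by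
    refine isCompact_Icc.eventually_forall_of_forall_eventually fun x _ => ?_
    have hc : Continuous fun p : ℝ × ℝ => ‖v p.1 p.2 - v 0 p.2‖ :=
      (hv.sub (hv.comp (continuous_const.prodMk continuous_snd))).norm
    exact (hc.tendsto (0, x)).eventually_lt_const (by simpa using hε)
  obtain ⟨δ, hδ, h⟩ := Metric.eventually_nhds_iff.1 hunif
  have hall : ∀ t, dist t 0 < δ → ∀ x, ‖v t x - v 0 x‖ ≤ ε := by
    intro t ht x
    obtain ⟨y, hy, hxy⟩ := (v t - v 0).periodic.exists_mem_Ico₀ Real.two_pi_pos x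
    have := (h ht y (Ico_subset_Icc_self hy)).le
    rwa [← Smooth.sub_apply, ← hxy, Smooth.sub_apply] at this
  filter_upwards [Metric.ball_mem_nhds (0 : ℝ) hδ] with t ht
  have e1 : Smooth.emb (u t) - Smooth.emb (u 0) - (t - 0) • Smooth.emb (v 0) =
      Smooth.emb (u t - u 0 - (t : ℂ) • v 0) := by
    rw [map_sub, map_sub, map_smul, sub_zero]
    rfl
  rw [e1]
  refine Smooth.norm_emb_le _ fun x => ?_
  have hd : ∀ s ∈ Metric.ball (0 : ℝ) δ, HasDerivWithinAt
      (fun s : ℝ => u s x - (s : ℂ) * v 0 x) (v s x - v 0 x) (Metric.ball 0 δ) s := by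
    intro s _
    have h1 : HasDerivAt (fun s : ℝ => (s : ℂ) * v 0 x) (1 * v 0 x) s :=
      (Complex.ofRealCLM.hasDerivAt (x := s)).mul_const _
    rw [one_mul] at h1
    exact ((hu s x).sub h1).hasDerivWithinAt
  have h2 := (convex_ball (0 : ℝ) δ).norm_image_sub_le_of_norm_hasDerivWithin_le hd
    (fun s hs => hall s hs x) (Metric.mem_ball_self hδ) ht
  simp only [Complex.ofReal_zero, zero_mul, sub_zero] at h2
  refine le_trans (le_of_eq ?_) (h2.trans_eq (by rw [sub_zero]))
  simp only [Smooth.sub_apply, Smooth.smul_apply]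
  congr 1
  ring

/-- The action of `T_f` on smooth functions. -/
def Smooth.T (f F : Smooth) : Smooth := f * Smooth.D F + (1 / 2 : ℂ) • (Smooth.D f * F)

/-- The sum of the two inner products is the mean of (f F̄ F')', where the prime on F' only names
the second function; the term ½ f' is what makes this derivative exact. -/
theorem Smooth.T_skew {f : Smooth} (hf : star f = f) (F F' : Smooth) :
    inner ℂ (emb (T f F)) (emb F') + inner ℂ (emb F) (emb (T f F')) = 0 := by
  have hf' : star (D f) = D f := by rw [← D_star, hf]
  have h := mean_D (f * (star F * F'))
  rw [inner_emb, inner_emb, ← mean_add, ← h]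
  congr 1
  rw [D_mul, D_mul, D_star, T, T]
  ext x
  have e1 : star (f x) = f x := congrFun (congrArg Subtype.val hf) x
  have e2 : star (D f x) = D f x := congrFun (congrArg Subtype.val hf') x
  simp only [add_apply, mul_apply, smul_apply, star_apply, star_add, star_mul', e1, e2, star_div₀,
    star_one, star_ofNat]
  ring

theorem IsSmooth.exists_bound {f : Torus → ℝ} (hf : IsSmooth f) : ∃ C : NNReal, ∀ x, ‖f x‖ ≤ C := by
  obtain ⟨C, hC⟩ := isCompact_univ.exists_bound_of_continuousOn hf.continuous.continuousOn
  exact ⟨⟨C, (norm_nonneg _).trans (hC 0 (mem_univ _))⟩, fun x => hC x (mem_univ x)⟩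

namespace IsFlow

variable {f : Torus → ℝ} {Φ : ℝ → ℝ → ℝ}

theorem exists_lipschitz (hf : IsSmooth f) : ∃ K, LipschitzWith K fun x : ℝ => f x := by
  obtain ⟨K, hK⟩ := hf.dx.exists_bound
  exact ⟨K, lipschitzWith_of_nnnorm_deriv_le (ContDiff.differentiable hf (by simp)) fun x => by
    rw [← dx_coe]; exact hK x⟩

theorem map_add_torus (hΦ : IsFlow (fun x : ℝ => f x) Φ) (hf : IsSmooth f) (s t x : ℝ) :
    Φ (s + t) x = Φ s (Φ t x) := by
  obtain ⟨K, hK⟩ := exists_lipschitz hf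
  exact hΦ.map_add hK s t x

theorem add_two_pi (hΦ : IsFlow (fun x : ℝ => f x) Φ) (hf : IsSmooth f) (t x : ℝ) :
    Φ t (x + 2 * π) = Φ t x + 2 * π := by
  obtain ⟨K, hK⟩ := exists_lipschitz hf
  exact hΦ.add_period hK (fun y => by simp only; rw [AddCircle.coe_add_period]) t x

theorem contDiff_torus (hΦ : IsFlow (fun x : ℝ => f x) Φ) (hf : IsSmooth f) :
    ContDiff ℝ ∞ fun p : ℝ × ℝ => Φ p.1 p.2 := by
  obtain ⟨K, hK⟩ := hf.dx.exists_bound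
  exact hΦ.contDiff hf (K := K) fun x => by rw [← dx_coe]; exact hK x

/-- The square root of the Jacobian of the flow. -/
def weight (f : Torus → ℝ) (Φ : ℝ → ℝ → ℝ) (t x : ℝ) : ℝ :=
  Real.exp (∫ s in (0 : ℝ)..t, 1 / 2 * dx f (Φ s x))

theorem contDiff_integrand (hΦ : IsFlow (fun x : ℝ => f x) Φ) (hf : IsSmooth f) :
    ContDiff ℝ ∞ fun p : ℝ × ℝ => 1 / 2 * dx f (Φ p.1 p.2) :=
  contDiff_const.mul ((show ContDiff ℝ ∞ fun x : ℝ => dx f x from hf.dx).comp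
    (hΦ.contDiff_torus hf))

theorem contDiff_weight (hΦ : IsFlow (fun x : ℝ => f x) Φ) (hf : IsSmooth f) :
    ContDiff ℝ ∞ fun p : ℝ × ℝ => weight f Φ p.1 p.2 :=
  (contDiff_infty.2 fun n => contDiff_primitive n (h := fun p => 1 / 2 * dx f (Φ p.1 p.2))
    ((hΦ.contDiff_integrand hf).of_le (by exact_mod_cast le_top))).exp

theorem weight_zero (x : ℝ) : weight f Φ 0 x = 1 := by simp [weight]

theorem continuous_integrand (hΦ : IsFlow (fun x : ℝ => f x) Φ) (hf : IsSmooth f) (x : ℝ) :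
    Continuous fun s => 1 / 2 * dx f (Φ s x) :=
  (hΦ.contDiff_integrand hf).continuous.comp (continuous_id.prodMk continuous_const)

theorem hasDerivAt_weight (hΦ : IsFlow (fun x : ℝ => f x) Φ) (hf : IsSmooth f) (t x : ℝ) :
    HasDerivAt (fun t => weight f Φ t x) (1 / 2 * dx f (Φ t x) * weight f Φ t x) t := by
  have hc := hΦ.continuous_integrand hf x
  have h : HasDerivAt (fun t => ∫ s in (0 : ℝ)..t, 1 / 2 * dx f (Φ s x))
      (1 / 2 * dx f (Φ t x)) t :=
    intervalIntegral.integral_hasDerivAt_right (hc.intervalIntegrable 0 t)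
      (hc.stronglyMeasurableAtFilter _ _) hc.continuousAt
  refine h.exp.congr_deriv ?_
  rw [mul_comm]
  rfl

/-- The cocycle identity that makes weighted composition with the flow a group. -/
theorem weight_add (hΦ : IsFlow (fun x : ℝ => f x) Φ) (hf : IsSmooth f) (s t x : ℝ) :
    weight f Φ (s + t) x = weight f Φ s (Φ t x) * weight f Φ t x := by
  have hc := hΦ.continuous_integrand hf x
  have h1 : ∫ r in (0 : ℝ)..s, 1 / 2 * dx f (Φ r (Φ t x)) =
      ∫ r in t..(s + t), 1 / 2 * dx f (Φ r x) := by
    simp only [← hΦ.map_add_torus hf]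
    have := intervalIntegral.integral_comp_add_right (a := 0) (b := s)
      (fun r => 1 / 2 * dx f (Φ r x)) t
    rw [zero_add] at this
    exact this
  have h2 := intervalIntegral.integral_add_adjacent_intervals (μ := volume)
    (hc.intervalIntegrable 0 t) (hc.intervalIntegrable t (s + t))
  rw [weight, weight, weight, ← Real.exp_add, h1, ← h2, add_comm]

theorem weight_add_two_pi (hΦ : IsFlow (fun x : ℝ => f x) Φ) (hf : IsSmooth f) (t x : ℝ) :
    weight f Φ t (x + 2 * π) = weight f Φ t x := by
  simp only [weight, hΦ.add_two_pi hf, AddCircle.coe_add_period]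

/-- The transport group on smooth functions. -/
def transport (hΦ : IsFlow (fun x : ℝ => f x) Φ) (hf : IsSmooth f) (t : ℝ) :
    Smooth →ₗ[ℂ] Smooth where
  toFun F := ⟨fun x => F (Φ t x) * (weight f Φ t x : ℂ),
    (F.contDiff.comp ((hΦ.contDiff_torus hf).comp (contDiff_prodMk_right t))).mul
      (Complex.ofRealCLM.contDiff.comp
        ((hΦ.contDiff_weight hf).comp (contDiff_prodMk_right t))),
    fun x => by
      simp only
      rw [hΦ.add_two_pi hf, F.periodic, hΦ.weight_add_two_pi hf]⟩
  map_add' F G := Smooth.ext fun x => add_mul _ _ _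
  map_smul' c F := Smooth.ext fun x => mul_assoc _ _ _

theorem transport_apply (hΦ : IsFlow (fun x : ℝ => f x) Φ) (hf : IsSmooth f) (t : ℝ) (F : Smooth)
    (x : ℝ) : hΦ.transport hf t F x = F (Φ t x) * (weight f Φ t x : ℂ) := rfl

theorem transport_zero (hΦ : IsFlow (fun x : ℝ => f x) Φ) (hf : IsSmooth f) (F : Smooth) :
    hΦ.transport hf 0 F = F := by
  ext x
  rw [transport_apply, hΦ.map_zero, weight_zero, Complex.ofReal_one, mul_one]

theorem transport_add (hΦ : IsFlow (fun x : ℝ => f x) Φ) (hf : IsSmooth f) (s t : ℝ)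
    (F : Smooth) : hΦ.transport hf (s + t) F = hΦ.transport hf s (hΦ.transport hf t F) := by
  ext x
  rw [transport_apply, transport_apply, transport_apply, add_comm s t, hΦ.map_add_torus hf,
    hΦ.weight_add hf, Complex.ofReal_mul, mul_assoc]

/-- At every time the pointwise derivative is the transport of T_f F: the flow contributes f F' and
the weight contributes ½ f' F. -/
theorem hasDerivAt_transport (hΦ : IsFlow (fun x : ℝ => f x) Φ) (hf : IsSmooth f) (F : Smooth) :
    HasDerivAt (fun t => Smooth.emb (hΦ.transport hf t F))
      (Smooth.emb (Smooth.T (Smooth.ofReal f hf) F)) 0 := by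
  have h := hasDerivAt_emb (u := fun t => hΦ.transport hf t F)
    (v := fun t => hΦ.transport hf t (Smooth.T (Smooth.ofReal f hf) F)) ?_ ?_
  · rwa [transport_zero] at h
  · intro t x
    have h1 : HasDerivAt (fun t => F (Φ t x)) (f (Φ t x) • Smooth.D F (Φ t x)) t :=
      (F.hasDerivAt (Φ t x)).scomp t (hΦ.hasDerivAt t x)
    have h2 := h1.mul (hΦ.hasDerivAt_weight hf t x).ofReal_comp
    refine h2.congr_deriv ?_
    simp only [transport_apply, Smooth.T, Smooth.add_apply, Smooth.mul_apply, Smooth.smul_apply,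
      Smooth.D_ofReal, Smooth.ofReal_apply, Complex.real_smul]
    push_cast
    ring
  · simp only [transport_apply]
    exact ((Smooth.continuous _).comp (hΦ.contDiff_torus hf).continuous).mul
      (Complex.continuous_ofReal.comp (hΦ.contDiff_weight hf).continuous)

end IsFlow

/-- Moves the zeroth-order term to the test function: T_f F = (fF)' - ½ f' F, so the distributional
definition says that η is minus the adjoint of T_f on smooth functions applied to ψ. -/
theorem mem_opT_iff {f : Torus → ℝ} (hf : IsSmooth f) (ψ η : L2) :
    (ψ, η) ∈ opT f ↔ ∀ F : Smooth, inner ℂ (Smooth.emb (Smooth.T (Smooth.ofReal f hf) F)) ψ =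
      -inner ℂ (Smooth.emb F) η := by
  have hm : Continuous fun x => ((1 / 2 * dx f x : ℝ) : ℂ) := by
    have := hf.dx.continuous
    fun_prop
  have hmt : (fun x => ((1 / 2 * dx f x : ℝ) : ℂ)) =
      ((1 / 2 : ℂ) • Smooth.ofReal (dx f) hf.dx).tor := by
    funext x
    induction x using QuotientAddGroup.induction_on
    simp [Smooth.tor_coe]
  have hweak : ∀ ζ : L2, IsWeakTransport f ψ ζ ↔ ∀ F : Smooth, inner ℂ (Smooth.emb F) ζ =
      -inner ℂ (Smooth.emb (Smooth.D (Smooth.ofReal f hf * F))) ψ := by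
    have h1 : ∀ G : Smooth, dx (fun y => (f y : ℂ) * G.tor y) =
        (Smooth.D (Smooth.ofReal f hf * G)).tor := by
      intro G
      rw [← Smooth.dx_tor]
      congr 1
      funext x
      induction x using QuotientAddGroup.induction_on
      rfl
    have h2 : ∀ G : Smooth, star (Smooth.D (Smooth.ofReal f hf * G)) =
        Smooth.D (Smooth.ofReal f hf * star G) := by
      intro G
      rw [← Smooth.D_star, star_mul', Smooth.star_ofReal]
    intro ζ
    constructor
    · intro h F
      have := h (star F).tor (star F).isSmooth_tor
      rw [h1, Smooth.integral_mul_tor, Smooth.integral_mul_tor, h2, star_star] at this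
      exact this
    · intro h θ hθ
      have := h (star (Smooth.ofTorus θ hθ))
      rw [← h2, ← Smooth.integral_mul_tor, ← Smooth.integral_mul_tor, ← h1,
        Smooth.tor_ofTorus] at this
      exact this
  have hsplit : ∀ F : Smooth, inner ℂ (Smooth.emb (Smooth.T (Smooth.ofReal f hf) F)) ψ =
      inner ℂ (Smooth.emb (Smooth.D (Smooth.ofReal f hf * F))) ψ -
        inner ℂ (Smooth.emb F) (mulOp (fun x => ((1 / 2 * dx f x : ℝ) : ℂ)) ψ) := by
    intro F
    have h1 : inner ℂ (Smooth.emb F) (mulOp (fun x => ((1 / 2 * dx f x : ℝ) : ℂ)) ψ) =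
        inner ℂ (mulOp (fun x => ((1 / 2 * dx f x : ℝ) : ℂ)) (Smooth.emb F)) ψ := by
      rw [inner_mulOp hm]
      congr 2
      funext x
      exact (Complex.conj_ofReal _).symm
    rw [h1, hmt, Smooth.mulOp_emb, ← inner_sub_left, ← map_sub]
    congr 2
    rw [Smooth.T, Smooth.D_mul, Smooth.D_ofReal]
    ext x
    simp only [Smooth.add_apply, Smooth.sub_apply, Smooth.mul_apply, Smooth.smul_apply]
    ring
  constructor
  · rintro ⟨ζ, hζ, h⟩ F
    simp only at h hζ
    rw [hsplit, h, inner_add_right, (hweak ζ).1 hζ F]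
    ring
  · intro h
    refine ⟨η - mulOp (fun x => ((1 / 2 * dx f x : ℝ) : ℂ)) ψ, (hweak _).2 fun F => ?_,
      (sub_add_cancel _ _).symm⟩
    have := h F
    rw [hsplit] at this
    rw [inner_sub_right]
    linear_combination this

/-- `T_f` generates a unitary group which preserves the smooth functions. -/
theorem exists_isUnitaryGroupGeneratedBy_opT {f : Torus → ℝ} (hf : IsSmooth f) :
    IsUnitaryGroupGeneratedBy (expGroup (opT f)) (opT f) ∧
      ∀ t F, ∃ F', expGroup (opT f) t (Smooth.emb F) = Smooth.emb F' := by
  suffices h : ∃ U, IsUnitaryGroupGeneratedBy U (opT f) ∧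
      ∀ t F, ∃ F', U t (Smooth.emb F) = Smooth.emb F' by
    obtain ⟨U, hU, h⟩ := h
    rw [hU.expGroup_eq]
    exact ⟨hU, h⟩
  obtain ⟨K, hK⟩ := IsFlow.exists_lipschitz hf
  obtain ⟨M, hM⟩ := hf.exists_bound
  obtain ⟨Φ, hΦ⟩ := exists_isFlow hK fun x => hM x
  obtain ⟨U, hU, hUe⟩ := exists_isUnitaryGroup_of_dense Smooth.denseRange_emb
    (hΦ.transport_zero hf) (hΦ.transport_add hf) (hΦ.hasDerivAt_transport hf)
    (Smooth.T_skew (Smooth.star_ofReal f hf))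
  have hG : ∀ F, HasDerivAt (fun t => U t (Smooth.emb F))
      (Smooth.emb (Smooth.T (Smooth.ofReal f hf) F)) 0 := fun F => by
    simpa only [hUe] using hΦ.hasDerivAt_transport hf F
  have hgen : ∀ ψ η, (ψ, η) ∈ opT f ↔ HasDerivAt (fun t => U t ψ) η 0 := fun ψ η =>
    (mem_opT_iff hf ψ η).trans
      (hU.hasDerivAt_iff_weak Smooth.denseRange_emb hG (fun t F => ⟨_, hUe t F⟩) ψ η).symm
  refine ⟨U, ⟨?_, hU.map_zero, hU.map_add, hU.continuous, hgen⟩, fun t F => ⟨_, hUe t F⟩⟩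
  refine Smooth.denseRange_emb.mono ?_
  rintro _ ⟨F, rfl⟩
  exact ⟨_, (hgen _ _).2 (hG F)⟩

theorem hasDerivAt_expT {f : Torus → ℝ} (hf : IsSmooth f) (F : Smooth) :
    HasDerivAt (fun t => expGroup (opT f) t (Smooth.emb F))
      (Smooth.emb (Smooth.T (Smooth.ofReal f hf) F)) 0 := by
  refine ((exists_isUnitaryGroupGeneratedBy_opT hf).1.generator _ _).1 ((mem_opT_iff hf _ _).2 ?_)
  intro F'
  exact eq_neg_of_add_eq_zero_left (Smooth.T_skew (Smooth.star_ofReal f hf) F' F)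

end TransportGroup

/-! ### The conjugated operator and the iterated limit of the products. -/

section Limits

/-- Conjugation of a unitary group. -/
def conjGroup {H : Type*} [NormedAddCommGroup H] [InnerProductSpace ℂ H] (P : H ≃ₗᵢ[ℂ] H)
    (U : ℝ → H ≃ₗᵢ[ℂ] H) (t : ℝ) : H ≃ₗᵢ[ℂ] H := P.symm.trans ((U t).trans P)

theorem conjGroup_apply {H : Type*} [NormedAddCommGroup H] [InnerProductSpace ℂ H]
    (P : H ≃ₗᵢ[ℂ] H) (U : ℝ → H ≃ₗᵢ[ℂ] H) (t : ℝ) (ψ : H) :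
    conjGroup P U t ψ = P (U t (P.symm ψ)) := rfl

theorem IsUnitaryGroup.conjGroup {H : Type*} [NormedAddCommGroup H] [InnerProductSpace ℂ H]
    {U : ℝ → H ≃ₗᵢ[ℂ] H} (hU : IsUnitaryGroup U) (P : H ≃ₗᵢ[ℂ] H) :
    IsUnitaryGroup (conjGroup P U) where
  map_zero ψ := by rw [conjGroup_apply, hU.map_zero, P.apply_symm_apply]
  map_add s t ψ := by
    rw [conjGroup_apply, conjGroup_apply, conjGroup_apply, P.symm_apply_apply, hU.map_add]
  continuous ψ := P.continuous.comp (hU.continuous (P.symm ψ))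

theorem IsUnitaryGroup.rescale {H : Type*} [NormedAddCommGroup H] [InnerProductSpace ℂ H]
    {U : ℝ → H ≃ₗᵢ[ℂ] H} (hU : IsUnitaryGroup U) (c : ℝ) :
    IsUnitaryGroup fun t => U (c * t) where
  map_zero ψ := by rw [mul_zero, hU.map_zero]
  map_add s t ψ := by rw [mul_add, hU.map_add]
  continuous ψ := (hU.continuous ψ).comp (by fun_prop)

theorem hasDerivAt_rescale {H : Type*} [NormedAddCommGroup H] [InnerProductSpace ℂ H]
    {U : ℝ → H ≃ₗᵢ[ℂ] H} {ψ η : H} (h : HasDerivAt (fun t => U t ψ) η 0) (c : ℝ) :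
    HasDerivAt (fun t => U (c * t) ψ) (c • η) 0 := by
  have h1 : HasDerivAt (fun t : ℝ => c * t) c 0 := by
    simpa using (hasDerivAt_id (0 : ℝ)).const_mul c
  have h2 : HasDerivAt (fun t => U t ψ) η (c * 0) := by rwa [mul_zero]
  exact h2.scomp 0 h1

namespace Smooth

theorem expI_mul_expI_neg (θ : Torus → ℝ) (h : IsSmooth θ) (h' : IsSmooth fun x => -θ x)
    (F : Smooth) : expI θ h * (expI (fun x => -θ x) h' * F) = F := by
  ext x
  rw [mul_apply, mul_apply, expI_apply, expI_apply, ← mul_assoc, ← Complex.exp_add]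
  simp

theorem D_add (F G : Smooth) : D (F + G) = D F + D G := Derivation.map_add D F G

theorem D_sub (F G : Smooth) : D (F - G) = D F - D G := Derivation.map_sub D F G

theorem D_smul (c : ℂ) (F : Smooth) : D (c • F) = c • D F := Derivation.map_smul D c F

/-- First order part of the conjugated operator `e^{iθ} L e^{-iθ}`. -/
def conjFst (α : ℝ) (b F : Smooth) : Smooth :=
  (α : ℂ) • ((2 : ℂ) • (b * D F) + D b * F) +
    Complex.I • ((3 : ℂ) • (b * D (D F)) + (3 : ℂ) • (D b * D F) + D (D b) * F)

/-- Expansion of the conjugated operator `e^{iθ} L e^{-iθ}` for `θ' = c b`. -/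
theorem expI_mul_L (α : ℝ) (θ : Torus → ℝ) (h : IsSmooth θ) (h' : IsSmooth fun x => -θ x)
    {b : Smooth} {c : ℂ} (hb : ofReal (dx θ) h.dx = c • b) (F : Smooth) :
    expI θ h * L α (expI (fun x => -θ x) h' * F) =
      L α F + c • conjFst α b F +
        c ^ 2 • (T ((3 : ℂ) • (b * b)) F - (Complex.I * α) • (b * b * F)) -
        (c ^ 3 * Complex.I) • (b * b * b * F) := by
  have hneg : ofReal (dx fun x => -θ x) h'.dx = -(c • b) := by
    rw [← hb]
    ext x
    simp only [ofReal_apply, neg_apply, dx_coe]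
    rw [deriv.fun_neg]
    push_cast
    rfl
  -- Moving e^{-iθ} past the derivative replaces D by D - i c b, so `L` becomes the same polynomial
  -- in that operator, expanded below in powers of c.
  have hD : ∀ G : Smooth, D (expI (fun x => -θ x) h' * G) =
      expI (fun x => -θ x) h' * (D G - (Complex.I * c) • (b * G)) := by
    intro G
    rw [D_mul, D_expI, hneg]
    ext x
    simp only [add_apply, sub_apply, neg_apply, mul_apply, smul_apply]
    ring
  have hL : L α (expI (fun x => -θ x) h' * F) = expI (fun x => -θ x) h' *
      (-(D (D (D F - (Complex.I * c) • (b * F)) - (Complex.I * c) • (b * (D F - (Complex.I * c) •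
          (b * F)))) - (Complex.I * c) • (b * (D (D F - (Complex.I * c) • (b * F)) -
            (Complex.I * c) • (b * (D F - (Complex.I * c) • (b * F)))))) +
        (Complex.I * α) • (D (D F - (Complex.I * c) • (b * F)) -
          (Complex.I * c) • (b * (D F - (Complex.I * c) • (b * F))))) := by
    rw [L, hD, hD, hD]
    ext x
    simp only [add_apply, neg_apply, mul_apply, smul_apply]
    ring
  rw [hL, expI_mul_expI_neg, L, conjFst, T]
  simp only [D_add, D_sub, D_smul, D_mul]
  ext x
  simp only [add_apply, sub_apply, neg_apply, mul_apply, smul_apply]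
  have h3 : Complex.I ^ 3 = -Complex.I := by rw [pow_succ, Complex.I_sq]; ring
  ring_nf
  simp only [Complex.I_sq, h3]
  ring

end Smooth

theorem isUnitaryGroup_conjL (α : ℝ) (θ : C(Torus, ℝ)) (c : ℝ) :
    IsUnitaryGroup (conjGroup (phaseEquiv θ) fun t => expGroup (opL α) (c * t)) :=
  ((isUnitaryGroup_expL α).rescale c).conjGroup _

theorem hasDerivAt_conjL (α : ℝ) (θ : C(Torus, ℝ)) (h : IsSmooth θ) (h' : IsSmooth fun x => -θ x)
    (c : ℝ) (F : Smooth) :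
    HasDerivAt (fun t => conjGroup (phaseEquiv θ) (fun t => expGroup (opL α) (c * t)) t
      (Smooth.emb F))
      (Smooth.emb ((c : ℂ) • (Smooth.expI θ h *
        Smooth.L α (Smooth.expI (fun x => -θ x) h' * F)))) 0 := by
  have h1 := hasDerivAt_rescale (hasDerivAt_expL α (Smooth.expI (fun x => -θ x) h' * F)) c
  have h2 := (phaseEquiv θ).hasDerivAt_comp h1
  have e : phaseEquiv θ ((c : ℂ) • Smooth.emb
      (Smooth.L α (Smooth.expI (fun x => -θ x) h' * F))) =
      Smooth.emb ((c : ℂ) • (Smooth.expI θ h *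
        Smooth.L α (Smooth.expI (fun x => -θ x) h' * F))) := by
    rw [map_smul, phaseEquiv_apply, Smooth.phase_emb θ h, map_smul]
  have e' : ∀ t, conjGroup (phaseEquiv θ) (fun t => expGroup (opL α) (c * t)) t (Smooth.emb F) =
      phaseEquiv θ (expGroup (opL α) (c * t)
        (Smooth.emb (Smooth.expI (fun x => -θ x) h' * F))) := by
    intro t
    rw [← Smooth.phase_emb]
    rfl
  simp only [e']
  exact h2.congr_deriv e

theorem IsSmooth.neg {θ : Torus → ℝ} (h : IsSmooth θ) : IsSmooth fun x => -θ x :=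
  ContDiff.neg h

theorem IsSmooth.div_const {θ : Torus → ℝ} (h : IsSmooth θ) (c : ℝ) :
    IsSmooth fun x => θ x / c :=
  ContDiff.div_const h c

theorem Smooth.ofReal_dx_div (φ : Torus → ℝ) (h : IsSmooth φ) (c : ℝ) :
    Smooth.ofReal (dx fun x => φ x / c) (h.div_const c).dx =
      ((c⁻¹ : ℝ) : ℂ) • Smooth.ofReal (dx φ) h.dx := by
  ext x
  simp only [Smooth.smul_apply, Smooth.ofReal_apply, dx_coe]
  rw [deriv_div_const, div_eq_inv_mul]
  push_cast
  rfl

/-- A smooth real function as a continuous map. -/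
def IsSmooth.toC {θ : Torus → ℝ} (h : IsSmooth θ) : C(Torus, ℝ) := ⟨θ, h.continuous⟩

@[simp] theorem IsSmooth.toC_apply {θ : Torus → ℝ} (h : IsSmooth θ) (x : Torus) :
    h.toC x = θ x := rfl

/-- A perturbation of a unitary group by the multiplication with `iθ`. -/
theorem exists_isPerturbation_mul {U : ℝ → L2 ≃ₗᵢ[ℂ] L2} (hU : IsUnitaryGroup U)
    (θ : C(Torus, ℝ)) : ∃ V, IsPerturbation U
      (mulCLM (fun x => Complex.I * (θ x : ℂ)) (by fun_prop)) V :=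
  hU.exists_isPerturbation fun x y => inner_mulOp_I_skew θ.continuous x y

theorem isSmooth_gFun (α : ℝ) {φ : Torus → ℝ} (hφ : IsSmooth φ) (τ : ℝ) :
    IsSmooth (gFun α φ τ) := by
  have h : ContDiff ℝ ∞ fun x : ℝ => dx φ x := hφ.dx
  exact (h.pow 3).add (contDiff_const.mul (h.pow 2))

theorem isSmooth_three_mul_sq {φ : Torus → ℝ} (hφ : IsSmooth φ) :
    IsSmooth fun x => 3 * dx φ x ^ 2 := by
  have h : ContDiff ℝ ∞ fun x : ℝ => dx φ x := hφ.dx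
  exact contDiff_const.mul (h.pow 2)

/-- The inner limit is the Lie–Trotter formula at time one for the conjugated group perturbed by i
g_τ/√τ. The outer one is `IsUnitaryGroup.tendsto_of_core` with C^∞(𝕋) as core. The first limit is
obtained for every real τ, since the Trotter argument does not use its sign. -/
theorem exists_limit_W (α : ℝ) {φ : Torus → ℝ} (hφ : IsSmooth φ) :
    ∃ Wlim : ℝ → L2 → L2,
      (∀ τ, ∀ ψ : L2, Tendsto (fun n : ℕ => W α φ τ n ψ) atTop (𝓝 (Wlim τ ψ))) ∧
      (∀ ψ : L2, Tendsto (fun τ => Wlim τ ψ) (𝓝[>] 0)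
        (𝓝 (expGroup (opT fun x => 3 * dx φ x ^ 2) 1 ψ))) := by
  have hf := isSmooth_three_mul_sq hφ
  have hθ : ∀ τ : ℝ, IsSmooth fun x => φ x / √τ := fun τ => hφ.div_const _
  have hg : ∀ τ : ℝ, IsSmooth fun x => gFun α φ τ x / √τ := fun τ =>
    (isSmooth_gFun α hφ τ).div_const _
  let U : ℝ → ℝ → L2 ≃ₗᵢ[ℂ] L2 := fun τ =>
    conjGroup (phaseEquiv (hθ τ).toC) fun t => expGroup (opL α) (τ * t)
  have hU : ∀ τ, IsUnitaryGroup (U τ) := fun τ => isUnitaryGroup_conjL α _ τ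
  choose V hV using fun τ => exists_isPerturbation_mul (hU τ) (hg τ).toC
  refine ⟨fun τ ψ => V τ 1 ψ, fun τ ψ => ?_, fun ψ => ?_⟩
  · have h := (hV τ).tendsto_trotter (hU τ) (isUnitaryGroup_phaseGroup (hg τ).toC)
      (hasDerivAt_phaseGroup (hg τ).toC) zero_le_one ψ
    refine h.congr fun n => ?_
    rw [W]
    congr 2
    funext x
    have e1 : (fun y => 1 / (n : ℝ) * (gFun α φ τ y / √τ)) =
        fun y => gFun α φ τ y / (n * √τ) := by
      funext y
      rw [div_mul_div_comm, one_mul]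
    rw [phaseGroup_apply, ← e1, ← mul_one_div τ (n : ℝ)]
    rfl
  · set b := Smooth.ofReal (dx φ) hφ.dx with hb
    refine IsUnitaryGroup.tendsto_of_core (fun τ => (hV τ).isUnitaryGroup)
      (exists_isUnitaryGroupGeneratedBy_opT hf).1.isUnitaryGroup Smooth.denseRange_emb
      (hasDerivAt_expT hf) (exists_isUnitaryGroupGeneratedBy_opT hf).2
      (A := fun τ F => Smooth.emb ((τ : ℂ) • (Smooth.expI (fun x => φ x / √τ) (hθ τ) *
        Smooth.L α (Smooth.expI (fun x => -(φ x / √τ)) (hθ τ).neg * F)) +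
        Complex.I • (Smooth.ofReal _ (hg τ) * F))) (fun τ F => ?_) (fun F => ?_) zero_le_one ψ
    · have h1 := (hV τ).hasDerivAt (hU τ)
        (hasDerivAt_conjL α (hθ τ).toC (hθ τ) (hθ τ).neg τ F)
      refine h1.congr_deriv ?_
      rw [map_add, mulCLM_apply]
      exact congrArg _ (Smooth.mulOp_I_emb _ (hg τ) F)
    -- For τ > 0 the perturbed generator on F is exactly T_f F + √τ (second order) + τ L F: g_τ was
    -- chosen to cancel the singular term in (φ')³ and the term in α(φ')².
    · have hlim : Tendsto (fun τ : ℝ => Smooth.emb (Smooth.T (Smooth.ofReal _ hf) F) +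
          (√τ • Smooth.emb (Smooth.conjFst α b F) + τ • Smooth.emb (Smooth.L α F)))
          (𝓝[>] 0) (𝓝 (Smooth.emb (Smooth.T (Smooth.ofReal _ hf) F))) := by
        have hc : Continuous fun τ : ℝ => Smooth.emb (Smooth.T (Smooth.ofReal _ hf) F) +
          (√τ • Smooth.emb (Smooth.conjFst α b F) + τ • Smooth.emb (Smooth.L α F)) :=
          continuous_const.add (((Real.continuous_sqrt).smul continuous_const).add
            (continuous_id.smul continuous_const))
        have := (hc.tendsto 0).mono_left (nhdsWithin_le_nhds (s := Ioi 0))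
        simpa using this
      refine hlim.congr' ?_
      filter_upwards [self_mem_nhdsWithin] with τ (hτ : 0 < τ)
      have hs : (√τ : ℂ) ≠ 0 := by
        exact_mod_cast (Real.sqrt_pos.2 hτ).ne'
      have hs2 : (τ : ℂ) = (√τ : ℂ) ^ 2 := by
        rw [← Complex.ofReal_pow, Real.sq_sqrt hτ.le]
      have e1 : ∀ (r : ℝ) (ψ : L2), r • ψ = (r : ℂ) • ψ := fun r ψ => rfl
      have e2 : Smooth.ofReal _ hf = (3 : ℂ) • (b * b) := by
        ext x
        rw [Smooth.smul_apply, Smooth.mul_apply, hb, Smooth.ofReal_apply, Smooth.ofReal_apply]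
        push_cast
        ring
      rw [Smooth.expI_mul_L α (fun x => φ x / √τ) (hθ τ) (hθ τ).neg (Smooth.ofReal_dx_div φ hφ √τ), e1, e1,
        ← map_smul, ← map_smul, ← map_add, ← map_add, ← hb, ← e2]
      congr 1
      ext x
      simp only [Smooth.add_apply, Smooth.sub_apply, Smooth.mul_apply, Smooth.smul_apply,
        Smooth.ofReal_apply, gFun]
      push_cast
      rw [hs2]
      have e3 : b x = ((dx φ x : ℝ) : ℂ) := rfl
      rw [e3]
      field_simp
      ring

end Limits

/-! ### Piecewise constant controls, mild solutions and the calculus of reachable operators. -/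

section Control

variable {q : ℕ}

/-- The potential of a constant control. -/
def potential (Q : Fin q → Torus → ℝ) (c : Fin q → ℝ) (x : Torus) : ℝ := ∑ j, c j * Q j x

theorem isSmooth_potential {Q : Fin q → Torus → ℝ} (hQ : ∀ j, IsSmooth (Q j)) (c : Fin q → ℝ) :
    IsSmooth (potential Q c) :=
  ContDiff.sum fun j _ => contDiff_const.mul (hQ j)

theorem potential_smul (Q : Fin q → Torus → ℝ) (r : ℝ) (c : Fin q → ℝ) (x : Torus) :
    potential Q (r • c) x = r * potential Q c x := by
  simp only [potential, Pi.smul_apply, smul_eq_mul, mul_assoc, Finset.mul_sum]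

theorem exists_constGroup (α : ℝ) {Q : Fin q → Torus → ℝ} (hQ : ∀ j, IsSmooth (Q j))
    (c : Fin q → ℝ) : ∃ V, IsPerturbation (expGroup (opL α))
      (mulCLM (fun x => Complex.I * ((isSmooth_potential hQ c).toC x : ℂ)) (by fun_prop)) V :=
  exists_isPerturbation_mul (isUnitaryGroup_expL α) _

/-- The evolution with a constant control. -/
def constGroup (α : ℝ) {Q : Fin q → Torus → ℝ} (hQ : ∀ j, IsSmooth (Q j)) (c : Fin q → ℝ) :
    ℝ → L2 ≃ₗᵢ[ℂ] L2 := (exists_constGroup α hQ c).choose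

theorem constGroup_spec (α : ℝ) {Q : Fin q → Torus → ℝ} (hQ : ∀ j, IsSmooth (Q j))
    (c : Fin q → ℝ) : IsPerturbation (expGroup (opL α))
      (mulCLM (fun x => Complex.I * ((isSmooth_potential hQ c).toC x : ℂ)) (by fun_prop))
      (constGroup α hQ c) := (exists_constGroup α hQ c).choose_spec

/-- The evolution operators of piecewise constant controls, with their final times. -/
inductive IsEvolution (α : ℝ) {Q : Fin q → Torus → ℝ} (hQ : ∀ j, IsSmooth (Q j)) :
    ℝ → (L2 → L2) → Prop
  | refl : IsEvolution α hQ 0 id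
  | step {T : ℝ} {P : L2 → L2} (c : Fin q → ℝ) {t : ℝ} (ht : 0 ≤ t) (h : IsEvolution α hQ T P) :
      IsEvolution α hQ (T + t) (constGroup α hQ c t ∘ P)

/-- The right hand side of Duhamel's formula in the interaction picture. -/
def interaction (α : ℝ) (Q : Fin q → Torus → ℝ) (u : ℝ → Fin q → ℝ) (ψ : ℝ → L2) (s : ℝ) : L2 :=
  expGroup (opL α) (-s) (mulOp (fun x => Complex.I * ((∑ j, u s j * Q j x : ℝ) : ℂ)) (ψ s))

/-- Factoring e^{(t-s)L} = e^{tL} e^{-sL} leaves a plain primitive. The control may jump, so only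
integrability of the integrand is available, and that already makes the primitive continuous. -/
theorem isSolution_of_interaction {α : ℝ} {Q : Fin q → Torus → ℝ} {T : ℝ} {u : ℝ → Fin q → ℝ}
    {ψ₀ : L2} {ψ : ℝ → L2} (hT : 0 ≤ T)
    (hint : IntervalIntegrable (interaction α Q u ψ) volume 0 T)
    (h : ∀ t ∈ Icc 0 T, ψ t =
      expGroup (opL α) t (ψ₀ + ∫ s in (0 : ℝ)..t, interaction α Q u ψ s)) :
    IsSolution α Q T u ψ₀ ψ := by
  have hU := isUnitaryGroup_expL α
  constructor
  · have h1 : ContinuousOn (fun t => ∫ s in (0 : ℝ)..t, interaction α Q u ψ s) (Icc 0 T) := by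
      have := intervalIntegral.continuousOn_primitive_interval' hint (left_mem_uIcc)
      rwa [uIcc_of_le hT] at this
    have h2 : ContinuousOn (fun t => expGroup (opL α) t
        (ψ₀ + ∫ s in (0 : ℝ)..t, interaction α Q u ψ s)) (Icc 0 T) :=
      hU.continuous_uncurry.comp_continuousOn (continuousOn_id.prodMk (continuousOn_const.add h1))
    exact h2.congr h
  · intro t ht
    rw [h t ht, map_add]
    congr 1
    have hint' : IntervalIntegrable (interaction α Q u ψ) volume 0 t :=
      hint.mono_set (by rw [uIcc_of_le hT, uIcc_of_le ht.1]; exact Icc_subset_Icc_right ht.2)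
    have h1 := ((expGroup (opL α) t).toContinuousLinearEquiv.toContinuousLinearMap
      ).intervalIntegral_comp_comm hint'
    refine h1.symm.trans (intervalIntegral.integral_congr fun s _ => ?_)
    change expGroup (opL α) t (expGroup (opL α) (-s) _) = _
    rw [← hU.map_add, sub_eq_add_neg]

theorem IsPWC.extend {T : ℝ} {u : ℝ → Fin q → ℝ} (hu : IsPWC T u) (c : Fin q → ℝ) {t : ℝ}
    (ht : 0 ≤ t) : IsPWC (T + t) fun s => if s ≤ T then u s else c := by
  obtain ⟨m, p, hp, hp0, hpm, h⟩ := hu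
  refine ⟨m + 1, fun i => if i ≤ m then p i else T + t, ?_, by simpa using hp0, by simp, ?_⟩
  · intro i j hij
    simp only
    split_ifs with h1 h2 h2
    · exact hp hij
    · have := hp h1
      rw [hpm] at this
      linarith
    · omega
    · exact le_rfl
  · intro i hi
    rcases Nat.lt_succ_iff_lt_or_eq.1 hi with h1 | rfl
    · obtain ⟨d, hd⟩ := h i h1
      refine ⟨d, fun s hs => ?_⟩
      simp only [if_pos h1.le, if_pos (Nat.succ_le_of_lt h1)] at hs
      have : s ≤ T := by
        rw [← hpm]
        exact hs.2.le.trans (hp (Nat.succ_le_of_lt h1))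
      simp only [if_pos this]
      exact hd s hs
    · refine ⟨c, fun s hs => ?_⟩
      simp only [if_pos le_rfl, hpm] at hs
      simp only [if_neg (not_le.2 hs.1)]

/-- Induction on the number of pieces. In the interaction picture a new piece just adds its integral
to the old one, so integrability and the integrated identity are carried through the induction. -/
theorem IsEvolution.exists_solution {α : ℝ} {Q : Fin q → Torus → ℝ} {hQ : ∀ j, IsSmooth (Q j)}
    {T : ℝ} {P : L2 → L2} (hP : IsEvolution α hQ T P) (ψ₀ : L2) :
    0 ≤ T ∧ ∃ u, IsPWC T u ∧ ∃ ψ : ℝ → L2, ψ T = P ψ₀ ∧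
      IntervalIntegrable (interaction α Q u ψ) volume 0 T ∧
      ∀ t ∈ Icc 0 T, ψ t =
        expGroup (opL α) t (ψ₀ + ∫ s in (0 : ℝ)..t, interaction α Q u ψ s) := by
  have hU := isUnitaryGroup_expL α
  induction hP with
  | refl =>
    refine ⟨le_rfl, fun _ => 0, ⟨0, fun _ => 0, monotone_const, rfl, rfl, by simp⟩, fun _ => ψ₀, rfl,
      by simp, fun t ht => ?_⟩
    have : t = 0 := le_antisymm ht.2 ht.1
    rw [this, hU.map_zero]
    simp
  | @step T P c r hr hP ih =>
    obtain ⟨hT, u, hu, ψ, hψT, hint, h⟩ := ih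
    have hV := constGroup_spec α hQ c
    set V := constGroup α hQ c with hVdef
    set u' : ℝ → Fin q → ℝ := fun s => if s ≤ T then u s else c with hu'
    set ψ' : ℝ → L2 := fun s => if s ≤ T then ψ s else V (s - T) (P ψ₀) with hψ'
    have hψ'T : ∀ s, T ≤ s → ψ' s = V (s - T) (P ψ₀) := by
      intro s hs
      rcases hs.eq_or_lt with rfl | hs
      · rw [hψ', sub_self, hV.isUnitaryGroup.map_zero, ← hψT]
        simp
      · simp only [hψ', if_neg (not_le.2 hs)]
    have hleft : ∀ s, s ≤ T → interaction α Q u' ψ' s = interaction α Q u ψ s := by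
      intro s hs
      simp only [interaction, hu', hψ', if_pos hs]
    let g : ℝ → L2 := fun s => expGroup (opL α) (-s) (mulCLM (fun x => Complex.I *
      ((isSmooth_potential hQ c).toC x : ℂ)) (by fun_prop) (V (s - T) (P ψ₀)))
    have hgc : Continuous g := by
      refine hU.continuous_apply continuous_neg ((ContinuousLinearMap.continuous _).comp ?_)
      exact (hV.isUnitaryGroup.continuous _).comp (by fun_prop)
    have hright : ∀ s, T < s → interaction α Q u' ψ' s = g s := by
      intro s hs
      simp only [interaction, hu', hψ', if_neg (not_le.2 hs)]
      rfl
    -- The derivative of the perturbed group in the interaction picture, shifted to start at T and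
    -- transported by e^{-TL}, integrates exactly over the new piece.
    have hgint : ∀ t, ∫ s in T..t, g s =
        expGroup (opL α) (-t) (V (t - T) (P ψ₀)) - expGroup (opL α) (-T) (P ψ₀) := by
      intro t
      have hd : ∀ s, HasDerivAt (fun s => expGroup (opL α) (-s) (V (s - T) (P ψ₀))) (g s) s := by
        intro s
        have h1 := (hV.hasDerivAt_interaction (P ψ₀) (s - T)).comp_sub_const s T
        have h2 := (expGroup (opL α) (-T)).hasDerivAt_comp h1
        have e : ∀ s x, expGroup (opL α) (-T) (expGroup (opL α) (-(s - T)) x) =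
            expGroup (opL α) (-s) x := fun s x => by
          rw [← hU.map_add]
          congr 2
          ring
        simp only [e] at h2
        exact h2
      have := intervalIntegral.integral_eq_sub_of_hasDerivAt (fun s _ => hd s)
        (hgc.intervalIntegrable T t)
      rwa [sub_self, hV.isUnitaryGroup.map_zero] at this
    have hi1 : ∀ t, 0 ≤ t → t ≤ T → IntervalIntegrable (interaction α Q u' ψ') volume 0 t := by
      intro t ht0 ht
      have h1 : IntervalIntegrable (interaction α Q u ψ) volume 0 t :=
        hint.mono_set (by rw [uIcc_of_le hT, uIcc_of_le ht0]; exact Icc_subset_Icc_right ht)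
      refine h1.congr fun s hs => ?_
      rw [uIoc_of_le ht0] at hs
      exact (hleft s (hs.2.trans ht)).symm
    have hi2 : ∀ t, T ≤ t → IntervalIntegrable (interaction α Q u' ψ') volume T t := by
      intro t ht
      refine (hgc.intervalIntegrable T t).congr fun s hs => ?_
      rw [uIoc_of_le ht] at hs
      exact (hright s hs.1).symm
    have hl : ∀ t, 0 ≤ t → t ≤ T → ∫ s in (0 : ℝ)..t, interaction α Q u' ψ' s =
        ∫ s in (0 : ℝ)..t, interaction α Q u ψ s := by
      intro t ht0 ht
      refine intervalIntegral.integral_congr fun s hs => ?_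
      rw [uIcc_of_le ht0] at hs
      exact hleft s (hs.2.trans ht)
    refine ⟨by positivity, u', hu.extend c hr, ψ', ?_, (hi1 T hT le_rfl).trans
      (hi2 _ (by linarith)), fun t ht => ?_⟩
    · rw [hψ'T _ (by linarith), add_sub_cancel_left]
      rfl
    · rcases le_total t T with htT | htT
      · rw [hl t ht.1 htT, ← h t ⟨ht.1, htT⟩]
        simp only [hψ', if_pos htT]
      · have hr' : ∫ s in T..t, interaction α Q u' ψ' s = ∫ s in T..t, g s := by
          refine intervalIntegral.integral_congr_ae (ae_of_all _ fun s hs => ?_)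
          rw [uIoc_of_le htT] at hs
          exact hright s hs.1
        have hη : ψ₀ + ∫ s in (0 : ℝ)..T, interaction α Q u ψ s =
            expGroup (opL α) (-T) (P ψ₀) := by
          rw [← hψT, h T ⟨hT, le_rfl⟩, hU.neg_apply]
        rw [hψ'T t htT, ← intervalIntegral.integral_add_adjacent_intervals (hi1 T hT le_rfl)
          (hi2 t htT), hl T hT le_rfl, hr', hgint, ← add_assoc, hη, add_sub_cancel, hU.apply_neg]

theorem IsEvolution.trans {α : ℝ} {Q : Fin q → Torus → ℝ} {hQ : ∀ j, IsSmooth (Q j)}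
    {T T' : ℝ} {P P' : L2 → L2} (hP : IsEvolution α hQ T P) (hP' : IsEvolution α hQ T' P') :
    IsEvolution α hQ (T + T') (P' ∘ P) := by
  induction hP' with
  | refl => simpa using hP
  | step c ht _ ih =>
    rw [← add_assoc]
    exact ih.step c ht

theorem IsEvolution.norm_sub {α : ℝ} {Q : Fin q → Torus → ℝ} {hQ : ∀ j, IsSmooth (Q j)}
    {T : ℝ} {P : L2 → L2} (hP : IsEvolution α hQ T P) (ψ η : L2) :
    ‖P ψ - P η‖ = ‖ψ - η‖ := by
  induction hP with
  | refl => rfl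
  | step c ht _ ih =>
    rw [Function.comp, Function.comp, ← map_sub, LinearIsometryEquiv.norm_map, ih]

/-- `S` is approximately reachable in times arbitrarily close to `T`, or smaller. -/
def IsReachable (α : ℝ) {Q : Fin q → Torus → ℝ} (hQ : ∀ j, IsSmooth (Q j)) (T : ℝ)
    (S : L2 → L2) : Prop :=
  ∀ ψ, ∀ η > 0, ∃ T' ≤ T + η, ∃ P, IsEvolution α hQ T' P ∧ ‖P ψ - S ψ‖ < η

namespace IsReachable

variable {α : ℝ} {Q : Fin q → Torus → ℝ} {hQ : ∀ j, IsSmooth (Q j)}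

theorem isSTAR {S : L2 ≃ₗᵢ[ℂ] L2} (h : IsReachable α hQ 0 S) : IsSTAR α Q S := by
  intro ψ₀ _ ε hε
  obtain ⟨T, hT, P, hP, hPS⟩ := h ψ₀ ε hε
  obtain ⟨hT0, u, hu, ψ, hψT, hint, hψ⟩ := hP.exists_solution ψ₀
  -- No global phase is needed: the operator itself is approximated, so β = 0.
  refine ⟨T, ⟨hT0, by simpa using hT⟩, 0, ⟨le_rfl, Real.two_pi_pos⟩, u, hu, ψ,
    isSolution_of_interaction hT0 hint hψ, ?_⟩
  simpa [hψT] using hPS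

/-- Evolutions are isometric, so the second one does not enlarge the error of the first, and half
the tolerance goes to each. -/
theorem comp {T T' : ℝ} {S S' : L2 → L2} (h : IsReachable α hQ T S)
    (h' : IsReachable α hQ T' S') : IsReachable α hQ (T + T') (S' ∘ S) := by
  intro ψ η hη
  obtain ⟨T₁, hT₁, P, hP, hPS⟩ := h ψ (η / 2) (by positivity)
  obtain ⟨T₂, hT₂, P', hP', hPS'⟩ := h' (S ψ) (η / 2) (by positivity)
  refine ⟨T₁ + T₂, by linarith, P' ∘ P, hP.trans hP', ?_⟩
  have h1 : (P' ∘ P) ψ - (S' ∘ S) ψ = (P' (P ψ) - P' (S ψ)) + (P' (S ψ) - S' (S ψ)) := by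
    simp only [Function.comp]
    abel
  rw [h1]
  refine (norm_add_le _ _).trans_lt ?_
  rw [hP'.norm_sub]
  linarith

theorem of_approx {T : ℝ} {S : L2 → L2}
    (h : ∀ ψ, ∀ η > 0, ∃ T' ≤ T + η, ∃ S', IsReachable α hQ T' S' ∧ ‖S' ψ - S ψ‖ < η) :
    IsReachable α hQ T S := by
  intro ψ η hη
  obtain ⟨T₁, hT₁, S', hS', h1⟩ := h ψ (η / 2) (by positivity)
  obtain ⟨T₂, hT₂, P, hP, h2⟩ := hS' ψ (η / 2) (by positivity)
  refine ⟨T₂, by linarith, P, hP, ?_⟩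
  have h3 := norm_add_le (P ψ - S' ψ) (S' ψ - S ψ)
  rw [sub_add_sub_cancel] at h3
  linarith

protected theorem id : IsReachable α hQ 0 id := fun ψ η hη =>
  ⟨0, by linarith, id, .refl, by simpa using hη⟩

theorem iterate {T : ℝ} {S : L2 → L2} (h : IsReachable α hQ T S) (n : ℕ) :
    IsReachable α hQ (n * T) S^[n] := by
  induction n with
  | zero => simpa using IsReachable.id (α := α) (hQ := hQ)
  | succ n ih =>
    rw [Function.iterate_succ']
    have := ih.comp h
    push_cast
    rwa [add_mul, one_mul]

theorem constGroup (c : Fin q → ℝ) {t : ℝ} (ht : 0 ≤ t) :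
    IsReachable α hQ t (constGroup α hQ c t) := fun ψ η hη => by
  refine ⟨0 + t, by linarith, _, IsEvolution.refl.step c ht, by simpa using hη⟩

theorem expL {t : ℝ} (ht : 0 ≤ t) : IsReachable α hQ t (expGroup (opL α) t) := by
  have h : KdVTransport.constGroup α hQ 0 t = expGroup (opL α) t := by
    ext1 ψ
    rw [(constGroup_spec α hQ 0).duhamel (isUnitaryGroup_expL α)]
    have h0 : ∀ χ : L2, mulCLM (fun x => Complex.I * ((isSmooth_potential hQ 0).toC x : ℂ))
        (by fun_prop) χ = 0 := by
      intro χ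
      rw [mulCLM_apply]
      refine mulOp_ae_eq (by fun_prop) ?_
      filter_upwards [Lp.coeFn_zero ℂ 2 (AddCircle.haarAddCircle : Measure Torus)] with x hx
      rw [hx]
      simp [potential]
    simp only [h0, map_zero, intervalIntegral.integral_zero, add_zero]
  rw [← h]
  exact IsReachable.constGroup 0 ht

end IsReachable

end Control

/-! ### Reachability of phases, then of the transport operator. -/

section PhaseReachability

theorem IsSmooth.const_mul {θ : Torus → ℝ} (h : IsSmooth θ) (c : ℝ) : IsSmooth fun x => c * θ x :=
  contDiff_const.mul h

/-- `IsUnitaryGroup.tendsto_of_core` for limits that are phase groups; multiplication by e^{itθ}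
keeps smooth functions smooth. -/
theorem tendsto_phase {ι : Type*} {l : Filter ι} {V : ι → ℝ → L2 ≃ₗᵢ[ℂ] L2}
    (hV : ∀ i, IsUnitaryGroup (V i)) {θ : Torus → ℝ} (hθ : IsSmooth θ) {A : ι → Smooth → L2}
    (hA : ∀ i F, HasDerivAt (fun t => V i t (Smooth.emb F)) (A i F) 0)
    (hlim : ∀ F, Tendsto (fun i => A i F) l
      (𝓝 (Smooth.emb (Complex.I • (Smooth.ofReal θ hθ * F))))) {t : ℝ} (ht : 0 ≤ t) (ψ : L2) :
    Tendsto (fun i => V i t ψ) l (𝓝 (phase (fun x => t * θ x) ψ)) :=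
  IsUnitaryGroup.tendsto_of_core hV (isUnitaryGroup_phaseGroup hθ.toC) Smooth.denseRange_emb
    (fun F => (hasDerivAt_phaseGroup hθ.toC _).congr_deriv (Smooth.mulOp_I_emb θ hθ F))
    (fun t F => ⟨_, Smooth.phase_emb (fun x => t * θ x) (hθ.const_mul t) F⟩) hA hlim ht ψ

variable {q : ℕ} {α : ℝ} {Q : Fin q → Torus → ℝ} {hQ : ∀ j, IsSmooth (Q j)}

theorem IsReachable.of_tendsto {ι : Type*} {l : Filter ι} [l.NeBot] {T : ℝ} {S : L2 → L2}
    {s : ι → ℝ} {V : ι → L2 → L2} (hs : Tendsto s l (𝓝 T))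
    (hV : ∀ᶠ i in l, IsReachable α hQ (s i) (V i))
    (h : ∀ ψ, Tendsto (fun i => V i ψ) l (𝓝 (S ψ))) : IsReachable α hQ T S := by
  refine .of_approx fun ψ η hη => ?_
  have h1 := Metric.tendsto_nhds.1 (h ψ) η hη
  have h2 := hs.eventually_le_const (lt_add_of_pos_right T hη)
  obtain ⟨i, hi1, hi2, hi3⟩ := (h1.and (h2.and hV)).exists
  exact ⟨s i, hi2, V i, hi3, by rwa [← dist_eq_norm]⟩

/-- A control of size 1/ε during time ε: the rescaled generator εL + i(c·Q) loses its `L` part as ε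
tends to 0. -/
theorem IsReachable.phase_potential (c : Fin q → ℝ) :
    IsReachable α hQ 0 (phase (potential Q c)) := by
  have hU := isUnitaryGroup_expL α
  let V : ℝ → ℝ → L2 ≃ₗᵢ[ℂ] L2 := fun ε t => KdVTransport.constGroup α hQ (ε⁻¹ • c) (ε * t)
  have hp := isSmooth_potential hQ c
  have hε : Tendsto (fun ε : ℝ => ε) (𝓝[>] 0) (𝓝 0) := nhdsWithin_le_nhds
  refine .of_tendsto (l := 𝓝[>] (0 : ℝ)) (s := fun ε => ε) (V := fun ε => V ε 1) hε ?_ fun ψ => ?_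
  · filter_upwards [self_mem_nhdsWithin] with ε (hε : 0 < ε)
    have := IsReachable.constGroup (α := α) (hQ := hQ) (ε⁻¹ • c) hε.le
    simpa only [V, mul_one] using this
  · have := tendsto_phase (l := 𝓝[>] (0 : ℝ)) (V := V)
      (fun ε => (constGroup_spec α hQ (ε⁻¹ • c)).isUnitaryGroup.rescale ε) hp
      (A := fun ε F => Smooth.emb ((ε : ℂ) • (Smooth.L α F +
        Complex.I • (Smooth.ofReal _ (isSmooth_potential hQ (ε⁻¹ • c)) * F))))
      (fun ε F => ?_) (fun F => ?_) zero_le_one ψ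
    · simpa only [one_mul] using this
    · have h1 := hasDerivAt_rescale
        ((constGroup_spec α hQ (ε⁻¹ • c)).hasDerivAt hU (hasDerivAt_expL α F)) ε
      refine h1.congr_deriv ?_
      rw [map_smul, map_add, ← Smooth.mulOp_I_emb]
      rfl
    · have hlim : Tendsto (fun ε : ℝ => Smooth.emb (Complex.I • (Smooth.ofReal _ hp * F)) +
          ε • Smooth.emb (Smooth.L α F)) (𝓝[>] 0)
          (𝓝 (Smooth.emb (Complex.I • (Smooth.ofReal _ hp * F)))) := by
        simpa using tendsto_const_nhds.add (hε.smul_const (Smooth.emb (Smooth.L α F)))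
      refine hlim.congr' ?_
      filter_upwards [self_mem_nhdsWithin] with ε (hε : 0 < ε)
      have e1 : ε • Smooth.emb (Smooth.L α F) = (ε : ℂ) • Smooth.emb (Smooth.L α F) := rfl
      rw [e1, ← map_smul, ← map_add]
      congr 1
      ext x
      have hε' : (ε : ℂ) ≠ 0 := by exact_mod_cast hε.ne'
      simp only [Smooth.add_apply, Smooth.mul_apply, Smooth.smul_apply, Smooth.ofReal_apply,
        potential_smul]
      push_cast
      field_simp
      ring

/-- Conjugating by e^{iθ/ε} and running `L` for time ε³t keeps only the most singular term of
`Smooth.expI_mul_L`, of order ε⁻³; the others carry positive powers of ε. -/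
theorem IsReachable.phase_cube {θ : Torus → ℝ} (hθ : IsSmooth θ)
    (h : ∀ c : ℝ, IsReachable α hQ 0 (phase fun x => c * θ x)) {t : ℝ} (ht : 0 ≤ t) :
    IsReachable α hQ 0 (phase fun x => t * -dx θ x ^ 3) := by
  have hs : ∀ ε : ℝ, IsSmooth fun x => θ x / ε := fun ε => hθ.div_const ε
  let V : ℝ → ℝ → L2 ≃ₗᵢ[ℂ] L2 := fun ε =>
    conjGroup (phaseEquiv (hs ε).toC) fun t => expGroup (opL α) (ε ^ 3 * t)
  set b := Smooth.ofReal (dx θ) hθ.dx with hb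
  have hcube : IsSmooth fun x => -dx θ x ^ 3 := by
    have h : ContDiff ℝ ∞ fun x : ℝ => dx θ x := hθ.dx
    exact (h.pow 3).neg
  have htime : Tendsto (fun ε : ℝ => ε ^ 3 * t) (𝓝[>] 0) (𝓝 0) := by
    have : Continuous fun ε : ℝ => ε ^ 3 * t := by fun_prop
    simpa using (this.tendsto 0).mono_left (nhdsWithin_le_nhds (s := Ioi 0))
  refine .of_tendsto (V := fun ε => V ε t) htime ?_ fun ψ => ?_
  · filter_upwards [self_mem_nhdsWithin] with ε (hε : 0 < ε)
    have h1 := ((h (-ε⁻¹)).comp (IsReachable.expL (t := ε ^ 3 * t) (by positivity))).comp (h ε⁻¹)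
    rw [zero_add, add_zero] at h1
    convert h1 using 1
    funext ψ
    have e1 : (fun x => ε⁻¹ * θ x) = fun x => θ x / ε := by
      funext x
      rw [inv_mul_eq_div]
    have e2 : (fun x => -ε⁻¹ * θ x) = fun x => -(θ x / ε) := by
      funext x
      rw [neg_mul, inv_mul_eq_div]
    rw [e1, e2]
    rfl
  · refine tendsto_phase (fun ε => isUnitaryGroup_conjL α _ _) hcube
      (A := fun ε F => Smooth.emb (((ε ^ 3 : ℝ) : ℂ) • (Smooth.expI (fun x => θ x / ε) (hs ε) *
        Smooth.L α (Smooth.expI (fun x => -(θ x / ε)) (hs ε).neg * F))))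
      (fun ε F => hasDerivAt_conjL α (hs ε).toC (hs ε) (hs ε).neg (ε ^ 3) F) (fun F => ?_) ht ψ
    set G₂ := Smooth.T ((3 : ℂ) • (b * b)) F - (Complex.I * α) • (b * b * F)
    have hlim : Tendsto (fun ε : ℝ => Smooth.emb (Complex.I • (Smooth.ofReal _ hcube * F)) +
        (ε ^ 3 • Smooth.emb (Smooth.L α F) + ε ^ 2 • Smooth.emb (Smooth.conjFst α b F) +
          ε • Smooth.emb G₂)) (𝓝[>] 0)
        (𝓝 (Smooth.emb (Complex.I • (Smooth.ofReal _ hcube * F)))) := by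
      have hc : Continuous fun ε : ℝ => Smooth.emb (Complex.I • (Smooth.ofReal _ hcube * F)) +
          (ε ^ 3 • Smooth.emb (Smooth.L α F) + ε ^ 2 • Smooth.emb (Smooth.conjFst α b F) +
            ε • Smooth.emb G₂) := by fun_prop
      simpa using (hc.tendsto 0).mono_left (nhdsWithin_le_nhds (s := Ioi 0))
    refine hlim.congr' ?_
    filter_upwards [self_mem_nhdsWithin] with ε (hε : 0 < ε)
    have e1 : ∀ (r : ℝ) (ψ : L2), r • ψ = (r : ℂ) • ψ := fun r ψ => rfl
    have hε' : (ε : ℂ) ≠ 0 := by exact_mod_cast hε.ne'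
    rw [Smooth.expI_mul_L α (fun x => θ x / ε) (hs ε) (hs ε).neg (Smooth.ofReal_dx_div θ hθ ε),
      e1, e1, e1, ← map_smul, ← map_smul, ← map_smul, ← map_add, ← map_add, ← map_add, ← hb]
    congr 1
    ext x
    have e3 : b x = ((dx θ x : ℝ) : ℂ) := rfl
    simp only [Smooth.add_apply, Smooth.sub_apply, Smooth.mul_apply, Smooth.smul_apply,
      Smooth.ofReal_apply, G₂, e3]
    push_cast
    field_simp
    ring

variable (α hQ) in
/-- The smooth functions all of whose multiples are reachable phases in small time. -/
def phaseSpace : Submodule ℝ (Torus → ℝ) where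
  carrier := {θ | IsSmooth θ ∧ ∀ c : ℝ, IsReachable α hQ 0 (phase fun x => c * θ x)}
  zero_mem' := by
    refine ⟨contDiff_const, fun c => ?_⟩
    convert IsReachable.id (α := α) (hQ := hQ) using 1
    funext ψ
    simpa using phase_zero ψ
  add_mem' := by
    rintro θ θ' ⟨h1, h2⟩ ⟨h1', h2'⟩
    refine ⟨ContDiff.add h1 h1', fun c => ?_⟩
    have h3 := (h2' c).comp (h2 c)
    rw [add_zero] at h3
    convert h3 using 1
    funext ψ
    rw [Function.comp, phase_add (h1.const_mul c).continuous (h1'.const_mul c).continuous]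
    simp only [Pi.add_apply, mul_add]
  smul_mem' := by
    rintro r θ ⟨h1, h2⟩
    refine ⟨h1.const_mul r, fun c => ?_⟩
    simpa only [Pi.smul_apply, smul_eq_mul, ← mul_assoc] using h2 (c * r)

theorem span_le_phaseSpace : Submodule.span ℝ (Set.range Q) ≤ phaseSpace α hQ := by
  rw [Submodule.span_le]
  rintro _ ⟨j, rfl⟩
  refine ⟨hQ j, fun c => ?_⟩
  have := IsReachable.phase_potential (α := α) (hQ := hQ) (Pi.single j c)
  convert this using 2
  funext x
  simp [potential, Pi.single_apply]

theorem dx_add {θ θ' : Torus → ℝ} (h : IsSmooth θ) (h' : IsSmooth θ') :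
    dx (θ + θ') = dx θ + dx θ' := by
  funext x
  induction x using QuotientAddGroup.induction_on with
  | H x =>
    change dx (θ + θ') (x : Torus) = dx θ (x : Torus) + dx θ' (x : Torus)
    rw [dx_coe]
    exact ((h.hasDerivAt x).add (h'.hasDerivAt x)).deriv

theorem dx_neg {θ : Torus → ℝ} (h : IsSmooth θ) : dx (-θ) = -dx θ := by
  funext x
  induction x using QuotientAddGroup.induction_on with
  | H x =>
    change dx (-θ) (x : Torus) = -dx θ (x : Torus)
    rw [dx_coe]
    exact (h.hasDerivAt x).neg.deriv

theorem cube_mem_phaseSpace {θ : Torus → ℝ} (h : θ ∈ phaseSpace α hQ) :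
    dx θ ^ 3 ∈ phaseSpace α hQ := by
  refine ⟨?_, fun c => ?_⟩
  · have h1 : ContDiff ℝ ∞ fun x : ℝ => dx θ x := h.1.dx
    exact h1.pow 3
  -- `IsReachable.phase_cube` runs forward in time only, but the cube is odd: replacing θ by -θ
  -- supplies the other sign.
  · rcases le_total 0 c with hc | hc
    · have hn := (phaseSpace α hQ).neg_mem h
      have := IsReachable.phase_cube hn.1 hn.2 hc
      rw [dx_neg h.1] at this
      convert this using 2
      funext x
      simp only [Pi.neg_apply, Pi.pow_apply]
      ring
    · have := IsReachable.phase_cube h.1 h.2 (neg_nonneg.2 hc)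
      convert this using 2
      funext x
      simp only [Pi.pow_apply]
      ring

/-- Polarisation of the cubic form θ ↦ (θ')³ on a linear space. -/
theorem mul_mem_phaseSpace {a b c : Torus → ℝ} (ha : a ∈ phaseSpace α hQ)
    (hb : b ∈ phaseSpace α hQ) (hc : c ∈ phaseSpace α hQ) :
    dx a * dx b * dx c ∈ phaseSpace α hQ := by
  set S := phaseSpace α hQ
  have hab := S.add_mem ha hb
  have hbc := S.add_mem hb hc
  have hac := S.add_mem ha hc
  have habc := S.add_mem hab hc
  have key : dx a * dx b * dx c = (1 / 6 : ℝ) • (dx (a + b + c) ^ 3 - dx (a + b) ^ 3 -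
      dx (b + c) ^ 3 - dx (a + c) ^ 3 + dx a ^ 3 + dx b ^ 3 + dx c ^ 3) := by
    rw [dx_add hab.1 hc.1, dx_add ha.1 hb.1, dx_add hb.1 hc.1, dx_add ha.1 hc.1]
    funext x
    simp only [Pi.mul_apply, Pi.smul_apply, Pi.sub_apply, Pi.add_apply, Pi.pow_apply, smul_eq_mul]
    ring
  rw [key]
  exact S.smul_mem _ (S.add_mem (S.add_mem (S.add_mem (S.sub_mem (S.sub_mem (S.sub_mem
    (cube_mem_phaseSpace habc) (cube_mem_phaseSpace hab)) (cube_mem_phaseSpace hbc))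
    (cube_mem_phaseSpace hac)) (cube_mem_phaseSpace ha)) (cube_mem_phaseSpace hb))
    (cube_mem_phaseSpace hc))

/-- The real part of a smooth function. -/
def Smooth.re (F : Smooth) (x : Torus) : ℝ := (F.tor x).re

/-- The imaginary part of a smooth function. -/
def Smooth.im (F : Smooth) (x : Torus) : ℝ := (F.tor x).im

theorem Smooth.dx_re (F : Smooth) : dx F.re = (Smooth.D F).re := by
  funext x
  induction x using QuotientAddGroup.induction_on with
  | H x =>
    exact (dx_coe F.re x).trans
      (Complex.reCLM.hasFDerivAt.comp_hasDerivAt x (F.hasDerivAt x)).deriv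

theorem Smooth.dx_im (F : Smooth) : dx F.im = (Smooth.D F).im := by
  funext x
  induction x using QuotientAddGroup.induction_on with
  | H x =>
    exact (dx_coe F.im x).trans
      (Complex.imCLM.hasFDerivAt.comp_hasDerivAt x (F.hasDerivAt x)).deriv

theorem Smooth.tor_add (F G : Smooth) : (F + G).tor = F.tor + G.tor := by
  funext x
  induction x using QuotientAddGroup.induction_on
  rfl

theorem Smooth.tor_smul (c : ℂ) (F : Smooth) : (c • F).tor = c • F.tor := by
  funext x
  induction x using QuotientAddGroup.induction_on
  rfl

theorem Smooth.tor_mul (F G : Smooth) : (F * G).tor = F.tor * G.tor := by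
  funext x
  induction x using QuotientAddGroup.induction_on
  rfl

theorem Smooth.tor_star (F : Smooth) : (star F).tor = star F.tor := by
  funext x
  induction x using QuotientAddGroup.induction_on
  rfl

variable (α hQ) in
/-- The complexification of `phaseSpace`. -/
def phaseSpaceC : Submodule ℂ Smooth where
  carrier := {F | F.re ∈ phaseSpace α hQ ∧ F.im ∈ phaseSpace α hQ}
  zero_mem' := by
    have h : (0 : Smooth).tor = 0 := by
      funext x
      induction x using QuotientAddGroup.induction_on
      rfl
    constructor
    · convert (phaseSpace α hQ).zero_mem
      funext x
      simp [Smooth.re, h]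
    · convert (phaseSpace α hQ).zero_mem
      funext x
      simp [Smooth.im, h]
  add_mem' := by
    rintro F G ⟨h1, h2⟩ ⟨h3, h4⟩
    constructor
    · convert (phaseSpace α hQ).add_mem h1 h3
      funext x
      simp [Smooth.re, Smooth.tor_add]
    · convert (phaseSpace α hQ).add_mem h2 h4
      funext x
      simp [Smooth.im, Smooth.tor_add]
  smul_mem' := by
    rintro c F ⟨h1, h2⟩
    constructor
    · convert (phaseSpace α hQ).sub_mem ((phaseSpace α hQ).smul_mem c.re h1)
        ((phaseSpace α hQ).smul_mem c.im h2)
      funext x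
      simp [Smooth.re, Smooth.im, Smooth.tor_smul]
    · convert (phaseSpace α hQ).add_mem ((phaseSpace α hQ).smul_mem c.re h2)
        ((phaseSpace α hQ).smul_mem c.im h1)
      funext x
      simp [Smooth.re, Smooth.im, Smooth.tor_smul]

theorem star_mem_phaseSpaceC {F : Smooth} (hF : F ∈ phaseSpaceC α hQ) :
    star F ∈ phaseSpaceC α hQ := by
  constructor
  · convert hF.1 using 1
    funext x
    simp [Smooth.re, Smooth.tor_star]
  · convert (phaseSpace α hQ).neg_mem hF.2
    funext x
    simp [Smooth.im, Smooth.tor_star]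

/-- Real and imaginary parts of a triple product are signed sums of four real triple products. -/
theorem mul_mem_phaseSpaceC {F G H : Smooth} (hF : F ∈ phaseSpaceC α hQ)
    (hG : G ∈ phaseSpaceC α hQ) (hH : H ∈ phaseSpaceC α hQ) :
    Smooth.D F * Smooth.D G * Smooth.D H ∈ phaseSpaceC α hQ := by
  set S := phaseSpace α hQ
  constructor
  · convert S.sub_mem (S.sub_mem (S.sub_mem (mul_mem_phaseSpace hF.1 hG.1 hH.1)
      (mul_mem_phaseSpace hF.2 hG.2 hH.1)) (mul_mem_phaseSpace hF.2 hG.1 hH.2))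
      (mul_mem_phaseSpace hF.1 hG.2 hH.2)
    funext x
    simp only [Smooth.dx_re, Smooth.dx_im, Smooth.re, Smooth.im, Smooth.tor_mul, Pi.sub_apply,
      Pi.mul_apply, Complex.mul_re, Complex.mul_im]
    ring
  · convert S.sub_mem (S.add_mem (S.add_mem (mul_mem_phaseSpace hF.1 hG.1 hH.2)
      (mul_mem_phaseSpace hF.1 hG.2 hH.1)) (mul_mem_phaseSpace hF.2 hG.1 hH.1))
      (mul_mem_phaseSpace hF.2 hG.2 hH.2)
    funext x
    simp only [Smooth.dx_re, Smooth.dx_im, Smooth.re, Smooth.im, Smooth.tor_mul, Pi.sub_apply,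
      Pi.add_apply, Pi.mul_apply, Complex.mul_re, Complex.mul_im]
    ring

theorem Smooth.star_mode (k : ℤ) : star (Smooth.mode k) = Smooth.mode (-k) := by
  ext x
  rw [Smooth.star_apply, Smooth.mode_apply, Smooth.mode_apply, Complex.star_def,
    ← Complex.exp_conj]
  simp

theorem Smooth.mode_add (k l : ℤ) : Smooth.mode (k + l) = Smooth.mode k * Smooth.mode l := by
  ext x
  rw [Smooth.mul_apply, Smooth.mode_apply, Smooth.mode_apply, Smooth.mode_apply, ← Complex.exp_add]
  push_cast
  congr 1
  ring

/-- The frequencies n, 2 and -1 add up to n + 1, and the three derivatives contribute (in)(2i)(-i) =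
2in, nonzero for n ≠ 0. Frequency 2 is needed because triple products of odd modes have odd
frequency. -/
theorem mode_succ_mem_phaseSpaceC (h1 : Smooth.mode 1 ∈ phaseSpaceC α hQ)
    (h2 : Smooth.mode 2 ∈ phaseSpaceC α hQ) {n : ℤ} (hn : n ≠ 0)
    (h : Smooth.mode n ∈ phaseSpaceC α hQ) : Smooth.mode (n + 1) ∈ phaseSpaceC α hQ := by
  have h3 := star_mem_phaseSpaceC h1
  rw [Smooth.star_mode] at h3
  have h4 := (phaseSpaceC α hQ).smul_mem (2 * Complex.I * n)⁻¹ (mul_mem_phaseSpaceC h h2 h3)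
  convert h4 using 1
  rw [show n + 1 = n + 2 + -1 by ring, Smooth.mode_add, Smooth.mode_add]
  ext x
  have hn' : (n : ℂ) ≠ 0 := by exact_mod_cast hn
  simp only [Smooth.D_mode, Smooth.mul_apply, Smooth.smul_apply]
  push_cast
  field_simp
  rw [Complex.I_sq]
  ring

theorem mode_mem_phaseSpaceC (h0 : Smooth.mode 0 ∈ phaseSpaceC α hQ)
    (h1 : Smooth.mode 1 ∈ phaseSpaceC α hQ) (h2 : Smooth.mode 2 ∈ phaseSpaceC α hQ) (k : ℤ) :
    Smooth.mode k ∈ phaseSpaceC α hQ := by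
  have hnat : ∀ n : ℕ, Smooth.mode (n + 1) ∈ phaseSpaceC α hQ := by
    intro n
    induction n with
    | zero => simpa using h1
    | succ n ih =>
      push_cast
      exact mode_succ_mem_phaseSpaceC h1 h2 (by omega) ih
  have hpos : ∀ n : ℕ, Smooth.mode n ∈ phaseSpaceC α hQ := by
    rintro (_ | n)
    · exact h0
    · exact_mod_cast hnat n
  rcases Int.eq_nat_or_neg k with ⟨n, rfl | rfl⟩
  · exact hpos n
  · rw [← Smooth.star_mode]
    exact star_mem_phaseSpaceC (hpos n)

theorem mode_mem_phaseSpaceC_of_isAdmissible (h : IsAdmissible Q) (k : ℤ) :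
    Smooth.mode k ∈ phaseSpaceC α h.1 := by
  have hm : ∀ {θ : Torus → ℝ}, θ ∈ ({(fun _ => 1), sinT, cosT, (fun x => sinT (2 • x)),
      (fun x => cosT (2 • x))} : Set (Torus → ℝ)) → θ ∈ phaseSpace α h.1 :=
    fun hθ => span_le_phaseSpace (h.2 hθ)
  refine mode_mem_phaseSpaceC ⟨?_, ?_⟩ ⟨?_, ?_⟩ ⟨?_, ?_⟩ k
  · convert hm (θ := fun _ => 1) (by simp) using 1
    funext x
    induction x using QuotientAddGroup.induction_on with
    | H x => simp [Smooth.re, Smooth.mode_apply]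
  · convert (phaseSpace α h.1).zero_mem
    funext x
    induction x using QuotientAddGroup.induction_on with
    | H x => simp [Smooth.im, Smooth.mode_apply]
  · convert hm (θ := cosT) (by simp) using 1
    funext x
    induction x using QuotientAddGroup.induction_on with
    | H x =>
      change (Complex.exp (Complex.I * (1 : ℤ) * x)).re = Real.cos x
      simp [Complex.exp_re]
  · convert hm (θ := sinT) (by simp) using 1
    funext x
    induction x using QuotientAddGroup.induction_on with
    | H x =>
      change (Complex.exp (Complex.I * (1 : ℤ) * x)).im = Real.sin x
      simp [Complex.exp_im]
  · convert hm (θ := fun x => cosT (2 • x)) (by simp) using 1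
    funext x
    induction x using QuotientAddGroup.induction_on with
    | H x =>
      change (Complex.exp (Complex.I * (2 : ℤ) * x)).re = Real.cos (2 • x)
      simp [Complex.exp_re]
  · convert hm (θ := fun x => sinT (2 • x)) (by simp) using 1
    funext x
    induction x using QuotientAddGroup.induction_on with
    | H x =>
      change (Complex.exp (Complex.I * (2 : ℤ) * x)).im = Real.sin (2 • x)
      simp [Complex.exp_im]

theorem norm_phase_sub_le {θ θ' : Torus → ℝ} (h : Continuous θ) (h' : Continuous θ') {δ : ℝ}
    (hδ : ∀ x, |θ x - θ' x| ≤ δ) (ψ : L2) : ‖phase θ ψ - phase θ' ψ‖ ≤ δ * ‖ψ‖ := by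
  have e : phase θ ψ - phase θ' ψ = mulOp (fun x => Complex.exp (Complex.I * (θ x : ℂ)) -
      Complex.exp (Complex.I * (θ' x : ℂ))) ψ := by
    rw [sub_eq_iff_eq_add, phase, phase, ← mulOp_add_fun (by fun_prop) (by fun_prop)]
    simp only [sub_add_cancel]
  rw [e]
  refine norm_mulOp_le (by fun_prop) (fun x => le_trans ?_ (hδ x)) ψ
  have e1 : Complex.exp (Complex.I * (θ x : ℂ)) - Complex.exp (Complex.I * (θ' x : ℂ)) =
      Complex.exp (Complex.I * (θ' x : ℂ)) *
        (Complex.exp (Complex.I * ((θ x - θ' x : ℝ) : ℂ)) - 1) := by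
    rw [mul_sub, ← Complex.exp_add, mul_one]
    congr 2
    push_cast
    ring
  rw [e1, norm_mul, mul_comm Complex.I (θ' x : ℂ), Complex.norm_exp_ofReal_mul_I, one_mul]
  exact Real.norm_exp_I_mul_ofReal_sub_one_le

/-- Every phase operator is approximately reachable in small time. -/
theorem IsReachable.phase (h : IsAdmissible Q) {θ : Torus → ℝ} (hθ : Continuous θ) :
    IsReachable α h.1 0 (phase θ) := by
  -- All modes are available, so every trigonometric polynomial comes from the complexified phase
  -- space; uniform approximation of θ, followed by taking real parts, then suffices.
  have hspan : ∀ p ∈ Submodule.span ℂ (Set.range (fourier (T := 2 * π))),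
      ∃ F ∈ phaseSpaceC α h.1, F.tor = p := by
    intro p hp
    induction hp using Submodule.span_induction with
    | mem p hp =>
      obtain ⟨k, rfl⟩ := hp
      exact ⟨_, mode_mem_phaseSpaceC_of_isAdmissible h k, Smooth.tor_mode k⟩
    | zero => exact ⟨(0 : ℂ) • 0, Submodule.smul_mem _ _ (Submodule.zero_mem _), by
        rw [Smooth.tor_smul, zero_smul]; rfl⟩
    | add p p' _ _ ih ih' =>
      obtain ⟨F, hF, hFp⟩ := ih
      obtain ⟨F', hF', hFp'⟩ := ih'
      exact ⟨F + F', Submodule.add_mem _ hF hF', by rw [Smooth.tor_add, hFp, hFp']; rfl⟩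
    | smul c p _ ih =>
      obtain ⟨F, hF, hFp⟩ := ih
      exact ⟨c • F, Submodule.smul_mem _ c hF, by rw [Smooth.tor_smul, hFp]; rfl⟩
  refine .of_approx fun ψ η hη => ?_
  let Θ : C(Torus, ℂ) := ⟨fun x => (θ x : ℂ), by fun_prop⟩
  have hΘ : Θ ∈ closure (Submodule.span ℂ (Set.range (fourier (T := 2 * π))) :
      Set C(Torus, ℂ)) := by
    rw [← Submodule.topologicalClosure_coe, span_fourier_closure_eq_top]
    trivial
  set δ := η / (2 * (‖ψ‖ + 1)) with hδ
  have hδ0 : 0 < δ := by positivity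
  obtain ⟨p, hp, hpΘ⟩ := Metric.mem_closure_iff.1 hΘ δ hδ0
  obtain ⟨F, hF, hFp⟩ := hspan p hp
  have hr := hF.1.2 1
  simp only [one_mul] at hr
  refine ⟨0, by linarith, _, hr, ?_⟩
  have h1 : ∀ x, |F.re x - θ x| ≤ δ := by
    intro x
    have h2 : ‖Θ x - p x‖ ≤ δ := by
      rw [← dist_eq_norm]
      exact (ContinuousMap.dist_apply_le_dist x).trans hpΘ.le
    have h3 := (Complex.abs_re_le_norm (Θ x - p x)).trans h2
    rw [abs_sub_comm, Smooth.re, hFp]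
    simpa [Θ] using h3
  refine (norm_phase_sub_le hF.1.1.continuous hθ h1 ψ).trans_lt ?_
  rw [hδ, div_mul_eq_mul_div, div_lt_iff₀ (by positivity)]
  nlinarith [norm_nonneg ψ]

/-- The approximating products are approximately reachable in time `τ`. -/
theorem IsReachable.approximation (h : IsAdmissible Q) {φ : Torus → ℝ} (hφ : IsSmooth φ) {τ : ℝ}
    (hτ : 0 < τ) {n : ℕ} (hn : n ≠ 0) : IsReachable α h.1 τ (W α φ τ n) := by
  have h1 : IsReachable α h.1 0 _ :=
    IsReachable.phase (α := α) h (θ := fun x => -(φ x / √τ)) (hφ.div_const _).neg.continuous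
  have h2 : IsReachable α h.1 (τ / n) _ := IsReachable.expL (by positivity)
  have h3 : IsReachable α h.1 0 _ :=
    IsReachable.phase (α := α) h (θ := fun x => φ x / √τ) (hφ.div_const _).continuous
  have h4 : IsReachable α h.1 0 _ :=
    IsReachable.phase (α := α) h (θ := fun x => gFun α φ τ x / (n * √τ))
      ((isSmooth_gFun α hφ τ).div_const _).continuous
  -- Phases cost no time, so n blocks of length τ/n are reachable in total time τ.
  have h5 := (((h1.comp h2).comp h3).comp h4).iterate n
  have hn' : (n : ℝ) ≠ 0 := by exact_mod_cast hn
  rw [zero_add, add_zero, add_zero, mul_div_cancel₀ _ hn'] at h5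
  exact h5

/-- The transport along `3 (φ')²` is approximately reachable in small time. -/
theorem IsReachable.transport (h : IsAdmissible Q) {φ : Torus → ℝ} (hφ : IsSmooth φ) :
    IsReachable α h.1 0 (expGroup (opT fun x => 3 * dx φ x ^ 2) 1) := by
  obtain ⟨Wlim, h1, h2⟩ := exists_limit_W α hφ
  refine .of_tendsto (l := 𝓝[>] (0 : ℝ)) (s := fun τ => τ) nhdsWithin_le_nhds ?_ h2
  filter_upwards [self_mem_nhdsWithin] with τ (hτ : 0 < τ)
  exact .of_tendsto tendsto_const_nhds ((eventually_ne_atTop 0).mono fun n hn =>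
    IsReachable.approximation h hφ hτ hn) (h1 τ)

end PhaseReachability

end KdVTransport

end

theorem proposition4p5 (α : ℝ) (φ : Torus → ℝ) (hφ : IsSmooth φ) :
    -- the operators `L` and `T_f`, `f = 3 (φ')²`, do generate unitary groups
    IsUnitaryGroupGeneratedBy (expGroup (opL α)) (opL α) ∧
    IsUnitaryGroupGeneratedBy (expGroup (opT fun x => 3 * dx φ x ^ 2))
      (opT fun x => 3 * dx φ x ^ 2) ∧
    -- the iterated strong limit
    (∃ Wlim : ℝ → L2 → L2,
      (∀ τ > 0, ∀ ψ : L2, Tendsto (fun n : ℕ => W α φ τ n ψ) atTop (𝓝 (Wlim τ ψ))) ∧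
      (∀ ψ : L2, Tendsto (fun τ => Wlim τ ψ) (𝓝[>] 0)
        (𝓝 (expGroup (opT fun x => 3 * dx φ x ^ 2) 1 ψ)))) ∧
    -- small-time approximate reachability
    (∀ (q : ℕ) (Q : Fin q → Torus → ℝ), IsAdmissible Q →
      IsSTAR α Q (expGroup (opT fun x => 3 * dx φ x ^ 2) 1)) := by
  exact ⟨isUnitaryGroupGeneratedBy_opL α,
    (exists_isUnitaryGroupGeneratedBy_opT (isSmooth_three_mul_sq hφ)).1,
    (exists_limit_W α hφ).imp fun _ h => ⟨fun τ _ => h.1 τ, h.2⟩,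
    fun _ _ hQ => (IsReachable.transport hQ hφ).isSTAR⟩
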